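/- Let $X=(X_n)_{n\ge 0}$ be a Markov chain with values in a finite real alphabet $\mathbb S=\{a_1,\dots,a_d\}$, transition matrix $\Lambda=(\lambda_{ij})$, $\lambda_{ij}=\mathrm P(X_n=a_j\mid X_{n-1}=a_i)$, and initial distribution $\nu$. Let $h:\mathbb S\to\mathbb R$, also regarded as the column vector with entries $h_i=h(a_i)$, and for $\sigma>0$ let $$Y^\sigma_n=h(X_n)+\sigma\xi_n,\qquad n\ge 1,$$ where $(\xi_n)_{n\ge 1}$ is an i.i.d. sequence, independent of $X$, whose common law has a probability density $g$ with respect to Lebesgue measure on $\mathbb R$. Let $$\mathcal E^\sigma_n=\min_{\theta\in L^2(\Omega,\mathscr F^{Y^\sigma}_n,\mathrm P)}\mathrm E(X_n-\theta)^2,\qquad \mathscr F^{Y^\sigma}_n=\sigma\{Y^\sigma_m:1\le m\le n\},$$ be the minimal mean square error of estimating $X_n$ from the observations up to time $n$. Assume that $X$ is ergodic, i.e. there is a probability vector $\mu$ with positive entries such that $(\Lambda^*)^n\nu\to\mu$ as $n\to\infty$ for every initial distribution $\nu$ ($^*$ denotes the transpose). Assume also that (a1) $g$ does not vanish on $\mathbb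 R$, is bounded, and is twice differentiable with bounded first and second derivatives; (a2) there is a $\delta>0$ such that $$\int_{-\infty}^\infty\left(\frac{g'(x)}{\min_{|u|\le\delta}g(x+u)}\right)^2g(x)\,dx<\infty\quad\text{and}\quad \int_{-\infty}^\infty\left(\frac{\sup_{|v|\le\delta}|g''(x+v)|}{\min_{|u|\le\delta}g(x+u)}\right)^2g(x)\,dx<\infty .$$ Then the Fisher information $I=\int_{-\infty}^\infty \frac{(g'(x))^2}{g(x)}\,dx$ is finite, and the algebraic Lyapunov equation $$P=\Lambda^*P\Lambda+\big(\mathrm{diag}(\mu)-\mu\mu^*\big)\,h\,I\,h^*\,\big(\mathrm{diag}(\mu)-\mu\mu^*\big)$$ has a unique solution $P$ in the class of (symmetric) nonnegative definite real $d\times d$ matrices with $\sum_{i,j}P_{ij}=0$. Moreover, for every $\sigma>0$ the limit $\mathcal E^\sigma=\lim_{n\to\infty}\mathcal E^\sigma_n$ exists and does not depend on $\nu$, and $$\lim_{\sigma\to\infty}\sigma^2\big(\mathcal E^\infty-\mathcal E^\sigma\big)=a^*Pa,$$ where $a=(a_1,\dots,a_d)^*$ and $\mathcal E^\infty=\sum_i\mu_ia_i^2-\big(\sum_i\mu_ia_i\big)^2$.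 -/

import Mathlib

open MeasureTheory ProbabilityTheory Filter Topology Matrix

noncomputable section

/-- The chain with transition matrix `Λ` is ergodic with limit distribution `μ`: for every initial
distribution `ν` the law `(Λ*)ⁿ ν` of the chain at time `n` converges to one and the same `μ`, and
all entries of `μ` are positive. -/
def IsErgodicWithLimit {d : ℕ} (Λ : Matrix (Fin d) (Fin d) ℝ) (μ : Fin d → ℝ) : Prop :=
  (∀ i, 0 < μ i) ∧
    ∀ ν ∈ stdSimplex ℝ (Fin d), Tendsto (fun n : ℕ => (Λᵀ ^ n) *ᵥ ν) atTop (𝓝 μ)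

/-- `S` is a Markov chain on the indices `0, …, d - 1` of the states, with initial distribution `ν`
and transition matrix `Λ`. -/
structure IsMarkovChain {d : ℕ} {Ω : Type*} [MeasurableSpace Ω] (Pr : Measure Ω)
    (ν : Fin d → ℝ) (Λ : Matrix (Fin d) (Fin d) ℝ) (S : ℕ → Ω → Fin d) : Prop where
  measurable : ∀ n, Measurable (S n)
  path_law : ∀ (n : ℕ) (s : ℕ → Fin d),
    Pr.real {ω | ∀ k ≤ n, S k ω = s k} = ν (s 0) * ∏ k ∈ Finset.range n, Λ (s k) (s (k + 1))

/-- The variables `ξ 0, ξ 1, …` are i.i.d. with density `g` with respect to Lebesgue measure. -/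
structure IsIIDWithDensity {Ω : Type*} [MeasurableSpace Ω] (Pr : Measure Ω)
    (g : ℝ → ℝ) (ξ : ℕ → Ω → ℝ) : Prop where
  measurable : ∀ n, Measurable (ξ n)
  law : ∀ n, Pr.map (ξ n) = volume.withDensity (fun x => ENNReal.ofReal (g x))
  indep : iIndepFun ξ Pr

/-- Signal in additive noise: a Markov chain `S` of state indices and an i.i.d. noise sequence `ξ`
with density `g`, the two sequences being independent. Here `ξ n` is the noise at time `n + 1`. -/
structure IsFilteringModel {d : ℕ} {Ω : Type*} [MeasurableSpace Ω] (Pr : Measure Ω)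
    (ν : Fin d → ℝ) (Λ : Matrix (Fin d) (Fin d) ℝ) (g : ℝ → ℝ)
    (S : ℕ → Ω → Fin d) (ξ : ℕ → Ω → ℝ) : Prop where
  chain : IsMarkovChain Pr ν Λ S
  noise : IsIIDWithDensity Pr g ξ
  indep : IndepFun (fun ω n => S n ω) (fun ω n => ξ n ω) Pr

/-- `observation h σ S ξ n` is the observation at time `n + 1`, namely
`h (X_{n+1}) + σ ξ_{n+1}`; there is no observation at time `0`. -/
def observation {d : ℕ} {Ω : Type*} (h : Fin d → ℝ) (σ : ℝ) (S : ℕ → Ω → Fin d)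
    (ξ : ℕ → Ω → ℝ) (n : ℕ) (ω : Ω) : ℝ :=
  h (S (n + 1) ω) + σ * ξ n ω

/-- The σ-algebra generated by the observations up to time `n`, i.e. by `Y 0, …, Y (n - 1)`. -/
@[reducible]
def observationAlgebra {Ω : Type*} (Y : ℕ → Ω → ℝ) (n : ℕ) : MeasurableSpace Ω :=
  ⨆ m : Fin n, MeasurableSpace.comap (Y m) inferInstance

/-- The minimal mean square error of estimating `Z` by an element of `L²(Ω, m, Pr)`. -/
def minMeanSquareError {Ω : Type*} [MeasurableSpace Ω] (Pr : Measure Ω) (m : MeasurableSpace Ω)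
    (Z : Ω → ℝ) : ℝ :=
  sInf {e : ℝ | ∃ θ : Ω → ℝ, Measurable[m] θ ∧ MemLp θ 2 Pr ∧ e = ∫ ω, (Z ω - θ ω) ^ 2 ∂Pr}

/-- The minimal mean square error at time `n`, for the signal `X_n = a (S n)` and the observations
with noise intensity `σ`. -/
def filteringMMSE {d : ℕ} {Ω : Type*} [MeasurableSpace Ω] (Pr : Measure Ω) (a h : Fin d → ℝ)
    (σ : ℝ) (S : ℕ → Ω → Fin d) (ξ : ℕ → Ω → ℝ) (n : ℕ) : ℝ :=
  minMeanSquareError Pr (observationAlgebra (observation h σ S ξ) n) (fun ω => a (S n ω))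

/-- `min_{|u| ≤ δ} g (x + u)` -/
def localMin (g : ℝ → ℝ) (δ x : ℝ) : ℝ := ⨅ u : Set.Icc (-δ) δ, g (x + u)

/-- `max_{|v| ≤ δ} |f (x + v)|` -/
def localMaxAbs (f : ℝ → ℝ) (δ x : ℝ) : ℝ := ⨆ v : Set.Icc (-δ) δ, |f (x + v)|

/-- The Fisher information of the density `g`. -/
def fisherInformation (g : ℝ → ℝ) : ℝ := ∫ x, (deriv g x) ^ 2 / g x

/-- The matrix `diag(μ) - μ μ*`. -/
def covMatrix {d : ℕ} (μ : Fin d → ℝ) : Matrix (Fin d) (Fin d) ℝ :=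
  Matrix.diagonal μ - Matrix.vecMulVec μ μ

/-- `P` is a nonnegative definite matrix with zero entry sum that solves
`P = Λ* P Λ + (diag(μ) - μ μ*) h I h* (diag(μ) - μ μ*)`. -/
structure IsLyapunovSolution {d : ℕ} (Λ : Matrix (Fin d) (Fin d) ℝ) (μ h : Fin d → ℝ) (I : ℝ)
    (P : Matrix (Fin d) (Fin d) ℝ) : Prop where
  posSemidef : P.PosSemidef
  sum_eq_zero : ∑ i, ∑ j, P i j = 0
  equation : P = Λᵀ * P * Λ + covMatrix μ * (I • Matrix.vecMulVec h h) * covMatrix μ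

end

/-! ### Ergodic transition matrices -/

section Ergodic

variable {d : ℕ} {Λ : Matrix (Fin d) (Fin d) ℝ} {μ : Fin d → ℝ}

/-! Divide the observations by `σ` and take as reference the law under which they are i.i.d. with
density `g`. The unnormalized filter then evolves by i.i.d. random matrices `diag(w) Λᵀ`, where `w j
x = g (x - h j / σ) / g x`, and the mean square error at time `n` is the `n`-th iterate of the
operator `Ψ ↦ E Ψ(A ·)`, applied to `posteriorRisk a` and evaluated at `ν`
(`IsFilteringModel.filteringMMSE_eq`).

Existence of the limit. The risk is positively homogeneous and superadditive, and these properties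
survive the operator. Some power of `Λ` is positive and so are the likelihoods, hence a block of
steps has positive matrices and shrinks the gap between `Ψ` and its linear interpolant at the
vertices by a factor below one (`IsRandomMatrix.exists_gap_contraction`). After many blocks the
iterate is almost linear, and linear functions are moved by powers of `Λᵀ`, which forget `ν`
(`IsRandomMatrix.exists_tendsto_iterate`). The limit may therefore be computed from `ν = μ`.

Asymptotics. The risk is a linear functional minus `explainedSquare a`, and the linear part is
constant under `μ`. A signal transition replaces `b` by `Λ b` in the explained square; an
observation adds a gain which is `σ⁻² I Cov_p(b, h)²` to leading order, `p` being the predicted law,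
uniformly in `p` and in `b` on the unit ball (`eventually_abs_observationGain_sub_le`, dominated
convergence under the integrability hypotheses). Going backwards from time `n`, the gains are taken
at `b = Λ^m a`. Three facts control the errors uniformly in `n`: the gain ignores constants in `b`;
`Λ^m a` approaches a constant square-summably; the predicted law differs from `μ` by `O(1/σ)` in
mean, because the explained squares themselves are `O(σ⁻²)`. This gives
`IsShiftLikelihood.abs_iterate_explainedSquare_sub_le`, with main term `∑ I Cov_μ(Λ^m a, h)²`.

The Lyapunov equation. That sum is the quadratic form at `a` of the series `∑ (Λᵀ)^m R Λ^m` with `R`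
the forcing term, which solves the equation. The difference of two solutions is invariant under `Λᵀ
· Λ`, and a nonnegative definite matrix with zero entry sum kills the constants, onto which `Λ^n`
collapses every vector; so the difference is zero. -/

theorem transpose_pow_mulVec_mem_stdSimplex (hΛ : Λ ∈ rowStochastic ℝ (Fin d)) {ν : Fin d → ℝ}
    (hν : ν ∈ stdSimplex ℝ (Fin d)) (n : ℕ) : (Λᵀ ^ n) *ᵥ ν ∈ stdSimplex ℝ (Fin d) := by
  have h : Λᵀ ^ n ∈ colStochastic ℝ (Fin d) :=
    pow_mem (transpose_mem_colStochastic_iff_mem_rowStochastic.2 hΛ) n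
  refine ⟨nonneg_mulVec_of_mem_colStochastic h hν.1, ?_⟩
  rw [sum_mulVec_of_mem_colStochastic h, hν.2]

theorem IsErgodicWithLimit.mem_stdSimplex [Nonempty (Fin d)] (hμ : IsErgodicWithLimit Λ μ)
    (hΛ : Λ ∈ rowStochastic ℝ (Fin d)) : μ ∈ stdSimplex ℝ (Fin d) := by
  have hν := single_mem_stdSimplex ℝ (Classical.arbitrary (Fin d))
  exact (isClosed_stdSimplex ℝ (Fin d)).mem_of_tendsto (hμ.2 _ hν)
    (Eventually.of_forall fun n => transpose_pow_mulVec_mem_stdSimplex hΛ hν n)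

theorem IsErgodicWithLimit.transpose_mulVec [Nonempty (Fin d)] (hμ : IsErgodicWithLimit Λ μ) :
    Λᵀ *ᵥ μ = μ := by
  have h := hμ.2 _ (single_mem_stdSimplex ℝ (Classical.arbitrary (Fin d)))
  have h1 := (tendsto_add_atTop_iff_nat 1).2 h
  have h2 : Continuous fun v : Fin d → ℝ => Λᵀ *ᵥ v := by fun_prop
  refine tendsto_nhds_unique ((h2.tendsto μ).comp h) (h1.congr fun n => ?_)
  rw [Function.comp_apply, mulVec_mulVec, pow_succ']

theorem IsErgodicWithLimit.transpose_pow_mulVec [Nonempty (Fin d)]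
    (hμ : IsErgodicWithLimit Λ μ) (n : ℕ) : (Λᵀ ^ n) *ᵥ μ = μ := by
  induction n with
  | zero => simp
  | succ n ih => rw [pow_succ, ← mulVec_mulVec, hμ.transpose_mulVec, ih]

theorem IsErgodicWithLimit.dotProduct_pow_mulVec [Nonempty (Fin d)]
    (hμ : IsErgodicWithLimit Λ μ) (n : ℕ) (b : Fin d → ℝ) : μ ⬝ᵥ (Λ ^ n) *ᵥ b = μ ⬝ᵥ b := by
  rw [dotProduct_mulVec, ← mulVec_transpose, transpose_pow, hμ.transpose_pow_mulVec]

theorem IsErgodicWithLimit.tendsto_pow_apply (hμ : IsErgodicWithLimit Λ μ) (i j : Fin d) :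
    Tendsto (fun n => (Λ ^ n) i j) atTop (𝓝 (μ j)) := by
  have h := (tendsto_pi_nhds.1 (hμ.2 _ (single_mem_stdSimplex ℝ i))) j
  refine h.congr fun n => ?_
  simp [← transpose_pow]

/-- The entrywise `ℓ¹` distance between the `m`-step transition matrix and its limit. -/
def mixingDefect (Λ : Matrix (Fin d) (Fin d) ℝ) (μ : Fin d → ℝ) (m : ℕ) : ℝ :=
  ∑ i, ∑ j, |(Λ ^ m) i j - μ j|

theorem mixingDefect_nonneg (Λ : Matrix (Fin d) (Fin d) ℝ) (μ : Fin d → ℝ) (m : ℕ) :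
    0 ≤ mixingDefect Λ μ m :=
  Finset.sum_nonneg fun _ _ => Finset.sum_nonneg fun _ _ => abs_nonneg _

/-- With `Π` the matrix all of whose rows are `μ`, stationarity and unit row sums give `Λ^(m+n) - Π
= (Λ^m - Π)(Λ^n - Π)`, and the `ℓ¹` norm is submultiplicative. -/
theorem mixingDefect_add_le [Nonempty (Fin d)] (hΛ : Λ ∈ rowStochastic ℝ (Fin d))
    (hμ : IsErgodicWithLimit Λ μ) (m n : ℕ) : mixingDefect Λ μ (m + n) ≤ mixingDefect Λ μ m * mixingDefect Λ μ n := by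
  have hsum := sum_row_of_mem_rowStochastic (pow_mem hΛ m)
  have hst : ∀ j, ∑ k, μ k * (Λ ^ n) k j = μ j := fun j => by
    have := congrFun (hμ.transpose_pow_mulVec n) j
    rw [← transpose_pow] at this
    simpa [mulVec, dotProduct, mul_comm] using this
  have hμ1 := (hμ.mem_stdSimplex hΛ).2
  have hsplit : ∀ i j, (Λ ^ (m + n)) i j - μ j =
      ∑ k, ((Λ ^ m) i k - μ k) * ((Λ ^ n) k j - μ j) := fun i j => by
    have : ∀ k, ((Λ ^ m) i k - μ k) * ((Λ ^ n) k j - μ j) =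
        (Λ ^ m) i k * (Λ ^ n) k j - (Λ ^ m) i k * μ j - μ k * (Λ ^ n) k j + μ k * μ j :=
      fun k => by ring
    simp only [this, Finset.sum_add_distrib, Finset.sum_sub_distrib, ← Finset.sum_mul, hsum,
      hst, hμ1, pow_add, mul_apply]
    ring
  have hrow : ∀ k, ∑ j, |(Λ ^ n) k j - μ j| ≤ mixingDefect Λ μ n := fun k =>
    Finset.single_le_sum (f := fun k => ∑ j, |(Λ ^ n) k j - μ j|)
      (fun _ _ => Finset.sum_nonneg fun _ _ => abs_nonneg _) (Finset.mem_univ k)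
  calc mixingDefect Λ μ (m + n)
      ≤ ∑ i, ∑ j, ∑ k, |(Λ ^ m) i k - μ k| * |(Λ ^ n) k j - μ j| := by
        refine Finset.sum_le_sum fun i _ => Finset.sum_le_sum fun j _ => ?_
        rw [hsplit]
        refine (Finset.abs_sum_le_sum_abs _ _).trans_eq (by simp [abs_mul])
    _ = ∑ i, ∑ k, |(Λ ^ m) i k - μ k| * ∑ j, |(Λ ^ n) k j - μ j| := by
        refine Finset.sum_congr rfl fun i _ => ?_
        rw [Finset.sum_comm]
        simp [Finset.mul_sum]
    _ ≤ ∑ i, ∑ k, |(Λ ^ m) i k - μ k| * mixingDefect Λ μ n := by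
        gcongr with i _ k _
        exact hrow k
    _ = mixingDefect Λ μ m * mixingDefect Λ μ n := by
        simp [mixingDefect, Finset.sum_mul]

theorem tendsto_mixingDefect (hμ : IsErgodicWithLimit Λ μ) :
    Tendsto (mixingDefect Λ μ) atTop (𝓝 0) := by
  have : Tendsto (mixingDefect Λ μ) atTop (𝓝 (∑ i : Fin d, ∑ j, |μ j - μ j|)) :=
    tendsto_finsetSum _ fun i _ => tendsto_finsetSum _ fun j _ =>
      ((hμ.tendsto_pow_apply i j).sub_const _).abs
  simpa using this

theorem summable_mixingDefect [Nonempty (Fin d)] (hΛ : Λ ∈ rowStochastic ℝ (Fin d))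
    (hμ : IsErgodicWithLimit Λ μ) :
    Summable (mixingDefect Λ μ) := by
  have h0 := mixingDefect_nonneg Λ μ
  obtain ⟨N, hN⟩ := ((tendsto_mixingDefect hμ).eventually
    (ge_mem_nhds (show (0 : ℝ) < 1 / 2 by norm_num))).exists
  -- Once the defect at `N` is at most `1/2`, the partial sums satisfy `S_n ≤ S_N + S_n / 2`. This
  -- gives summability without extracting a geometric rate.
  refine summable_of_sum_range_le (c := 2 * ∑ m ∈ Finset.range N, mixingDefect Λ μ m) h0 fun n => ?_
  have h1 : ∑ m ∈ Finset.range n, mixingDefect Λ μ (N + m) ≤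
      1 / 2 * ∑ m ∈ Finset.range n, mixingDefect Λ μ m := by
    rw [Finset.mul_sum]
    refine Finset.sum_le_sum fun m _ => (mixingDefect_add_le hΛ hμ N m).trans ?_
    exact mul_le_mul_of_nonneg_right hN (h0 m)
  have h2 := Finset.sum_range_add (mixingDefect Λ μ) N n
  have h3 : ∑ m ∈ Finset.range n, mixingDefect Λ μ m ≤
      ∑ m ∈ Finset.range (N + n), mixingDefect Λ μ m :=
    Finset.sum_le_sum_of_subset_of_nonneg (by simp) fun _ _ _ => h0 _
  linarith

theorem summable_mixingDefect_sq [Nonempty (Fin d)] (hΛ : Λ ∈ rowStochastic ℝ (Fin d))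
    (hμ : IsErgodicWithLimit Λ μ) : Summable fun m => mixingDefect Λ μ m ^ 2 := by
  have h0 := mixingDefect_nonneg Λ μ
  have hs := summable_mixingDefect hΛ hμ
  refine Summable.of_nonneg_of_le (fun m => sq_nonneg _) (fun m => ?_)
    (hs.mul_left (∑' m, mixingDefect Λ μ m))
  rw [sq]
  exact mul_le_mul_of_nonneg_right (hs.le_tsum m fun _ _ => h0 _) (h0 m)

theorem norm_pow_mulVec_sub_le (Λ : Matrix (Fin d) (Fin d) ℝ) (μ : Fin d → ℝ) (m : ℕ)
    (b : Fin d → ℝ) :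
    ‖(fun i => ((Λ ^ m) *ᵥ b) i - μ ⬝ᵥ b)‖ ≤ mixingDefect Λ μ m * ‖b‖ := by
  have h0 := mixingDefect_nonneg Λ μ m
  refine (pi_norm_le_iff_of_nonneg (by positivity)).2 fun i => ?_
  have h1 : ((Λ ^ m) *ᵥ b) i - μ ⬝ᵥ b = ∑ j, ((Λ ^ m) i j - μ j) * b j := by
    simp [mulVec, dotProduct, sub_mul]
  rw [h1, Real.norm_eq_abs]
  calc |∑ j, ((Λ ^ m) i j - μ j) * b j| ≤ ∑ j, |(Λ ^ m) i j - μ j| * ‖b‖ := by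
        refine (Finset.abs_sum_le_sum_abs _ _).trans (Finset.sum_le_sum fun j _ => ?_)
        rw [abs_mul]
        exact mul_le_mul_of_nonneg_left (norm_le_pi_norm b j) (abs_nonneg _)
    _ ≤ mixingDefect Λ μ m * ‖b‖ := by
        rw [← Finset.sum_mul]
        refine mul_le_mul_of_nonneg_right ?_ (norm_nonneg _)
        exact Finset.single_le_sum (f := fun k => ∑ j, |(Λ ^ m) k j - μ j|)
          (fun _ _ => Finset.sum_nonneg fun _ _ => abs_nonneg _) (Finset.mem_univ i)

/-- The constant depends neither on `b` nor on `n`; this is what lets one-step errors be summed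
uniformly in time. -/
theorem exists_sum_norm_pow_mulVec_sub_le [Nonempty (Fin d)] (hΛ : Λ ∈ rowStochastic ℝ (Fin d))
    (hμ : IsErgodicWithLimit Λ μ) : ∃ G : ℝ, 0 ≤ G ∧ ∀ (b : Fin d → ℝ) (n : ℕ),
      ∑ m ∈ Finset.range n, ‖(fun i => ((Λ ^ m) *ᵥ b) i - μ ⬝ᵥ b)‖ ^ 2 ≤ G * ‖b‖ ^ 2 := by
  have hs := summable_mixingDefect_sq hΛ hμ
  refine ⟨∑' m, mixingDefect Λ μ m ^ 2, tsum_nonneg fun _ => sq_nonneg _, fun b n => ?_⟩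
  calc ∑ m ∈ Finset.range n, ‖(fun i => ((Λ ^ m) *ᵥ b) i - μ ⬝ᵥ b)‖ ^ 2
      ≤ ∑ m ∈ Finset.range n, mixingDefect Λ μ m ^ 2 * ‖b‖ ^ 2 := by
        refine Finset.sum_le_sum fun m _ => ?_
        rw [← mul_pow]
        exact pow_le_pow_left₀ (norm_nonneg _) (norm_pow_mulVec_sub_le Λ μ m b) 2
    _ ≤ (∑' m, mixingDefect Λ μ m ^ 2) * ‖b‖ ^ 2 := by
        rw [← Finset.sum_mul]
        exact mul_le_mul_of_nonneg_right (hs.sum_le_tsum _ fun _ _ => sq_nonneg _) (sq_nonneg _)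

theorem IsErgodicWithLimit.exists_pow_pos (hμ : IsErgodicWithLimit Λ μ) :
    ∃ m, ∀ i j, 0 < (Λ ^ m) i j :=
  (eventually_all.2 fun i => eventually_all.2 fun j =>
    (hμ.tendsto_pow_apply i j).eventually (lt_mem_nhds (hμ.1 j))).exists

end Ergodic

/-! ### The algebraic Lyapunov equation -/

section Lyapunov

variable {d : ℕ} {Λ : Matrix (Fin d) (Fin d) ℝ} {μ : Fin d → ℝ}

/-- The covariance of `b` and `h` under the weights `p`. -/
def weightedCov (p b h : Fin d → ℝ) : ℝ := ∑ i, p i * b i * h i - (p ⬝ᵥ b) * (p ⬝ᵥ h)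

/-- Turns the forcing term of the Lyapunov equation into products of covariances with `h`. -/
theorem covMatrix_mulVec_dotProduct (μ h b : Fin d → ℝ) :
    (covMatrix μ *ᵥ h) ⬝ᵥ b = weightedCov μ b h := by
  have : ∀ i, (covMatrix μ *ᵥ h) i = μ i * h i - μ i * (μ ⬝ᵥ h) := fun i => by
    rw [covMatrix, sub_mulVec, Pi.sub_apply, mulVec_diagonal, vecMulVec_mulVec]
    simp
  simp only [dotProduct, this, weightedCov, sub_mul, Finset.sum_sub_distrib]
  congr 1
  · exact Finset.sum_congr rfl fun i _ => by ring
  · rw [Finset.sum_mul]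
    exact Finset.sum_congr rfl fun i _ => by ring

theorem weightedCov_sub_const {p : Fin d → ℝ} (hp : ∑ i, p i = 1) (b h : Fin d → ℝ) (c : ℝ) :
    weightedCov p (fun i => b i - c) h = weightedCov p b h := by
  simp only [weightedCov, dotProduct, mul_sub, sub_mul, Finset.sum_sub_distrib, ← Finset.sum_mul,
    hp]
  have : ∑ x, p x * c * h x = c * ∑ x, p x * h x := by
    rw [Finset.mul_sum]
    exact Finset.sum_congr rfl fun i _ => by ring
  rw [this]
  ring

theorem weightedCov_eq_sum {p : Fin d → ℝ} (b h : Fin d → ℝ) :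
    weightedCov p b h = ∑ i, p i * (b i - p ⬝ᵥ b) * h i := by
  simp only [weightedCov, mul_sub, sub_mul, Finset.sum_sub_distrib]
  congr 1
  rw [dotProduct.eq_def p h, Finset.mul_sum]
  exact Finset.sum_congr rfl fun i _ => by ring

theorem abs_dotProduct_le_of_mem_stdSimplex {p : Fin d → ℝ} (hp : p ∈ stdSimplex ℝ (Fin d))
    (b : Fin d → ℝ) : |p ⬝ᵥ b| ≤ ‖b‖ := by
  calc |p ⬝ᵥ b| ≤ ∑ i, p i * ‖b‖ := by
        refine (Finset.abs_sum_le_sum_abs _ _).trans (Finset.sum_le_sum fun i _ => ?_)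
        rw [abs_mul, abs_of_nonneg (hp.1 i)]
        exact mul_le_mul_of_nonneg_left (norm_le_pi_norm b i) (hp.1 i)
    _ = ‖b‖ := by rw [← Finset.sum_mul, hp.2, one_mul]

theorem abs_weightedCov_le {p : Fin d → ℝ} (hp : p ∈ stdSimplex ℝ (Fin d)) (b h : Fin d → ℝ) :
    |weightedCov p b h| ≤ 2 * (‖b‖ * ‖h‖) := by
  have h1 : |∑ i, p i * b i * h i| ≤ ‖b‖ * ‖h‖ := by
    have := abs_dotProduct_le_of_mem_stdSimplex hp (b * h)
    simp only [dotProduct, Pi.mul_apply, ← mul_assoc] at this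
    exact this.trans (norm_mul_le b h)
  have h2 : |(p ⬝ᵥ b) * (p ⬝ᵥ h)| ≤ ‖b‖ * ‖h‖ := by
    rw [abs_mul]
    exact mul_le_mul (abs_dotProduct_le_of_mem_stdSimplex hp b)
      (abs_dotProduct_le_of_mem_stdSimplex hp h) (abs_nonneg _) (norm_nonneg _)
  rw [weightedCov]
  exact (abs_sub _ _).trans (by linarith)

/-- A covariance ignores constants, so `Λ^m x` may be centred at `μ ⬝ᵥ x`, and the centred vector
decays with the mixing defect. -/
theorem abs_weightedCov_pow_le [Nonempty (Fin d)] (hΛ : Λ ∈ rowStochastic ℝ (Fin d)) (hμ : IsErgodicWithLimit Λ μ)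
    (h x : Fin d → ℝ) (m : ℕ) :
    |weightedCov μ ((Λ ^ m) *ᵥ x) h| ≤ 2 * ‖x‖ * ‖h‖ * mixingDefect Λ μ m := by
  have hμs := hμ.mem_stdSimplex hΛ
  rw [← weightedCov_sub_const hμs.2 _ h (μ ⬝ᵥ x)]
  refine (abs_weightedCov_le hμs _ h).trans ?_
  have := mul_le_mul_of_nonneg_right (norm_pow_mulVec_sub_le Λ μ m x) (norm_nonneg h)
  linarith

/-- The solution of the Lyapunov equation as the series `∑ (Λ*)ᵐ R Λᵐ`. -/
noncomputable def lyapunovSolution (Λ : Matrix (Fin d) (Fin d) ℝ) (μ h : Fin d → ℝ) (I : ℝ) :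
    Matrix (Fin d) (Fin d) ℝ := fun i j =>
  ∑' m : ℕ, I * (weightedCov μ ((Λ ^ m) *ᵥ Pi.single i 1) h *
    weightedCov μ ((Λ ^ m) *ᵥ Pi.single j 1) h)

theorem weightedCov_pow_eq_sum (Λ : Matrix (Fin d) (Fin d) ℝ) (μ h x : Fin d → ℝ) (m : ℕ) :
    weightedCov μ ((Λ ^ m) *ᵥ x) h =
      ∑ i, x i * weightedCov μ ((Λ ^ m) *ᵥ Pi.single i 1) h := by
  simp only [← covMatrix_mulVec_dotProduct, dotProduct_mulVec, dotProduct_single]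
  simp [dotProduct, mul_comm]

/-- The entrywise series converges by square-summability of the mixing defect; expanding `x` and `y`
in the standard basis gives the bilinear form in the shape used for both the equation and the limit.
-/
theorem hasSum_lyapunovSolution [Nonempty (Fin d)] (hΛ : Λ ∈ rowStochastic ℝ (Fin d))
    (hμ : IsErgodicWithLimit Λ μ) (h : Fin d → ℝ) (I : ℝ) (x y : Fin d → ℝ) :
    HasSum (fun m : ℕ => I * (weightedCov μ ((Λ ^ m) *ᵥ x) h * weightedCov μ ((Λ ^ m) *ᵥ y) h))
      (x ⬝ᵥ lyapunovSolution Λ μ h I *ᵥ y) := by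
  have hsum : ∀ x y : Fin d → ℝ, Summable fun m : ℕ =>
      I * (weightedCov μ ((Λ ^ m) *ᵥ x) h * weightedCov μ ((Λ ^ m) *ᵥ y) h) := fun x y => by
    refine Summable.mul_left _ (Summable.of_norm_bounded
      ((summable_mixingDefect_sq hΛ hμ).mul_left ((2 * ‖x‖ * ‖h‖) * (2 * ‖y‖ * ‖h‖)))
      fun m => ?_)
    rw [Real.norm_eq_abs, abs_mul]
    have h0 := mixingDefect_nonneg Λ μ m
    calc _ ≤ (2 * ‖x‖ * ‖h‖ * mixingDefect Λ μ m) * (2 * ‖y‖ * ‖h‖ * mixingDefect Λ μ m) :=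
          mul_le_mul (abs_weightedCov_pow_le hΛ hμ h x m) (abs_weightedCov_pow_le hΛ hμ h y m)
            (abs_nonneg _) (by positivity)
      _ = _ := by ring
  have hP : ∀ i j, HasSum (fun m : ℕ => I * (weightedCov μ ((Λ ^ m) *ᵥ Pi.single i 1) h *
      weightedCov μ ((Λ ^ m) *ᵥ Pi.single j 1) h)) (lyapunovSolution Λ μ h I i j) :=
    fun i j => (hsum _ _).hasSum
  have h1 := hasSum_sum (s := Finset.univ) fun (i : Fin d) _ =>
    hasSum_sum (s := Finset.univ) fun (j : Fin d) _ => (hP i j).mul_left (x i * y j)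
  have e1 : (fun m : ℕ => I * (weightedCov μ ((Λ ^ m) *ᵥ x) h * weightedCov μ ((Λ ^ m) *ᵥ y) h)) =
      fun m => ∑ i, ∑ j, x i * y j * (I * (weightedCov μ ((Λ ^ m) *ᵥ Pi.single i 1) h *
        weightedCov μ ((Λ ^ m) *ᵥ Pi.single j 1) h)) := by
    funext m
    rw [weightedCov_pow_eq_sum Λ μ h x, weightedCov_pow_eq_sum Λ μ h y, Finset.sum_mul_sum,
      Finset.mul_sum]
    refine Finset.sum_congr rfl fun i _ => ?_
    rw [Finset.mul_sum]
    exact Finset.sum_congr rfl fun j _ => by ring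
  have e2 : x ⬝ᵥ lyapunovSolution Λ μ h I *ᵥ y =
      ∑ i, ∑ j, x i * y j * lyapunovSolution Λ μ h I i j := by
    simp only [dotProduct, mulVec, Finset.mul_sum]
    exact Finset.sum_congr rfl fun i _ => Finset.sum_congr rfl fun j _ => by ring
  rw [e1, e2]
  exact h1

/-- Replacing `x, y` by `Λ x, Λ y` shifts the series by one index, so only the term `m = 0` is lost.
-/
theorem dotProduct_lyapunovSolution_mulVec [Nonempty (Fin d)] (hΛ : Λ ∈ rowStochastic ℝ (Fin d))
    (hμ : IsErgodicWithLimit Λ μ) (h : Fin d → ℝ) (I : ℝ) (x y : Fin d → ℝ) :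
    x ⬝ᵥ lyapunovSolution Λ μ h I *ᵥ y =
      (Λ *ᵥ x) ⬝ᵥ lyapunovSolution Λ μ h I *ᵥ (Λ *ᵥ y) +
        I * (weightedCov μ x h * weightedCov μ y h) := by
  have h1 := hasSum_lyapunovSolution hΛ hμ h I x y
  have h2 := hasSum_lyapunovSolution hΛ hμ h I (Λ *ᵥ x) (Λ *ᵥ y)
  simp only [mulVec_mulVec, ← pow_succ] at h2
  have h3 := (hasSum_nat_add_iff (f := fun m : ℕ => I * (weightedCov μ ((Λ ^ m) *ᵥ x) h *
    weightedCov μ ((Λ ^ m) *ᵥ y) h)) 1).1 h2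
  simpa [mulVec_mulVec] using h1.unique h3

theorem eq_of_forall_dotProduct_mulVec {A B : Matrix (Fin d) (Fin d) ℝ}
    (hAB : ∀ x y, x ⬝ᵥ A *ᵥ y = x ⬝ᵥ B *ᵥ y) : A = B := by
  ext i j
  simpa using hAB (Pi.single i 1) (Pi.single j 1)

theorem dotProduct_lyapunov_rhs (Λ : Matrix (Fin d) (Fin d) ℝ) (μ h : Fin d → ℝ) (I : ℝ)
    (P : Matrix (Fin d) (Fin d) ℝ) (x y : Fin d → ℝ) :
    x ⬝ᵥ (Λᵀ * P * Λ + covMatrix μ * (I • vecMulVec h h) * covMatrix μ) *ᵥ y =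
      (Λ *ᵥ x) ⬝ᵥ P *ᵥ (Λ *ᵥ y) + I * (weightedCov μ x h * weightedCov μ y h) := by
  have hsymm : (covMatrix μ)ᵀ = covMatrix μ := by
    simp [covMatrix, transpose_sub, transpose_vecMulVec]
  rw [add_mulVec, dotProduct_add]
  congr 1
  · rw [← mulVec_mulVec, ← mulVec_mulVec, dotProduct_mulVec, vecMul_transpose]
  · rw [← mulVec_mulVec, ← mulVec_mulVec, dotProduct_mulVec, ← mulVec_transpose, hsymm,
      smul_mulVec, dotProduct_smul, vecMulVec_mulVec, dotProduct_mulVec]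
    simp only [op_smul_eq_smul, dotProduct_smul, smul_eq_mul,
      ← covMatrix_mulVec_dotProduct]
    have hs : ∀ u v : Fin d → ℝ, (covMatrix μ *ᵥ u) ⬝ᵥ v = (covMatrix μ *ᵥ v) ⬝ᵥ u := fun u v => by
      rw [dotProduct_comm, dotProduct_mulVec, ← mulVec_transpose, hsymm]
    rw [hs h x, ← dotProduct_mulVec, dotProduct_comm h, hs h y]
    ring

theorem isLyapunovSolution_lyapunovSolution [Nonempty (Fin d)] (hΛ : Λ ∈ rowStochastic ℝ (Fin d))
    (hμ : IsErgodicWithLimit Λ μ) (h : Fin d → ℝ) {I : ℝ} (hI : 0 ≤ I) :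
    IsLyapunovSolution Λ μ h I (lyapunovSolution Λ μ h I) where
  posSemidef := by
    refine PosSemidef.of_dotProduct_mulVec_nonneg ?_ fun x => ?_
    · ext i j
      simp only [conjTranspose_apply, lyapunovSolution, star_trivial]
      exact tsum_congr fun m => by ring
    · rw [star_trivial]
      exact (hasSum_lyapunovSolution hΛ hμ h I x x).nonneg fun m =>
        mul_nonneg hI (mul_self_nonneg _)
  sum_eq_zero := by
    have hμs := hμ.mem_stdSimplex hΛ
    have h1 := hasSum_lyapunovSolution hΛ hμ h I 1 1
    have h0 : ∀ m : ℕ, weightedCov μ ((Λ ^ m) *ᵥ 1) h = 0 := fun m => by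
      rw [one_vecMul_of_mem_rowStochastic (pow_mem hΛ m)]
      simp [weightedCov, dotProduct, hμs.2]
    simp only [h0, mul_zero] at h1
    have := h1.unique hasSum_zero
    simpa [dotProduct, mulVec] using this
  equation := eq_of_forall_dotProduct_mulVec fun x y => by
    rw [dotProduct_lyapunov_rhs, ← dotProduct_lyapunovSolution_mulVec hΛ hμ]

/-- A zero entry sum means that the quadratic form vanishes at the constant vector `1`, and
semidefiniteness upgrades this to `R *ᵥ 1 = 0`. The form of `Q - P` is invariant under `Λ`, and `Λ^n
y` tends to a multiple of `1`. -/
theorem IsLyapunovSolution.unique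
    (hμ : IsErgodicWithLimit Λ μ) {h : Fin d → ℝ} {I : ℝ} {P Q : Matrix (Fin d) (Fin d) ℝ}
    (hP : IsLyapunovSolution Λ μ h I P) (hQ : IsLyapunovSolution Λ μ h I Q) : Q = P := by
  have hone : ∀ {R : Matrix (Fin d) (Fin d) ℝ}, IsLyapunovSolution Λ μ h I R → R *ᵥ 1 = 0 := by
    intro R hR
    refine (hR.posSemidef.dotProduct_mulVec_zero_iff 1).1 ?_
    simpa [dotProduct, mulVec] using hR.sum_eq_zero
  have hstep : ∀ x y, x ⬝ᵥ (Q - P) *ᵥ y = (Λ *ᵥ x) ⬝ᵥ (Q - P) *ᵥ (Λ *ᵥ y) := fun x y => by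
    have h1 : x ⬝ᵥ Q *ᵥ y = _ :=
      (congrArg (fun A => x ⬝ᵥ A *ᵥ y) hQ.equation).trans (dotProduct_lyapunov_rhs ..)
    have h2 : x ⬝ᵥ P *ᵥ y = _ :=
      (congrArg (fun A => x ⬝ᵥ A *ᵥ y) hP.equation).trans (dotProduct_lyapunov_rhs ..)
    simp only [sub_mulVec, dotProduct_sub, h1, h2]
    ring
  have hiter : ∀ (n : ℕ) x y,
      x ⬝ᵥ (Q - P) *ᵥ y = ((Λ ^ n) *ᵥ x) ⬝ᵥ (Q - P) *ᵥ ((Λ ^ n) *ᵥ y) := fun n => by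
    induction n with
    | zero => simp
    | succ n ih => intro x y; rw [ih, hstep]; simp [mulVec_mulVec, pow_succ']
  have hlim : ∀ x : Fin d → ℝ,
      Tendsto (fun n => (Λ ^ n) *ᵥ x) atTop (𝓝 fun _ => μ ⬝ᵥ x) := fun x =>
    tendsto_pi_nhds.2 fun i => tendsto_finsetSum _ fun j _ =>
      (hμ.tendsto_pow_apply i j).mul_const _
  refine eq_of_forall_dotProduct_mulVec fun x y => ?_
  rw [← sub_eq_zero, ← dotProduct_sub, ← sub_mulVec]
  have hc : Continuous fun z : (Fin d → ℝ) × (Fin d → ℝ) => z.1 ⬝ᵥ (Q - P) *ᵥ z.2 := by fun_prop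
  have h1 := (hc.tendsto _).comp ((hlim x).prodMk_nhds (hlim y))
  have h2 : (Q - P) *ᵥ (fun _ => μ ⬝ᵥ y) = 0 := by
    have : (fun _ => μ ⬝ᵥ y) = (μ ⬝ᵥ y) • (1 : Fin d → ℝ) := by ext; simp
    rw [this, mulVec_smul, sub_mulVec, hone hP, hone hQ]
    simp
  simp only [h2, dotProduct_zero] at h1
  exact tendsto_nhds_unique (tendsto_const_nhds.congr fun n => hiter n x y) h1

end Lyapunov

/-! ### Random nonnegative matrices and their transfer operators -/

section Transfer

variable {d : ℕ}

/-- `A` is a random matrix with nonnegative entries and column stochastic mean `L`. -/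
structure IsRandomMatrix {X : Type*} [MeasurableSpace X] (ρ : Measure X)
    (A : X → Matrix (Fin d) (Fin d) ℝ) (L : Matrix (Fin d) (Fin d) ℝ) : Prop where
  measurable : ∀ i j, Measurable fun x => A x i j
  nonneg : ∀ x i j, 0 ≤ A x i j
  integrable : ∀ i j, Integrable (fun x => A x i j) ρ
  integral_eq : ∀ i j, ∫ x, A x i j ∂ρ = L i j
  mem_colStochastic : L ∈ colStochastic ℝ (Fin d)

/-- Measurable functions of linear growth on the nonnegative orthant. -/
structure IsTame (Ψ : (Fin d → ℝ) → ℝ) : Prop where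
  measurable : Measurable Ψ
  bound : ∃ C : ℝ, ∀ q : Fin d → ℝ, 0 ≤ q → |Ψ q| ≤ C * ∑ i, q i

/-- The operator `Ψ ↦ E Ψ(A ·)`. -/
noncomputable def transfer {X : Type*} [MeasurableSpace X] (ρ : Measure X)
    (A : X → Matrix (Fin d) (Fin d) ℝ) (Ψ : (Fin d → ℝ) → ℝ) (q : Fin d → ℝ) : ℝ :=
  ∫ x, Ψ (A x *ᵥ q) ∂ρ

theorem IsTame.exists_nonneg_bound {Ψ : (Fin d → ℝ) → ℝ} (hΨ : IsTame Ψ) :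
    ∃ C : ℝ, 0 ≤ C ∧ ∀ q : Fin d → ℝ, 0 ≤ q → |Ψ q| ≤ C * ∑ i, q i := by
  obtain ⟨C, hC⟩ := hΨ.bound
  refine ⟨|C|, abs_nonneg _, fun q hq => (hC q hq).trans ?_⟩
  exact mul_le_mul_of_nonneg_right (le_abs_self C) (Finset.sum_nonneg fun i _ => hq i)

theorem IsTame.add {Ψ Ψ' : (Fin d → ℝ) → ℝ} (h : IsTame Ψ) (h' : IsTame Ψ') :
    IsTame fun q => Ψ q + Ψ' q := by
  obtain ⟨C, hC⟩ := h.bound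
  obtain ⟨C', hC'⟩ := h'.bound
  refine ⟨h.measurable.add h'.measurable, C + C', fun q hq => ?_⟩
  rw [add_mul]
  exact (abs_add_le _ _).trans (add_le_add (hC q hq) (hC' q hq))

theorem IsTame.const_mul {Ψ : (Fin d → ℝ) → ℝ} (h : IsTame Ψ) (c : ℝ) :
    IsTame fun q => c * Ψ q := by
  obtain ⟨C, hC⟩ := h.bound
  refine ⟨h.measurable.const_mul c, |c| * C, fun q hq => ?_⟩
  rw [abs_mul, mul_assoc]
  exact mul_le_mul_of_nonneg_left (hC q hq) (abs_nonneg c)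

theorem IsTame.dotProduct (c : Fin d → ℝ) : IsTame fun q => c ⬝ᵥ q := by
  refine ⟨by unfold _root_.dotProduct; fun_prop, ‖c‖, fun q hq => ?_⟩
  rw [Finset.mul_sum]
  refine (Finset.abs_sum_le_sum_abs _ _).trans (Finset.sum_le_sum fun i _ => ?_)
  rw [abs_mul, abs_of_nonneg (hq i)]
  exact mul_le_mul_of_nonneg_right (norm_le_pi_norm c i) (hq i)

theorem IsTame.finset_sum {ι : Type*} (s : Finset ι) {Ψ : ι → (Fin d → ℝ) → ℝ}
    (h : ∀ i ∈ s, IsTame (Ψ i)) : IsTame fun q => ∑ i ∈ s, Ψ i q := by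
  classical
  induction s using Finset.induction_on with
  | empty => simpa using IsTame.dotProduct (d := d) 0
  | insert i s hi ih =>
    simp only [Finset.sum_insert hi]
    exact (h i (Finset.mem_insert_self i s)).add
      (ih fun j hj => h j (Finset.mem_insert_of_mem hj))

namespace IsRandomMatrix

variable {X : Type*} [MeasurableSpace X] {ρ : Measure X} {A : X → Matrix (Fin d) (Fin d) ℝ}
  {L : Matrix (Fin d) (Fin d) ℝ}

theorem mulVec_nonneg (hA : IsRandomMatrix ρ A L) (x : X) {q : Fin d → ℝ} (hq : 0 ≤ q) :
    0 ≤ A x *ᵥ q := by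
  intro i
  simp only [mulVec, dotProduct, Pi.zero_apply]
  exact Finset.sum_nonneg fun j _ => mul_nonneg (hA.nonneg x i j) (hq j)

theorem measurable_mulVec (hA : IsRandomMatrix ρ A L) :
    Measurable fun z : (Fin d → ℝ) × X => A z.2 *ᵥ z.1 := by
  refine measurable_pi_lambda _ fun i => ?_
  simp only [mulVec, dotProduct]
  refine Finset.measurable_sum _ fun j _ => ?_
  exact ((hA.measurable i j).comp measurable_snd).mul
    ((measurable_pi_apply j).comp measurable_fst)

theorem measurable_mulVec_right (hA : IsRandomMatrix ρ A L) (q : Fin d → ℝ) :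
    Measurable fun x => A x *ᵥ q :=
  hA.measurable_mulVec.comp (measurable_const.prodMk measurable_id)

theorem integrable_mulVec (hA : IsRandomMatrix ρ A L) (q : Fin d → ℝ) (i : Fin d) :
    Integrable (fun x => (A x *ᵥ q) i) ρ := by
  simp only [mulVec, dotProduct]
  exact integrable_finsetSum _ fun j _ => (hA.integrable i j).mul_const _

theorem integral_mulVec (hA : IsRandomMatrix ρ A L) (q : Fin d → ℝ) (i : Fin d) :
    ∫ x, (A x *ᵥ q) i ∂ρ = (L *ᵥ q) i := by
  simp only [mulVec, dotProduct]
  rw [integral_finsetSum _ fun j _ => (hA.integrable i j).mul_const _]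
  simp [integral_mul_const, hA.integral_eq]

theorem integrable_sum_mulVec (hA : IsRandomMatrix ρ A L) (q : Fin d → ℝ) :
    Integrable (fun x => ∑ i, (A x *ᵥ q) i) ρ :=
  integrable_finsetSum _ fun i _ => hA.integrable_mulVec q i

theorem integral_sum_mulVec (hA : IsRandomMatrix ρ A L) (q : Fin d → ℝ) :
    ∫ x, ∑ i, (A x *ᵥ q) i ∂ρ = ∑ i, q i := by
  rw [integral_finsetSum _ fun i _ => hA.integrable_mulVec q i]
  simp_rw [hA.integral_mulVec]
  exact sum_mulVec_of_mem_colStochastic hA.mem_colStochastic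

theorem integrable_comp (hA : IsRandomMatrix ρ A L) {Ψ : (Fin d → ℝ) → ℝ} (hΨ : IsTame Ψ)
    {q : Fin d → ℝ} (hq : 0 ≤ q) : Integrable (fun x => Ψ (A x *ᵥ q)) ρ := by
  obtain ⟨C, hC⟩ := hΨ.bound
  exact ((hA.integrable_sum_mulVec q).const_mul C).mono'
    (hΨ.measurable.comp (hA.measurable_mulVec_right q)).aestronglyMeasurable
    (Eventually.of_forall fun x => hC _ (hA.mulVec_nonneg x hq))

/-- The growth constant is preserved: column stochasticity of the mean makes the expected total mass
of `A x *ᵥ q` equal to that of `q`. -/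
theorem isTame_transfer [SFinite ρ] (hA : IsRandomMatrix ρ A L) {Ψ : (Fin d → ℝ) → ℝ}
    (hΨ : IsTame Ψ) : IsTame (transfer ρ A Ψ) := by
  refine ⟨?_, ?_⟩
  · exact (StronglyMeasurable.integral_prod_right'
      (hΨ.measurable.comp hA.measurable_mulVec).stronglyMeasurable).measurable
  · obtain ⟨C, hC⟩ := hΨ.bound
    refine ⟨C, fun q hq => ?_⟩
    rw [← hA.integral_sum_mulVec q, ← integral_const_mul, ← Real.norm_eq_abs]
    exact norm_integral_le_of_norm_le ((hA.integrable_sum_mulVec q).const_mul C)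
      (Eventually.of_forall fun x => (Real.norm_eq_abs _).trans_le
        (hC _ (hA.mulVec_nonneg x hq)))

theorem transfer_mono (hA : IsRandomMatrix ρ A L) {Ψ Ψ' : (Fin d → ℝ) → ℝ} (hΨ : IsTame Ψ)
    (hΨ' : IsTame Ψ') (h : ∀ q, 0 ≤ q → Ψ q ≤ Ψ' q) {q : Fin d → ℝ} (hq : 0 ≤ q) :
    transfer ρ A Ψ q ≤ transfer ρ A Ψ' q :=
  integral_mono (hA.integrable_comp hΨ hq) (hA.integrable_comp hΨ' hq)
    fun x => h _ (hA.mulVec_nonneg x hq)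

theorem transfer_add (hA : IsRandomMatrix ρ A L) {Ψ Ψ' : (Fin d → ℝ) → ℝ} (hΨ : IsTame Ψ)
    (hΨ' : IsTame Ψ') {q : Fin d → ℝ} (hq : 0 ≤ q) :
    transfer ρ A (fun q => Ψ q + Ψ' q) q = transfer ρ A Ψ q + transfer ρ A Ψ' q :=
  integral_add (hA.integrable_comp hΨ hq) (hA.integrable_comp hΨ' hq)

theorem transfer_dotProduct (hA : IsRandomMatrix ρ A L) (c q : Fin d → ℝ) :
    transfer ρ A (fun q => c ⬝ᵥ q) q = c ⬝ᵥ L *ᵥ q := by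
  simp only [transfer, dotProduct]
  rw [integral_finsetSum _ fun i _ => (hA.integrable_mulVec q i).const_mul _]
  simp_rw [integral_const_mul, hA.integral_mulVec]

theorem isTame_iterate [SFinite ρ] (hA : IsRandomMatrix ρ A L) {Ψ : (Fin d → ℝ) → ℝ}
    (hΨ : IsTame Ψ) (n : ℕ) : IsTame ((transfer ρ A)^[n] Ψ) := by
  induction n with
  | zero => exact hΨ
  | succ n ih => rw [Function.iterate_succ_apply']; exact hA.isTame_transfer ih

theorem iterate_mono [SFinite ρ] (hA : IsRandomMatrix ρ A L) {Ψ Ψ' : (Fin d → ℝ) → ℝ}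
    (hΨ : IsTame Ψ) (hΨ' : IsTame Ψ') (h : ∀ q, 0 ≤ q → Ψ q ≤ Ψ' q) (n : ℕ) :
    ∀ q, 0 ≤ q → (transfer ρ A)^[n] Ψ q ≤ (transfer ρ A)^[n] Ψ' q := by
  induction n with
  | zero => exact h
  | succ n ih =>
    intro q hq
    rw [Function.iterate_succ_apply', Function.iterate_succ_apply']
    exact hA.transfer_mono (hA.isTame_iterate hΨ n) (hA.isTame_iterate hΨ' n) ih hq

theorem iterate_congr [SFinite ρ] (hA : IsRandomMatrix ρ A L) {Ψ Ψ' : (Fin d → ℝ) → ℝ}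
    (hΨ : IsTame Ψ) (hΨ' : IsTame Ψ') (h : ∀ q, 0 ≤ q → Ψ q = Ψ' q) (n : ℕ)
    {q : Fin d → ℝ} (hq : 0 ≤ q) : (transfer ρ A)^[n] Ψ q = (transfer ρ A)^[n] Ψ' q :=
  (hA.iterate_mono hΨ hΨ' (fun q hq => (h q hq).le) n q hq).antisymm
    (hA.iterate_mono hΨ' hΨ (fun q hq => (h q hq).ge) n q hq)

theorem iterate_add [SFinite ρ] (hA : IsRandomMatrix ρ A L) {Ψ Ψ' : (Fin d → ℝ) → ℝ}
    (hΨ : IsTame Ψ) (hΨ' : IsTame Ψ') (n : ℕ) {q : Fin d → ℝ} (hq : 0 ≤ q) :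
    (transfer ρ A)^[n] (fun q => Ψ q + Ψ' q) q =
      (transfer ρ A)^[n] Ψ q + (transfer ρ A)^[n] Ψ' q := by
  induction n generalizing Ψ Ψ' with
  | zero => rfl
  | succ n ih =>
    simp only [Function.iterate_succ_apply]
    rw [← ih (hA.isTame_transfer hΨ) (hA.isTame_transfer hΨ')]
    exact hA.iterate_congr (hA.isTame_transfer (hΨ.add hΨ'))
      ((hA.isTame_transfer hΨ).add (hA.isTame_transfer hΨ'))
      (fun q hq => hA.transfer_add hΨ hΨ' hq) n hq

theorem iterate_const_mul (Ψ : (Fin d → ℝ) → ℝ) (c : ℝ) (n : ℕ) :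
    (transfer ρ A)^[n] (fun q => c * Ψ q) = fun q => c * (transfer ρ A)^[n] Ψ q := by
  induction n generalizing Ψ with
  | zero => rfl
  | succ n ih =>
    simp only [Function.iterate_succ_apply]
    rw [← ih]
    congr 1
    ext q
    exact integral_const_mul c _

theorem iterate_dotProduct (hA : IsRandomMatrix ρ A L) (c : Fin d → ℝ) (n : ℕ)
    (q : Fin d → ℝ) : (transfer ρ A)^[n] (fun q => c ⬝ᵥ q) q = c ⬝ᵥ (L ^ n) *ᵥ q := by
  induction n generalizing c with
  | zero => simp
  | succ n ih =>
    rw [Function.iterate_succ_apply]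
    have : transfer ρ A (fun q => c ⬝ᵥ q) = fun q => (c ᵥ* L) ⬝ᵥ q := by
      ext q
      rw [hA.transfer_dotProduct, dotProduct_mulVec]
    rw [this, ih, ← dotProduct_mulVec, mulVec_mulVec, pow_succ']

theorem iterate_finset_sum [SFinite ρ] (hA : IsRandomMatrix ρ A L) {ι : Type*} (s : Finset ι)
    {Ψ : ι → (Fin d → ℝ) → ℝ} (h : ∀ i ∈ s, IsTame (Ψ i)) (n : ℕ) {q : Fin d → ℝ}
    (hq : 0 ≤ q) :
    (transfer ρ A)^[n] (fun q => ∑ i ∈ s, Ψ i q) q = ∑ i ∈ s, (transfer ρ A)^[n] (Ψ i) q := by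
  classical
  induction s using Finset.induction_on with
  | empty =>
    have := hA.iterate_dotProduct 0 n q
    simpa using this
  | insert i s hi ih =>
    simp only [Finset.sum_insert hi]
    have hs : ∀ j ∈ s, IsTame (Ψ j) := fun j hj => h j (Finset.mem_insert_of_mem hj)
    rw [hA.iterate_add (h i (Finset.mem_insert_self i s)) (IsTame.finset_sum s hs) n hq, ih hs]

/-! #### Products of independent copies -/

theorem mul {Y : Type*} [MeasurableSpace Y] {ρ' : Measure Y}
    {B : Y → Matrix (Fin d) (Fin d) ℝ} {L' : Matrix (Fin d) (Fin d) ℝ} [SFinite ρ] [SFinite ρ']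
    (hA : IsRandomMatrix ρ A L) (hB : IsRandomMatrix ρ' B L') :
    IsRandomMatrix (ρ.prod ρ') (fun z => A z.1 * B z.2) (L * L') where
  measurable i j := by
    simp only [mul_apply]
    exact Finset.measurable_sum _ fun k _ =>
      ((hA.measurable i k).comp measurable_fst).mul ((hB.measurable k j).comp measurable_snd)
  nonneg z i j := by
    rw [mul_apply]
    exact Finset.sum_nonneg fun k _ => mul_nonneg (hA.nonneg _ i k) (hB.nonneg _ k j)
  integrable i j := by
    simp only [mul_apply]
    exact integrable_finsetSum _ fun k _ => (hA.integrable i k).mul_prod (hB.integrable k j)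
  integral_eq i j := by
    simp only [mul_apply]
    rw [integral_finsetSum _ fun k _ => (hA.integrable i k).mul_prod (hB.integrable k j)]
    refine Finset.sum_congr rfl fun k _ => ?_
    rw [integral_prod_mul (fun x => A x i k) fun y => B y k j, hA.integral_eq, hB.integral_eq]
  mem_colStochastic := mul_mem hA.mem_colStochastic hB.mem_colStochastic

/-- Fubini. The right factor acts on `q` first, so its transfer operator is applied last. -/
theorem transfer_mul {Y : Type*} [MeasurableSpace Y] {ρ' : Measure Y}
    {B : Y → Matrix (Fin d) (Fin d) ℝ} {L' : Matrix (Fin d) (Fin d) ℝ} [SFinite ρ] [SFinite ρ']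
    (hA : IsRandomMatrix ρ A L) (hB : IsRandomMatrix ρ' B L') {Ψ : (Fin d → ℝ) → ℝ}
    (hΨ : IsTame Ψ) {q : Fin d → ℝ} (hq : 0 ≤ q) :
    transfer (ρ.prod ρ') (fun z => A z.1 * B z.2) Ψ q = transfer ρ' B (transfer ρ A Ψ) q := by
  simp only [transfer]
  rw [integral_prod_symm _ ((hA.mul hB).integrable_comp hΨ hq)]
  simp only [mulVec_mulVec]

theorem comp_measurePreserving {Y : Type*} [MeasurableSpace Y] {ρ' : Measure Y} {e : Y ≃ᵐ X}
    (he : MeasurePreserving e ρ' ρ) (hA : IsRandomMatrix ρ A L) :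
    IsRandomMatrix ρ' (fun y => A (e y)) L where
  measurable i j := (hA.measurable i j).comp e.measurable
  nonneg y i j := hA.nonneg _ i j
  integrable i j := (he.integrable_comp_emb e.measurableEmbedding).2 (hA.integrable i j)
  integral_eq i j := by
    rw [← hA.integral_eq i j]
    exact he.integral_comp' fun x => A x i j
  mem_colStochastic := hA.mem_colStochastic

end IsRandomMatrix

/-- The product `A (x_{n-1}) ⋯ A (x_0)`. -/
def prodMatrix {X : Type*} (A : X → Matrix (Fin d) (Fin d) ℝ) :
    (n : ℕ) → (Fin n → X) → Matrix (Fin d) (Fin d) ℝ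
  | 0, _ => 1
  | n + 1, x => A (x (Fin.last n)) * prodMatrix A n fun i => x i.castSucc

namespace IsRandomMatrix

variable {X : Type} [MeasurableSpace X] {ρ : Measure X} {A : X → Matrix (Fin d) (Fin d) ℝ}
  {L : Matrix (Fin d) (Fin d) ℝ}

theorem prodMatrix_succ_eq (A : X → Matrix (Fin d) (Fin d) ℝ) (n : ℕ) :
    prodMatrix A (n + 1) = fun x => (fun z : X × (Fin n → X) => A z.1 * prodMatrix A n z.2)
      (MeasurableEquiv.piFinSuccAbove (fun _ => X) (Fin.last n) x) := by
  ext x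
  simp [prodMatrix, MeasurableEquiv.piFinSuccAbove, Fin.insertNthEquiv]
  rfl

theorem prodMatrix [IsProbabilityMeasure ρ] (hA : IsRandomMatrix ρ A L) (n : ℕ) :
    IsRandomMatrix (Measure.pi fun _ : Fin n => ρ) (prodMatrix A n) (L ^ n) := by
  induction n with
  | zero =>
    refine ⟨fun i j => measurable_const, fun x i j => ?_, fun i j => ?_, fun i j => ?_,
      pow_mem hA.mem_colStochastic 0⟩
    · by_cases h : i = j <;> simp [_root_.prodMatrix, one_apply, h]
    · simp [_root_.prodMatrix]
    · simp [_root_.prodMatrix]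
  | succ n ih =>
    rw [prodMatrix_succ_eq, pow_succ']
    exact comp_measurePreserving
      (measurePreserving_piFinSuccAbove (fun _ : Fin (n + 1) => ρ) (Fin.last n)) (hA.mul ih)

/-- Several steps count as one step with a random product matrix. This permits the contraction
argument over a whole positive block and the comparison with the joint law of all observations. -/
theorem iterate_eq_transfer [IsProbabilityMeasure ρ] (hA : IsRandomMatrix ρ A L) (n : ℕ)
    {Ψ : (Fin d → ℝ) → ℝ} (hΨ : IsTame Ψ) {q : Fin d → ℝ} (hq : 0 ≤ q) :
    (transfer ρ A)^[n] Ψ q =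
      transfer (Measure.pi fun _ : Fin n => ρ) (_root_.prodMatrix A n) Ψ q := by
  induction n generalizing Ψ with
  | zero => simp [transfer, _root_.prodMatrix]
  | succ n ih =>
    rw [Function.iterate_succ_apply, ih (hA.isTame_transfer hΨ),
      ← hA.transfer_mul (hA.prodMatrix n) hΨ hq, prodMatrix_succ_eq]
    exact ((measurePreserving_piFinSuccAbove (fun _ : Fin (n + 1) => ρ)
      (Fin.last n)).integral_comp' fun z => Ψ ((A z.1 * _root_.prodMatrix A n z.2) *ᵥ q)).symm

end IsRandomMatrix

end Transfer

/-! ### Stability: contraction of the concavity gap -/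

section Stability

variable {d : ℕ}

/-- Tame, positively homogeneous and superadditive functions on the nonnegative orthant. -/
structure IsSuperlinear (Ψ : (Fin d → ℝ) → ℝ) : Prop where
  isTame : IsTame Ψ
  add_le : ∀ p q : Fin d → ℝ, 0 ≤ p → 0 ≤ q → Ψ p + Ψ q ≤ Ψ (p + q)
  smul : ∀ (c : ℝ) (q : Fin d → ℝ), 0 ≤ c → 0 ≤ q → Ψ (c • q) = c * Ψ q

/-- The linear function that agrees with `Ψ` at the vertices of the simplex. -/
def vertexInterpolant (Ψ : (Fin d → ℝ) → ℝ) (q : Fin d → ℝ) : ℝ :=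
  (fun j => Ψ (Pi.single j 1)) ⬝ᵥ q

namespace IsSuperlinear

variable {Ψ : (Fin d → ℝ) → ℝ}

theorem map_zero (hΨ : IsSuperlinear Ψ) : Ψ 0 = 0 := by
  simpa using hΨ.smul 0 0 le_rfl le_rfl

theorem sum_le (hΨ : IsSuperlinear Ψ) {ι : Type*} (s : Finset ι) (f : ι → Fin d → ℝ)
    (hf : ∀ i, 0 ≤ f i) : ∑ i ∈ s, Ψ (f i) ≤ Ψ (∑ i ∈ s, f i) := by
  classical
  induction s using Finset.induction_on with
  | empty => simp [hΨ.map_zero]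
  | insert i s hi ih =>
    rw [Finset.sum_insert hi, Finset.sum_insert hi]
    exact (add_le_add_right ih _).trans (hΨ.add_le _ _ (hf i) (Finset.sum_nonneg fun j _ => hf j))

/-- Jensen's inequality for the concave homogeneous `Ψ`, as `M *ᵥ q` is the combination of the
columns of `M` with weights `q`. -/
theorem sum_mul_mulVec_single_le (hΨ : IsSuperlinear Ψ) {M : Matrix (Fin d) (Fin d) ℝ}
    (hM : ∀ j, 0 ≤ M *ᵥ Pi.single j 1) {q : Fin d → ℝ} (hq : 0 ≤ q) :
    ∑ j, q j * Ψ (M *ᵥ Pi.single j 1) ≤ Ψ (M *ᵥ q) := by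
  have h1 : M *ᵥ q = ∑ j, q j • M *ᵥ Pi.single j 1 := by
    ext i
    simp [mulVec, dotProduct, mul_comm, Finset.sum_apply]
  rw [h1]
  refine le_trans (le_of_eq (Finset.sum_congr rfl fun j _ => ?_))
    (hΨ.sum_le _ _ fun j => smul_nonneg (hq j) (hM j))
  exact (hΨ.smul _ _ (hq j) (hM j)).symm

theorem vertexInterpolant_le (hΨ : IsSuperlinear Ψ) {q : Fin d → ℝ} (hq : 0 ≤ q) :
    vertexInterpolant Ψ q ≤ Ψ q := by
  have := hΨ.sum_mul_mulVec_single_le (M := 1)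
    (fun j => by rw [one_mulVec]; exact Pi.single_nonneg.2 zero_le_one) hq
  simpa only [one_mulVec, vertexInterpolant, dotProduct, mul_comm] using this

theorem sub_vertexInterpolant (hΨ : IsSuperlinear Ψ) :
    IsSuperlinear fun q => Ψ q - vertexInterpolant Ψ q where
  isTame := by
    have := hΨ.isTame.add ((IsTame.dotProduct fun j => Ψ (Pi.single j 1)).const_mul (-1))
    simpa [vertexInterpolant, sub_eq_add_neg] using this
  add_le p q hp hq := by
    have := hΨ.add_le p q hp hq
    simp only [vertexInterpolant, dotProduct_add]
    linarith
  smul c q hc hq := by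
    simp only [vertexInterpolant, dotProduct_smul, smul_eq_mul, hΨ.smul c q hc hq]
    ring

theorem transfer {X : Type*} [MeasurableSpace X] {ρ : Measure X} [SFinite ρ]
    {A : X → Matrix (Fin d) (Fin d) ℝ} {L : Matrix (Fin d) (Fin d) ℝ}
    (hA : IsRandomMatrix ρ A L) (hΨ : IsSuperlinear Ψ) : IsSuperlinear (transfer ρ A Ψ) where
  isTame := hA.isTame_transfer hΨ.isTame
  add_le p q hp hq := by
    rw [_root_.transfer, _root_.transfer, ← integral_add (hA.integrable_comp hΨ.isTame hp)
      (hA.integrable_comp hΨ.isTame hq)]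
    refine integral_mono ((hA.integrable_comp hΨ.isTame hp).add
      (hA.integrable_comp hΨ.isTame hq)) (hA.integrable_comp hΨ.isTame (add_nonneg hp hq))
      fun x => ?_
    simp only [mulVec_add]
    exact hΨ.add_le _ _ (hA.mulVec_nonneg x hp) (hA.mulVec_nonneg x hq)
  smul c q hc hq := by
    rw [_root_.transfer, _root_.transfer, ← integral_const_mul]
    congr 1
    ext x
    rw [mulVec_smul, hΨ.smul c _ hc (hA.mulVec_nonneg x hq)]

theorem iterate {X : Type*} [MeasurableSpace X] {ρ : Measure X} [SFinite ρ]
    {A : X → Matrix (Fin d) (Fin d) ℝ} {L : Matrix (Fin d) (Fin d) ℝ}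
    (hA : IsRandomMatrix ρ A L) (hΨ : IsSuperlinear Ψ) (n : ℕ) :
    IsSuperlinear ((_root_.transfer ρ A)^[n] Ψ) := by
  induction n with
  | zero => exact hΨ
  | succ n ih => rw [Function.iterate_succ_apply']; exact ih.transfer hA

end IsSuperlinear

/-- The gap between `Ψ` and its vertex interpolant is at most `c` on the simplex. -/
def GapLE (Ψ : (Fin d → ℝ) → ℝ) (c : ℝ) : Prop :=
  ∀ q : Fin d → ℝ, 0 ≤ q → Ψ q - vertexInterpolant Ψ q ≤ c * ∑ i, q i

theorem IsTame.exists_gapLE {Ψ : (Fin d → ℝ) → ℝ} (hΨ : IsTame Ψ) :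
    ∃ c, 0 ≤ c ∧ GapLE Ψ c := by
  have : IsTame fun q => Ψ q - vertexInterpolant Ψ q := by
    have := hΨ.add ((IsTame.dotProduct fun j => Ψ (Pi.single j 1)).const_mul (-1))
    simpa [vertexInterpolant, sub_eq_add_neg] using this
  obtain ⟨c, hc, h⟩ := this.exists_nonneg_bound
  exact ⟨c, hc, fun q hq => (le_abs_self _).trans (h q hq)⟩

theorem sum_mulVec_single (M : Matrix (Fin d) (Fin d) ℝ) (q : Fin d → ℝ) :
    ∑ i, (M *ᵥ q) i = ∑ j, q j * ∑ i, M i j := by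
  simp only [mulVec, dotProduct, Finset.mul_sum]
  rw [Finset.sum_comm]
  exact Finset.sum_congr rfl fun i _ => Finset.sum_congr rfl fun j _ => mul_comm _ _

/-- If all columns of `M` dominate `ε` times one another, the gap contracts by `1 - ε`. -/
theorem IsSuperlinear.gap_mulVec_le {Ψ : (Fin d → ℝ) → ℝ} (hΨ : IsSuperlinear Ψ) {c : ℝ}
    (hc : GapLE Ψ c) {M : Matrix (Fin d) (Fin d) ℝ} (hM : ∀ i j, 0 ≤ M i j) {ε : ℝ}
    (hε0 : 0 ≤ ε) (hε1 : ε ≤ 1) (hε : ∀ k i j, ε * M k i ≤ M k j) {q : Fin d → ℝ}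
    (hq : 0 ≤ q) :
    Ψ (M *ᵥ q) - ∑ j, q j * Ψ (M *ᵥ Pi.single j 1) ≤ (1 - ε) * c * ∑ i, (M *ᵥ q) i := by
  set ψ : (Fin d → ℝ) → ℝ := fun q => Ψ q - vertexInterpolant Ψ q with hψ
  have hψs : IsSuperlinear ψ := hΨ.sub_vertexInterpolant
  have hMq : 0 ≤ M *ᵥ q := fun i => by
    simp only [mulVec, dotProduct, Pi.zero_apply]
    exact Finset.sum_nonneg fun j _ => mul_nonneg (hM i j) (hq j)
  have hMe : ∀ j, 0 ≤ M *ᵥ Pi.single j 1 := fun j i => by simpa using hM i j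
  -- The linear part cancels, so `Ψ` may be replaced by its gap `ψ`, which is nonnegative and
  -- superadditive, hence monotone on the orthant.
  have hlin : Ψ (M *ᵥ q) - ∑ j, q j * Ψ (M *ᵥ Pi.single j 1) =
      ψ (M *ᵥ q) - ∑ j, q j * ψ (M *ᵥ Pi.single j 1) := by
    have h1 : vertexInterpolant Ψ (M *ᵥ q) =
        ∑ j, q j * vertexInterpolant Ψ (M *ᵥ Pi.single j 1) := by
      simp only [vertexInterpolant, dotProduct_mulVec, dotProduct_single]
      simp [dotProduct, mul_comm]
    simp only [hψ, mul_sub, Finset.sum_sub_distrib, h1]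
    ring
  have hψ0 : ∀ p, 0 ≤ p → 0 ≤ ψ p := fun p hp => sub_nonneg.2 (hΨ.vertexInterpolant_le hp)
  have hkey : ε * ψ (M *ᵥ q) ≤ ∑ j, q j * ψ (M *ᵥ Pi.single j 1) := by
    rcases (Finset.sum_nonneg fun i _ => hq i : 0 ≤ ∑ i, q i).eq_or_lt with h0 | h0
    · have hq0 : q = 0 := by
        ext i
        exact (Finset.sum_eq_zero_iff_of_nonneg fun i _ => hq i).1 h0.symm i (Finset.mem_univ i)
      simp [hq0, hψs.map_zero]
    · have hj : ∀ j, ε / (∑ i, q i) * ψ (M *ᵥ q) ≤ ψ (M *ᵥ Pi.single j 1) := fun j => by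
        rw [← hψs.smul _ _ (div_nonneg hε0 h0.le) hMq]
        -- Column `j` dominates a fixed multiple of `M *ᵥ q`, so by monotonicity `ψ` at that column
        -- is at least the same multiple of `ψ (M *ᵥ q)`.
        have hle : (ε / ∑ i, q i) • M *ᵥ q ≤ M *ᵥ Pi.single j 1 := fun k => by
          have : ε * (M *ᵥ q) k ≤ M k j * ∑ i, q i := by
            simp only [mulVec, dotProduct, Finset.mul_sum]
            refine Finset.sum_le_sum fun i _ => ?_
            rw [← mul_assoc]
            exact mul_le_mul_of_nonneg_right (hε k i j) (hq i)
          simpa [div_mul_eq_mul_div, div_le_iff₀ h0] using this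
        have h2 := hψs.add_le _ _ (smul_nonneg (div_nonneg hε0 h0.le) hMq) (sub_nonneg.2 hle)
        rw [add_sub_cancel] at h2
        linarith [hψ0 _ (sub_nonneg.2 hle)]
      calc ε * ψ (M *ᵥ q) = ∑ j, q j * (ε / (∑ i, q i) * ψ (M *ᵥ q)) := by
            rw [← Finset.sum_mul]
            field_simp
        _ ≤ _ := Finset.sum_le_sum fun j _ => mul_le_mul_of_nonneg_left (hj j) (hq j)
  rw [hlin]
  have h3 := mul_le_mul_of_nonneg_left (hc _ hMq) (sub_nonneg.2 hε1)
  rw [← mul_assoc] at h3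
  refine le_trans ?_ h3
  simp only [hψ] at hkey ⊢
  linarith

/-- A positive random matrix contracts concavity gaps. -/
theorem IsRandomMatrix.exists_gap_contraction [Nonempty (Fin d)] {X : Type*} [MeasurableSpace X]
    {ρ : Measure X} [IsProbabilityMeasure ρ] {A : X → Matrix (Fin d) (Fin d) ℝ}
    {L : Matrix (Fin d) (Fin d) ℝ} (hA : IsRandomMatrix ρ A L) (hpos : ∀ x i j, 0 < A x i j) :
    ∃ κ : ℝ, 0 ≤ κ ∧ κ < 1 ∧ ∀ Ψ : (Fin d → ℝ) → ℝ, IsSuperlinear Ψ → ∀ c, 0 ≤ c → GapLE Ψ c →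
      GapLE (transfer ρ A Ψ) (κ * c) := by
  -- The reciprocal of the sum of all entry ratios within rows is a measurable choice of the
  -- domination constant that lies in `(0, 1]`.
  set ε : X → ℝ := fun x => (∑ k, ∑ i, ∑ j, A x k i / A x k j)⁻¹ with hε
  have hterm : ∀ x k i j, A x k i / A x k j ≤ ∑ k, ∑ i, ∑ j, A x k i / A x k j := by
    intro x k i j
    have h0 : ∀ k i j, 0 ≤ A x k i / A x k j := fun k i j =>
      div_nonneg (hpos x k i).le (hpos x k j).le
    calc A x k i / A x k j ≤ ∑ j, A x k i / A x k j :=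
          Finset.single_le_sum (f := fun j => A x k i / A x k j) (fun j _ => h0 k i j)
            (Finset.mem_univ j)
      _ ≤ ∑ i, ∑ j, A x k i / A x k j :=
          Finset.single_le_sum (f := fun i => ∑ j, A x k i / A x k j)
            (fun i _ => Finset.sum_nonneg fun j _ => h0 k i j) (Finset.mem_univ i)
      _ ≤ _ := Finset.single_le_sum (f := fun k => ∑ i, ∑ j, A x k i / A x k j)
            (fun k _ => Finset.sum_nonneg fun i _ => Finset.sum_nonneg fun j _ => h0 k i j)
            (Finset.mem_univ k)
  have hone : ∀ x, 1 ≤ ∑ k, ∑ i, ∑ j, A x k i / A x k j := fun x => by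
    let i : Fin d := Classical.arbitrary _
    have := hterm x i i i
    rwa [div_self (hpos x i i).ne'] at this
  have hε0 : ∀ x, 0 < ε x := fun x => inv_pos.2 (zero_lt_one.trans_le (hone x))
  have hε1 : ∀ x, ε x ≤ 1 := fun x => inv_le_one_of_one_le₀ (hone x)
  have hεle : ∀ x k i j, ε x * A x k i ≤ A x k j := fun x k i j => by
    have h1 := (div_le_iff₀ (hpos x k j)).1 (hterm x k i j)
    rw [hε, inv_mul_le_iff₀ (zero_lt_one.trans_le (hone x))]
    exact h1
  have hεm : Measurable ε := by
    refine Measurable.inv ?_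
    refine Finset.measurable_sum _ fun k _ => Finset.measurable_sum _ fun i _ =>
      Finset.measurable_sum _ fun j _ => (hA.measurable k i).div (hA.measurable k j)
  have hint : ∀ {f : X → ℝ}, Integrable f ρ → Integrable (fun x => ε x * f x) ρ := fun hf =>
    hf.bdd_mul (c := 1) hεm.aestronglyMeasurable (Eventually.of_forall fun x => by
      rw [Real.norm_eq_abs, abs_of_pos (hε0 x)]; exact hε1 x)
  have hcol : ∀ j, Integrable (fun x => ∑ i, A x i j) ρ := fun j =>
    integrable_finsetSum _ fun i _ => hA.integrable i j
  have hκpos : ∀ j, 0 < ∫ x, ε x * ∑ i, A x i j ∂ρ := fun j => by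
    have hp : ∀ x, 0 < ε x * ∑ i, A x i j := fun x =>
      mul_pos (hε0 x) (Finset.sum_pos (fun i _ => hpos x i j) Finset.univ_nonempty)
    rw [integral_pos_iff_support_of_nonneg (fun x => (hp x).le) (hint (hcol j))]
    have : Function.support (fun x => ε x * ∑ i, A x i j) = Set.univ :=
      Set.eq_univ_of_forall fun x => (hp x).ne'
    rw [this]
    simp
  -- No uniform lower bound on `ε` is available or needed: only its mean weighted by a column sum
  -- enters, which is strictly positive. The worst column determines `κ`.
  obtain ⟨j₀, hj₀⟩ := Finite.exists_min fun j => ∫ x, ε x * ∑ i, A x i j ∂ρ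
  refine ⟨1 - ∫ x, ε x * ∑ i, A x i j₀ ∂ρ, ?_, by linarith [hκpos j₀],
    fun Ψ hΨ c hc0 hc q hq => ?_⟩
  · have h1 : ∫ x, ε x * ∑ i, A x i j₀ ∂ρ ≤ ∫ x, ∑ i, A x i j₀ ∂ρ :=
      integral_mono (hint (hcol j₀)) (hcol j₀) fun x =>
        mul_le_of_le_one_left (Finset.sum_nonneg fun i _ => hA.nonneg x i j₀) (hε1 x)
    have h2 : ∫ x, ∑ i, A x i j₀ ∂ρ = 1 := by
      rw [integral_finsetSum _ fun i _ => hA.integrable i j₀]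
      simp_rw [hA.integral_eq]
      exact sum_col_of_mem_colStochastic hA.mem_colStochastic j₀
    linarith
  · have he : ∀ j : Fin d, (0 : Fin d → ℝ) ≤ Pi.single j 1 := fun j =>
      Pi.single_nonneg.2 zero_le_one
    have hintv : ∀ j, Integrable (fun x => q j * Ψ (A x *ᵥ Pi.single j 1)) ρ := fun j =>
      (hA.integrable_comp hΨ.isTame (he j)).const_mul _
    have hleft : transfer ρ A Ψ q - vertexInterpolant (transfer ρ A Ψ) q =
        ∫ x, (Ψ (A x *ᵥ q) - ∑ j, q j * Ψ (A x *ᵥ Pi.single j 1)) ∂ρ := by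
      rw [integral_sub (hA.integrable_comp hΨ.isTame hq)
        (integrable_finsetSum _ fun j _ => hintv j), integral_finsetSum _ fun j _ => hintv j]
      simp only [integral_const_mul, vertexInterpolant, dotProduct, transfer]
      congr 1
      exact Finset.sum_congr rfl fun j _ => mul_comm _ _
    have hsum := hA.integrable_sum_mulVec q
    have hright : ∫ x, (1 - ε x) * c * ∑ i, (A x *ᵥ q) i ∂ρ =
        c * (∑ i, q i - ∑ j, q j * ∫ x, ε x * ∑ i, A x i j ∂ρ) := by
      have h1 : ∀ x, (1 - ε x) * c * ∑ i, (A x *ᵥ q) i =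
          c * (∑ i, (A x *ᵥ q) i - ε x * ∑ i, (A x *ᵥ q) i) := fun x => by ring
      simp_rw [h1]
      rw [integral_const_mul, integral_sub hsum (hint hsum), hA.integral_sum_mulVec]
      congr 2
      simp_rw [sum_mulVec_single, Finset.mul_sum, mul_left_comm _ (q _), ← Finset.mul_sum]
      rw [integral_finsetSum _ fun j _ => (hint (hcol j)).const_mul (q j)]
      simp_rw [integral_const_mul]
    rw [hleft]
    have hint2 : Integrable (fun x => (1 - ε x) * c * ∑ i, (A x *ᵥ q) i) ρ := by
      have h1 : (fun x => (1 - ε x) * c * ∑ i, (A x *ᵥ q) i) =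
          fun x => c * (∑ i, (A x *ᵥ q) i - ε x * ∑ i, (A x *ᵥ q) i) := by
        ext x; ring
      rw [h1]
      exact (hsum.sub (hint hsum)).const_mul c
    calc _ ≤ ∫ x, (1 - ε x) * c * ∑ i, (A x *ᵥ q) i ∂ρ :=
          integral_mono ((hA.integrable_comp hΨ.isTame hq).sub
            (integrable_finsetSum _ fun j _ => hintv j)) hint2 fun x =>
              hΨ.gap_mulVec_le hc (hA.nonneg x) (hε0 x).le (hε1 x) (hεle x) hq
      _ = c * (∑ i, q i - ∑ j, q j * ∫ x, ε x * ∑ i, A x i j ∂ρ) := hright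
      _ ≤ c * (∑ i, q i - ∑ j, q j * ∫ x, ε x * ∑ i, A x i j₀ ∂ρ) := by
          refine mul_le_mul_of_nonneg_left ?_ hc0
          refine sub_le_sub_left (Finset.sum_le_sum fun j _ => ?_) _
          exact mul_le_mul_of_nonneg_left (hj₀ j) (hq j)
      _ = _ := by rw [← Finset.sum_mul]; ring

/-- Filter stability: if some product of copies of `A` is positive and the powers of the mean
converge to a rank one limit, then the iterates converge to a limit that is the same for all initial
probability vectors. -/
theorem IsRandomMatrix.exists_tendsto_iterate [Nonempty (Fin d)] {X : Type} [MeasurableSpace X]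
    {ρ : Measure X} [IsProbabilityMeasure ρ] {A : X → Matrix (Fin d) (Fin d) ℝ}
    {L : Matrix (Fin d) (Fin d) ℝ} (hA : IsRandomMatrix ρ A L) {m : ℕ}
    (hpos : ∀ x i j, 0 < _root_.prodMatrix A m x i j) {μ : Fin d → ℝ}
    (hL : ∀ ν ∈ stdSimplex ℝ (Fin d), Tendsto (fun n => (L ^ n) *ᵥ ν) atTop (𝓝 μ))
    {Ψ : (Fin d → ℝ) → ℝ} (hΨ : IsSuperlinear Ψ) :
    ∃ E : ℝ, ∀ ν ∈ stdSimplex ℝ (Fin d),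
      Tendsto (fun n => (transfer ρ A)^[n] Ψ ν) atTop (𝓝 E) := by
  obtain ⟨κ, hκ0, hκ1, hκ⟩ := (hA.prodMatrix m).exists_gap_contraction hpos
  obtain ⟨c, hc0, hc⟩ := hΨ.isTame.exists_gapLE
  -- The iterate and the transfer of the product matrix are only known to agree on the orthant,
  -- where the vertices lie as well.
  have hgapcongr : ∀ {F G : (Fin d → ℝ) → ℝ}, (∀ q, 0 ≤ q → F q = G q) → ∀ {c}, GapLE G c →
      GapLE F c := by
    intro F G hFG c hG q hq
    have : vertexInterpolant F q = vertexInterpolant G q := by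
      simp only [vertexInterpolant]
      congr 1
      ext j
      exact hFG _ (Pi.single_nonneg.2 zero_le_one)
    rw [hFG q hq, this]
    exact hG q hq
  have hgap : ∀ k : ℕ, GapLE ((transfer ρ A)^[m * k] Ψ) (κ ^ k * c) := fun k => by
    induction k with
    | zero => simpa using hc
    | succ k ih =>
      have h1 := hκ _ (hΨ.iterate hA (m * k)) _ (by positivity) ih
      rw [← mul_assoc, ← pow_succ'] at h1
      refine hgapcongr (fun q hq => ?_) h1
      rw [Nat.mul_succ, add_comm, Function.iterate_add_apply]
      exact hA.iterate_eq_transfer m (hΨ.iterate hA (m * k)).isTame hq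
  -- After `k` blocks the iterate is trapped between the linear functions with coefficients `v` and
  -- `v + κ^k c`. The remaining iterations move these by `L^l`, so both bounds become independent of
  -- `ν` in the limit.
  have hmain : ∀ η > 0, ∃ ℓ : ℝ, ∀ ν ∈ stdSimplex ℝ (Fin d),
      ∀ᶠ n in atTop, |(transfer ρ A)^[n] Ψ ν - ℓ| ≤ η := by
    intro η hη
    have hlim : Tendsto (fun k => κ ^ k * c) atTop (𝓝 0) := by
      simpa using (tendsto_pow_atTop_nhds_zero_of_lt_one hκ0 hκ1).mul_const c
    obtain ⟨k, hk⟩ := (hlim.eventually (ge_mem_nhds (half_pos hη))).exists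
    set Ψk := (transfer ρ A)^[m * k] Ψ with hΨk
    have hΨks : IsSuperlinear Ψk := hΨ.iterate hA (m * k)
    set v : Fin d → ℝ := fun j => Ψk (Pi.single j 1) with hv
    refine ⟨v ⬝ᵥ μ, fun ν hν => ?_⟩
    have hcont : Tendsto (fun n => v ⬝ᵥ (L ^ n) *ᵥ ν) atTop (𝓝 (v ⬝ᵥ μ)) :=
      ((by fun_prop : Continuous fun q : Fin d → ℝ => v ⬝ᵥ q).tendsto μ).comp (hL ν hν)
    have hev := (Metric.tendsto_nhds.1 hcont (η / 2) (half_pos hη))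
    obtain ⟨N, hN⟩ := eventually_atTop.1 hev
    refine eventually_atTop.2 ⟨N + m * k, fun n hn => ?_⟩
    obtain ⟨l, rfl⟩ : ∃ l, n = l + m * k := ⟨n - m * k, by omega⟩
    have hlN : N ≤ l := by omega
    rw [Function.iterate_add_apply, ← hΨk]
    have hlow := hA.iterate_mono (IsTame.dotProduct v) hΨks.isTame
      (fun q hq => hΨks.vertexInterpolant_le hq) l ν hν.1
    have hup := hA.iterate_mono hΨks.isTame (IsTame.dotProduct (v + fun _ => κ ^ k * c))
      (fun q hq => by
        have h1 := hgap k q hq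
        rw [add_dotProduct]
        have h2 : (fun _ => κ ^ k * c) ⬝ᵥ q = κ ^ k * c * ∑ i, q i := by
          simp [dotProduct, Finset.mul_sum]
        rw [h2]
        simp only [vertexInterpolant] at h1
        linarith) l ν hν.1
    rw [hA.iterate_dotProduct] at hlow hup
    have hmass : (fun _ => κ ^ k * c) ⬝ᵥ (L ^ l) *ᵥ ν = κ ^ k * c := by
      have h1 : ∑ i, ((L ^ l) *ᵥ ν) i = 1 := by
        rw [sum_mulVec_of_mem_colStochastic (pow_mem hA.mem_colStochastic l), hν.2]
      simp only [dotProduct]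
      rw [← Finset.mul_sum, h1, mul_one]
    rw [add_dotProduct, hmass] at hup
    have hd := hN l hlN
    rw [Real.dist_eq, abs_lt] at hd
    rw [abs_le]
    constructor <;> linarith
  have hν₀ := single_mem_stdSimplex ℝ (Classical.arbitrary (Fin d))
  set ν₀ : Fin d → ℝ := Pi.single (Classical.arbitrary (Fin d)) 1
  -- The centre `ℓ` depends on `η`, so the limit is first found at one vertex and then transferred
  -- to every `ν`.
  have hcauchy : CauchySeq fun n => (transfer ρ A)^[n] Ψ ν₀ := by
    refine Metric.cauchySeq_iff.2 fun η hη => ?_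
    obtain ⟨ℓ, hℓ⟩ := hmain (η / 3) (by positivity)
    obtain ⟨N, hN⟩ := eventually_atTop.1 (hℓ ν₀ hν₀)
    refine ⟨N, fun a ha b hb => ?_⟩
    have h1 := abs_le.1 (hN a ha)
    have h2 := abs_le.1 (hN b hb)
    rw [Real.dist_eq, abs_lt]
    constructor <;> linarith
  obtain ⟨E, hE⟩ := cauchySeq_tendsto_of_complete hcauchy
  refine ⟨E, fun ν hν => Metric.tendsto_nhds.2 fun η hη => ?_⟩
  obtain ⟨ℓ, hℓ⟩ := hmain (η / 4) (by positivity)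
  filter_upwards [hℓ ν hν, hℓ ν₀ hν₀, Metric.tendsto_nhds.1 hE (η / 4) (by positivity)]
    with n h1 h2 h3
  rw [Real.dist_eq, abs_lt] at h3 ⊢
  rw [abs_le] at h1 h2
  constructor <;> linarith

end Stability

/-! ### The risk of the optimal estimate -/

section Risk

variable {d : ℕ}

/-- Mean square error of the optimal estimate of `a` under the unnormalized weights `q`. -/
noncomputable def posteriorRisk (a q : Fin d → ℝ) : ℝ :=
  (fun i => a i ^ 2) ⬝ᵥ q - (a ⬝ᵥ q) ^ 2 / ∑ i, q i

theorem eq_zero_of_sum_eq_zero {q : Fin d → ℝ} (hq : 0 ≤ q) (h : ∑ i, q i = 0) : q = 0 := by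
  ext i
  exact (Finset.sum_eq_zero_iff_of_nonneg fun i _ => hq i).1 h i (Finset.mem_univ i)

theorem sum_sub_sq_mul (a q : Fin d → ℝ) (t : ℝ) :
    ∑ i, (a i - t) ^ 2 * q i =
      (fun i => a i ^ 2) ⬝ᵥ q - 2 * t * (a ⬝ᵥ q) + t ^ 2 * ∑ i, q i := by
  simp only [dotProduct, Finset.mul_sum, ← Finset.sum_sub_distrib, ← Finset.sum_add_distrib]
  exact Finset.sum_congr rfl fun i _ => by ring

theorem posteriorRisk_eq (a q : Fin d → ℝ) :
    posteriorRisk a q = ∑ i, (a i - (a ⬝ᵥ q) / ∑ i, q i) ^ 2 * q i := by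
  rw [sum_sub_sq_mul, posteriorRisk]
  by_cases h : ∑ i, q i = 0
  · simp [h]
  · field_simp
    ring

/-- The weighted mean minimizes the quadratic error; the excess is a perfect square divided by the
mass. -/
theorem posteriorRisk_le {a q : Fin d → ℝ} (hq : 0 ≤ q) (t : ℝ) :
    posteriorRisk a q ≤ ∑ i, (a i - t) ^ 2 * q i := by
  rw [sum_sub_sq_mul, posteriorRisk]
  rcases (Finset.sum_nonneg fun i _ => hq i : 0 ≤ ∑ i, q i).eq_or_lt with h | h
  · simp [eq_zero_of_sum_eq_zero hq h.symm]
  · have : (fun i => a i ^ 2) ⬝ᵥ q - 2 * t * (a ⬝ᵥ q) + t ^ 2 * ∑ i, q i -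
        ((fun i => a i ^ 2) ⬝ᵥ q - (a ⬝ᵥ q) ^ 2 / ∑ i, q i) =
        (a ⬝ᵥ q - t * ∑ i, q i) ^ 2 / ∑ i, q i := by
      field_simp
      ring
    have h2 : 0 ≤ (a ⬝ᵥ q - t * ∑ i, q i) ^ 2 / ∑ i, q i := by positivity
    linarith

theorem posteriorRisk_nonneg {a q : Fin d → ℝ} (hq : 0 ≤ q) : 0 ≤ posteriorRisk a q := by
  rw [posteriorRisk_eq]
  exact Finset.sum_nonneg fun i _ => mul_nonneg (sq_nonneg _) (hq i)

/-- For nonnegative weights the risk is a minimum over `t` of functionals linear in `q`.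
Superadditivity follows by using the optimal `t` of `p + q` for both summands. -/
theorem isSuperlinear_posteriorRisk (a : Fin d → ℝ) : IsSuperlinear (posteriorRisk a) where
  isTame := by
    refine ⟨by unfold posteriorRisk dotProduct; fun_prop, ‖fun i => a i ^ 2‖, fun q hq => ?_⟩
    rw [abs_of_nonneg (posteriorRisk_nonneg hq), Finset.mul_sum]
    refine (posteriorRisk_le hq 0).trans (Finset.sum_le_sum fun i _ => ?_)
    rw [sub_zero]
    exact mul_le_mul_of_nonneg_right
      ((le_abs_self _).trans (norm_le_pi_norm (fun i => a i ^ 2) i)) (hq i)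
  add_le p q hp hq := by
    rw [posteriorRisk_eq a (p + q)]
    simp only [Pi.add_apply, mul_add, Finset.sum_add_distrib]
    exact add_le_add (posteriorRisk_le hp _) (posteriorRisk_le hq _)
  smul c q hc hq := by
    rw [posteriorRisk, posteriorRisk]
    simp only [dotProduct_smul, smul_eq_mul, Pi.smul_apply, ← Finset.mul_sum]
    rcases hc.eq_or_lt with rfl | hc
    · simp
    · by_cases h : ∑ i, q i = 0
      · simp [h]
      · field_simp

/-- The minimal mean square error in terms of the joint law of a finite signal and a dominated
observation. -/
theorem minMeanSquareError_eq_integral {Ω E : Type*} [MeasurableSpace Ω] [mE : MeasurableSpace E]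
    (Pr : Measure Ω) [IsProbabilityMeasure Pr] {S : Ω → Fin d} {Z : Ω → E} (hS : Measurable S)
    (hZ : Measurable Z) {ρ : Measure E} {q : E → Fin d → ℝ} (hq : Measurable q)
    (hq0 : ∀ y, 0 ≤ q y) (hqi : ∀ j, Integrable (fun y => q y j) ρ)
    (hlaw : ∀ j, (Pr.restrict (S ⁻¹' {j})).map Z =
      ρ.withDensity fun y => ENNReal.ofReal (q y j)) (a : Fin d → ℝ) :
    minMeanSquareError Pr (mE.comap Z) (fun ω => a (S ω)) = ∫ y, posteriorRisk a (q y) ∂ρ := by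
  have hqm : ∀ j, Measurable fun y => ENNReal.ofReal (q y j) := fun j =>
    ((measurable_pi_apply j).comp hq).ennreal_ofReal
  -- Split according to the value of the signal: on each event `S = j` the estimation error depends
  -- on the observation alone, whose restricted law has density `q · j`.
  have hfib : ∀ (ϑ : E → ℝ), Measurable ϑ → Integrable (fun ω => (a (S ω) - ϑ (Z ω)) ^ 2) Pr →
      (∀ j, Integrable (fun y => (a j - ϑ y) ^ 2 * q y j) ρ) ∧
      ∫ ω, (a (S ω) - ϑ (Z ω)) ^ 2 ∂Pr = ∑ j, ∫ y, (a j - ϑ y) ^ 2 * q y j ∂ρ := by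
    intro ϑ hϑ hint
    have hms : ∀ j, MeasurableSet (S ⁻¹' {j}) := fun j => hS (measurableSet_singleton j)
    have hcongr : ∀ j, Set.EqOn (fun ω => (a (S ω) - ϑ (Z ω)) ^ 2)
        (fun ω => (a j - ϑ (Z ω)) ^ 2) (S ⁻¹' {j}) := fun j ω hω => by
      simp only [Set.mem_preimage, Set.mem_singleton_iff] at hω
      simp [hω]
    have hmeas : ∀ j, Measurable fun y => (a j - ϑ y) ^ 2 := fun j => by fun_prop
    have hi : ∀ j, Integrable (fun y => (a j - ϑ y) ^ 2 * q y j) ρ := fun j => by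
      have h1 : IntegrableOn (fun ω => (a j - ϑ (Z ω)) ^ 2) (S ⁻¹' {j}) Pr :=
        (integrableOn_congr_fun (hcongr j) (hms j)).1 hint.integrableOn
      have h2 : Integrable (fun y => (a j - ϑ y) ^ 2) ((Pr.restrict (S ⁻¹' {j})).map Z) :=
        (integrable_map_measure (hmeas j).aestronglyMeasurable hZ.aemeasurable).2 h1
      rw [hlaw j, integrable_withDensity_iff (hqm j) (Eventually.of_forall fun _ => by simp)] at h2
      simpa only [ENNReal.toReal_ofReal (hq0 _ j)] using h2
    refine ⟨hi, ?_⟩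
    have hU : ⋃ j, S ⁻¹' {j} = Set.univ := by ext ω; simp
    rw [← setIntegral_univ, ← hU, integral_iUnion_fintype hms
      (fun i j hij => Disjoint.preimage _ (by simpa using hij)) fun j => hint.integrableOn]
    refine Finset.sum_congr rfl fun j _ => ?_
    rw [setIntegral_congr_fun (hms j) (hcongr j),
      ← integral_map (f := fun y => (a j - ϑ y) ^ 2) hZ.aemeasurable
        (hmeas j).aestronglyMeasurable, hlaw j,
      integral_withDensity_eq_integral_toReal_smul (hqm j) (Eventually.of_forall fun _ => by simp)]
    refine integral_congr_ae (Eventually.of_forall fun y => ?_)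
    simp only [smul_eq_mul, ENNReal.toReal_ofReal (hq0 y j)]
    ring
  have hrisk : Integrable (fun y => posteriorRisk a (q y)) ρ := by
    obtain ⟨C, hC⟩ := (isSuperlinear_posteriorRisk a).isTame.bound
    exact ((integrable_finsetSum _ fun i _ => hqi i).const_mul C).mono'
      ((isSuperlinear_posteriorRisk a).isTame.measurable.comp hq).aestronglyMeasurable
      (Eventually.of_forall fun y => (Real.norm_eq_abs _).trans_le (hC _ (hq0 y)))
  have haS : MemLp (fun ω => a (S ω)) 2 Pr :=
    MemLp.of_bound ((measurable_from_top.comp hS).aestronglyMeasurable) ‖a‖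
      (Eventually.of_forall fun ω => norm_le_pi_norm a (S ω))
  refine IsLeast.csInf_eq ⟨?_, ?_⟩
  · set ϑ : E → ℝ := fun y => (a ⬝ᵥ q y) / ∑ i, q y i with hϑ
    have hqj : ∀ j, Measurable fun y => q y j := fun j => (measurable_pi_apply j).comp hq
    have hϑm : Measurable ϑ := by
      refine Measurable.div ?_ (Finset.measurable_sum _ fun i _ => hqj i)
      unfold dotProduct
      exact Finset.measurable_sum _ fun i _ => (hqj i).const_mul _
    have hϑb : ∀ y, ‖ϑ y‖ ≤ ‖a‖ := fun y => by
      have hs : 0 ≤ ∑ i, q y i := Finset.sum_nonneg fun i _ => hq0 y i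
      rw [hϑ, Real.norm_eq_abs, abs_div, abs_of_nonneg hs]
      refine div_le_of_le_mul₀ hs (norm_nonneg a) ?_
      rw [Finset.mul_sum]
      refine (Finset.abs_sum_le_sum_abs _ _).trans (Finset.sum_le_sum fun i _ => ?_)
      rw [abs_mul, abs_of_nonneg (hq0 y i)]
      exact mul_le_mul_of_nonneg_right (norm_le_pi_norm a i) (hq0 y i)
    have hLp : MemLp (fun ω => ϑ (Z ω)) 2 Pr :=
      MemLp.of_bound (hϑm.comp hZ).aestronglyMeasurable ‖a‖
        (Eventually.of_forall fun ω => hϑb _)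
    refine ⟨fun ω => ϑ (Z ω), hϑm.comp (comap_measurable Z), hLp, ?_⟩
    obtain ⟨h1, h2⟩ := hfib ϑ hϑm (haS.sub hLp).integrable_sq
    rw [h2, ← integral_finsetSum _ fun j _ => h1 j]
    exact integral_congr_ae (Eventually.of_forall fun y => posteriorRisk_eq _ _)
  · rintro e ⟨θ, hθm, hθ, rfl⟩
    -- Doob–Dynkin: any competitor is a measurable function of the observation.
    obtain ⟨ϑ, hϑ, rfl⟩ := hθm.exists_eq_measurable_comp
    obtain ⟨h1, h2⟩ := hfib ϑ hϑ (haS.sub hθ).integrable_sq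
    simp only [Function.comp_apply]
    rw [h2, ← integral_finsetSum _ fun j _ => h1 j]
    exact integral_mono hrisk (integrable_finsetSum _ fun j _ => h1 j)
      fun y => posteriorRisk_le (hq0 y) _

end Risk

/-! ### Joint law of the signal and the observations -/

section JointLaw

variable {d : ℕ}

theorem pi_withDensity_prod {n : ℕ} {X : Type*} [MeasurableSpace X] (γ : Measure X)
    [IsProbabilityMeasure γ] (f : Fin n → X → ENNReal) (hf : ∀ i, Measurable (f i))
    [∀ i, SigmaFinite (γ.withDensity (f i))] :
    Measure.pi (fun i => γ.withDensity (f i)) =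
      (Measure.pi fun _ : Fin n => γ).withDensity fun x => ∏ i, f i (x i) := by
  refine Measure.pi_eq fun s hs => ?_
  rw [withDensity_apply _ (MeasurableSet.univ_pi hs),
    ← lintegral_indicator (MeasurableSet.univ_pi hs)]
  have h1 : ∀ x : Fin n → X, (Set.univ.pi s).indicator (fun x => ∏ i, f i (x i)) x =
      ∏ i, (s i).indicator (f i) (x i) := fun x => by
    classical
    by_cases hx : ∀ i, x i ∈ s i
    · rw [Set.indicator_of_mem (by simpa [Set.mem_univ_pi] using hx)]
      exact Finset.prod_congr rfl fun i _ => (Set.indicator_of_mem (hx i) _).symm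
    · rw [Set.indicator_of_notMem (by simpa [Set.mem_univ_pi] using hx)]
      obtain ⟨i, hi⟩ := not_forall.1 hx
      exact (Finset.prod_eq_zero (Finset.mem_univ i) (Set.indicator_of_notMem hi _)).symm
  have hm : ∀ i, Measurable ((s i).indicator (f i)) := fun i => (hf i).indicator (hs i)
  simp_rw [h1]
  rw [lintegral_prod_eq_prod_lintegral_of_indepFun Finset.univ
    (fun i (x : Fin n → X) => (s i).indicator (f i) (x i))
    (iIndepFun_pi fun i => (hm i).aemeasurable) fun i => (hm i).comp (measurable_pi_apply i)]
  refine Finset.prod_congr rfl fun i _ => ?_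
  rw [(measurePreserving_eval (fun _ : Fin n => γ) i).lintegral_comp (hm i),
    lintegral_indicator (hs i), withDensity_apply _ (hs i)]

/-- `w j` is the likelihood ratio of the shift by `c j` of the probability measure `γ`. -/
structure IsShiftLikelihood (γ : Measure ℝ) (c : Fin d → ℝ) (w : Fin d → ℝ → ℝ) : Prop where
  measurable : ∀ j, Measurable (w j)
  pos : ∀ j x, 0 < w j x
  map_eq : ∀ j, γ.map (fun x => c j + x) = γ.withDensity fun x => ENNReal.ofReal (w j x)

/-- One step of the unnormalized filter: the transition of the signal followed by the reweighting
with the likelihoods. -/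
def likelihoodMatrix (Λ : Matrix (Fin d) (Fin d) ℝ) (w : Fin d → ℝ → ℝ) (x : ℝ) :
    Matrix (Fin d) (Fin d) ℝ :=
  diagonal (fun j => w j x) * Λᵀ

theorem likelihoodMatrix_apply (Λ : Matrix (Fin d) (Fin d) ℝ) (w : Fin d → ℝ → ℝ) (x : ℝ)
    (i j : Fin d) : likelihoodMatrix Λ w x i j = w i x * Λ j i := by
  simp [likelihoodMatrix, diagonal_mul]

theorem likelihoodMatrix_mulVec (Λ : Matrix (Fin d) (Fin d) ℝ) (w : Fin d → ℝ → ℝ) (x : ℝ)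
    (q : Fin d → ℝ) (i : Fin d) :
    (likelihoodMatrix Λ w x *ᵥ q) i = w i x * (Λᵀ *ᵥ q) i := by
  rw [likelihoodMatrix, ← mulVec_mulVec, mulVec_diagonal]

namespace IsShiftLikelihood

variable {γ : Measure ℝ} [IsProbabilityMeasure γ] {c : Fin d → ℝ} {w : Fin d → ℝ → ℝ}

theorem lintegral_eq_one (hw : IsShiftLikelihood γ c w) (j : Fin d) :
    ∫⁻ x, ENNReal.ofReal (w j x) ∂γ = 1 := by
  rw [← setLIntegral_univ, ← withDensity_apply _ MeasurableSet.univ, ← hw.map_eq,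
    Measure.map_apply (by fun_prop) MeasurableSet.univ]
  simp

theorem integrable (hw : IsShiftLikelihood γ c w) (j : Fin d) : Integrable (w j) γ := by
  refine ⟨(hw.measurable j).aestronglyMeasurable, ?_⟩
  rw [hasFiniteIntegral_iff_ofReal (Eventually.of_forall fun x => (hw.pos j x).le),
    hw.lintegral_eq_one]
  exact ENNReal.one_lt_top

theorem integral_eq_one (hw : IsShiftLikelihood γ c w) (j : Fin d) : ∫ x, w j x ∂γ = 1 := by
  rw [integral_eq_lintegral_of_nonneg_ae (Eventually.of_forall fun x => (hw.pos j x).le)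
    (hw.measurable j).aestronglyMeasurable, hw.lintegral_eq_one]
  rfl

theorem isRandomMatrix (hw : IsShiftLikelihood γ c w) {Λ : Matrix (Fin d) (Fin d) ℝ}
    (hΛ : Λ ∈ rowStochastic ℝ (Fin d)) : IsRandomMatrix γ (likelihoodMatrix Λ w) Λᵀ where
  measurable i j := by simpa only [likelihoodMatrix_apply] using (hw.measurable i).mul_const _
  nonneg x i j := by
    rw [likelihoodMatrix_apply]
    exact mul_nonneg (hw.pos i x).le (hΛ.1 j i)
  integrable i j := by simpa only [likelihoodMatrix_apply] using (hw.integrable i).mul_const _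
  integral_eq i j := by
    simp only [likelihoodMatrix_apply, integral_mul_const, hw.integral_eq_one, one_mul,
      transpose_apply]
  mem_colStochastic := transpose_mem_colStochastic_iff_mem_rowStochastic.2 hΛ

/-- Since the likelihoods never vanish, a positive entry of `Λ^n` forces a positive entry of the
product at the transposed place, for every observation record and not merely almost every one. -/
theorem prodMatrix_pos (hw : IsShiftLikelihood γ c w) {Λ : Matrix (Fin d) (Fin d) ℝ}
    (hΛ : Λ ∈ rowStochastic ℝ (Fin d)) (n : ℕ) (x : Fin n → ℝ) {i j : Fin d}
    (h : 0 < (Λ ^ n) j i) : 0 < prodMatrix (likelihoodMatrix Λ w) n x i j := by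
  induction n generalizing i j with
  | zero => simpa [prodMatrix, one_apply, eq_comm] using h
  | succ n ih =>
    rw [pow_succ, mul_apply] at h
    obtain ⟨k, -, hk⟩ := Finset.exists_lt_of_sum_lt (s := Finset.univ) (f := fun _ : Fin d => (0 : ℝ))
      (by simpa using h)
    have h1 : 0 < Λ k i := by
      refine (hΛ.1 k i).lt_of_ne fun h0 => ?_
      simp [← h0] at hk
    have h2 : 0 < (Λ ^ n) j k := by
      refine ((pow_mem hΛ n).1 j k).lt_of_ne fun h0 => ?_
      simp [← h0] at hk
    rw [prodMatrix, mul_apply]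
    refine Finset.sum_pos' (fun l _ => mul_nonneg ((hw.isRandomMatrix hΛ).nonneg _ _ _)
      (((hw.isRandomMatrix hΛ).prodMatrix n).nonneg _ _ _)) ⟨k, Finset.mem_univ k, ?_⟩
    rw [likelihoodMatrix_apply]
    exact mul_pos (mul_pos (hw.pos i _) h1) (ih _ h2)

/-- The law of `n` observations given the path of the signal. -/
theorem map_pi_add (hw : IsShiftLikelihood γ c w) {n : ℕ} (s : Fin n → Fin d) :
    (Measure.pi fun _ : Fin n => γ).map (fun x k => c (s k) + x k) =
      (Measure.pi fun _ : Fin n => γ).withDensity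
        fun x => ENNReal.ofReal (∏ k, w (s k) (x k)) := by
  have hprob : ∀ k, IsProbabilityMeasure (γ.map fun x => c (s k) + x) := fun k =>
    Measure.isProbabilityMeasure_map (by fun_prop)
  have hsf : ∀ k, SigmaFinite (γ.withDensity fun x => ENNReal.ofReal (w (s k) x)) := fun k => by
    rw [← hw.map_eq]; infer_instance
  rw [Measure.pi_map_pi (f := fun k x => c (s k) + x) fun k => by fun_prop]
  simp_rw [hw.map_eq]
  rw [pi_withDensity_prod γ (fun k x => ENNReal.ofReal (w (s k) x))
    fun k => (hw.measurable _).ennreal_ofReal]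
  congr 1
  ext x
  rw [ENNReal.ofReal_prod_of_nonneg fun k _ => (hw.pos _ _).le]

end IsShiftLikelihood

/-- Expansion of the unnormalized filter as a sum over signal paths. -/
theorem prodMatrix_likelihoodMatrix_mulVec (Λ : Matrix (Fin d) (Fin d) ℝ) (w : Fin d → ℝ → ℝ)
    (ν : Fin d → ℝ) (n : ℕ) (x : Fin n → ℝ) (j : Fin d) :
    (prodMatrix (likelihoodMatrix Λ w) n x *ᵥ ν) j =
      ∑ s : Fin (n + 1) → Fin d, if s (Fin.last n) = j then
        (ν (s 0) * ∏ k : Fin n, Λ (s k.castSucc) (s k.succ)) * ∏ k : Fin n, w (s k.succ) (x k)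
      else 0 := by
  induction n generalizing j with
  | zero =>
    rw [← (Equiv.funUnique (Fin 1) (Fin d)).symm.sum_comp]
    simp [prodMatrix]
  | succ n ih =>
    rw [prodMatrix, ← mulVec_mulVec, likelihoodMatrix_mulVec]
    rw [← (Fin.snocEquiv fun _ : Fin (n + 2) => Fin d).sum_comp, Fintype.sum_prod_type]
    have h1 : ∀ (i : Fin d) (s : Fin (n + 1) → Fin d),
        (Fin.snocEquiv fun _ : Fin (n + 2) => Fin d) (i, s) = Fin.snoc s i := fun i s => rfl
    simp only [h1, Fin.snoc_last]
    rw [Finset.sum_comm]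
    simp only [Finset.sum_ite_eq', Finset.mem_univ, if_true]
    simp only [mulVec, dotProduct, transpose_apply]
    simp only [mulVec, dotProduct] at ih
    simp only [ih, Finset.mul_sum]
    rw [Finset.sum_comm]
    refine Finset.sum_congr rfl fun s _ => ?_
    simp only [mul_ite, mul_zero, Finset.sum_ite_eq, Finset.mem_univ, if_true]
    rw [Fin.prod_univ_castSucc, Fin.prod_univ_castSucc]
    have h2 : (Fin.snoc s j : Fin (n + 2) → Fin d) 0 = s 0 := by
      rw [← Fin.castSucc_zero, Fin.snoc_castSucc]
    simp only [Fin.succ_last, Fin.snoc_last, Fin.snoc_castSucc, Fin.succ_castSucc, h2]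
    ring

theorem IsMarkovChain.real_path {Ω : Type*} [MeasurableSpace Ω] {Pr : Measure Ω}
    {ν : Fin d → ℝ} {Λ : Matrix (Fin d) (Fin d) ℝ} {S : ℕ → Ω → Fin d}
    (hS : IsMarkovChain Pr ν Λ S) (n : ℕ) (s : Fin (n + 1) → Fin d) :
    Pr.real {ω | ∀ k : Fin (n + 1), S k ω = s k} =
      ν (s 0) * ∏ k : Fin n, Λ (s k.castSucc) (s k.succ) := by
  -- `Fin.ofNat` extends `s` beyond `n` by wrapping around; only indices up to `n` are read.
  have h := hS.path_law n fun k => s (Fin.ofNat (n + 1) k)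
  have h1 : {ω | ∀ k ≤ n, S k ω = s (Fin.ofNat (n + 1) k)} =
      {ω | ∀ k : Fin (n + 1), S k ω = s k} := by
    ext ω
    constructor
    · intro hω k
      have := hω k (Nat.lt_succ_iff.1 k.2)
      simpa using this
    · intro hω k hk
      have := hω (Fin.ofNat (n + 1) k)
      simpa [Nat.mod_eq_of_lt (Nat.lt_succ_iff.2 hk)] using this
  rw [h1] at h
  rw [h, Finset.prod_range]
  congr 1
  refine Finset.prod_congr rfl fun k _ => ?_
  congr 2
  · ext; simp
  · ext; simp [Nat.mod_eq_of_lt (Nat.succ_lt_succ k.2)]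

/-- The joint law of the signal at time `n` and the observations up to time `n`. -/
theorem IsFilteringModel.map_restrict_eq {Ω : Type*} [MeasurableSpace Ω] {Pr : Measure Ω}
    [IsProbabilityMeasure Pr] {ν : Fin d → ℝ} {Λ : Matrix (Fin d) (Fin d) ℝ} {g : ℝ → ℝ}
    {S : ℕ → Ω → Fin d} {ξ : ℕ → Ω → ℝ} (hM : IsFilteringModel Pr ν Λ g S ξ)
    (hν : ν ∈ stdSimplex ℝ (Fin d)) (hΛ : Λ ∈ rowStochastic ℝ (Fin d))
    {γ : Measure ℝ} [IsProbabilityMeasure γ] (hγ : γ = volume.withDensity fun x => ENNReal.ofReal (g x))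
    {c : Fin d → ℝ} {w : Fin d → ℝ → ℝ} (hw : IsShiftLikelihood γ c w) (n : ℕ) (j : Fin d) :
    (Pr.restrict (S n ⁻¹' {j})).map (fun ω (k : Fin n) => c (S (k + 1) ω) + ξ k ω) =
      (Measure.pi fun _ : Fin n => γ).withDensity
        fun x => ENNReal.ofReal ((prodMatrix (likelihoodMatrix Λ w) n x *ᵥ ν) j) := by
  have hSm := hM.chain.measurable
  have hξm := hM.noise.measurable
  have hZm : Measurable fun ω (k : Fin n) => c (S (k + 1) ω) + ξ k ω :=
    measurable_pi_lambda _ fun k => ((measurable_of_finite c).comp (hSm _)).add (hξm _)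
  have hξlaw : Pr.map (fun ω (k : Fin n) => ξ k ω) = Measure.pi fun _ : Fin n => γ := by
    have h1 := (hM.noise.indep.precomp (g := fun k : Fin n => (k : ℕ))
      Fin.val_injective).map_fun_eq_pi_map fun k => (hξm _).aemeasurable
    simpa only [hM.noise.law, ← hγ] using h1
  set Path : Ω → Fin (n + 1) → Fin d := fun ω k => S k ω with hPath
  have hPathm : Measurable Path := measurable_pi_lambda _ fun k => hSm _
  have hind : IndepFun Path (fun ω (k : Fin n) => ξ k ω) Pr :=
    hM.indep.comp (φ := fun (s : ℕ → Fin d) (k : Fin (n + 1)) => s k)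
      (ψ := fun (x : ℕ → ℝ) (k : Fin n) => x k)
      (measurable_pi_lambda _ fun k => measurable_pi_apply _)
      (measurable_pi_lambda _ fun k => measurable_pi_apply _)
  ext B hB
  rw [Measure.map_apply hZm hB, withDensity_apply _ hB,
    Measure.restrict_apply (hZm hB)]
  set D := ((fun ω (k : Fin n) => c (S (k + 1) ω) + ξ k ω) ⁻¹' B) ∩ S n ⁻¹' {j} with hD
  have hDm : MeasurableSet D := (hZm hB).inter (hSm n (measurableSet_singleton j))
  -- Decompose over signal paths. On a fixed path the observations are independent noise shifted by
  -- constants, which matches the path expansion of the filter term by term.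
  have hsplit : Pr D = ∑ s : Fin (n + 1) → Fin d, Pr (Path ⁻¹' {s} ∩ D) := by
    have h1 := sum_measure_preimage_singleton (μ := Pr.restrict D) Finset.univ (f := Path)
      fun s _ => hPathm (measurableSet_singleton s)
    simp only [Finset.coe_univ, Set.preimage_univ, Measure.restrict_apply MeasurableSet.univ,
      Set.univ_inter] at h1
    rw [← h1]
    exact Finset.sum_congr rfl fun s _ =>
      Measure.restrict_apply (hPathm (measurableSet_singleton s))
  have hnn : ∀ s : Fin (n + 1) → Fin d, 0 ≤ ν (s 0) * ∏ k : Fin n, Λ (s k.castSucc) (s k.succ) :=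
    fun s => mul_nonneg (hν.1 _) (Finset.prod_nonneg fun k _ => hΛ.1 _ _)
  have hpath : ∀ s, Pr (Path ⁻¹' {s}) =
      ENNReal.ofReal (ν (s 0) * ∏ k : Fin n, Λ (s k.castSucc) (s k.succ)) := fun s => by
    rw [← hM.chain.real_path, Measure.real, ENNReal.ofReal_toReal (measure_ne_top _ _)]
    congr 1
    ext ω
    simp [hPath, funext_iff]
  have hterm : ∀ s : Fin (n + 1) → Fin d, Pr (Path ⁻¹' {s} ∩ D) =
      ∫⁻ x in B, ENNReal.ofReal (if s (Fin.last n) = j then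
        (ν (s 0) * ∏ k : Fin n, Λ (s k.castSucc) (s k.succ)) * ∏ k : Fin n, w (s k.succ) (x k)
      else 0) ∂(Measure.pi fun _ : Fin n => γ) := by
    intro s
    by_cases hs : s (Fin.last n) = j
    · have hset : Path ⁻¹' {s} ∩ D = Path ⁻¹' {s} ∩ (fun ω (k : Fin n) => ξ k ω) ⁻¹'
          ((fun x (k : Fin n) => c (s k.succ) + x k) ⁻¹' B) := by
        ext ω
        simp only [Set.mem_inter_iff, Set.mem_preimage, Set.mem_singleton_iff, hD, hPath,
          and_congr_right_iff]
        rintro rfl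
        have h1 : S n ω = j := by simpa using hs
        simp [h1]
      have hshift : Measurable fun (x : Fin n → ℝ) (k : Fin n) => c (s k.succ) + x k := by fun_prop
      have hξn : Measurable fun ω (k : Fin n) => ξ k ω := measurable_pi_lambda _ fun k => hξm _
      rw [hset, (indepFun_iff_measure_inter_preimage_eq_mul.1 hind) _ _
        (measurableSet_singleton s) (hshift hB), hpath, ← Measure.map_apply hξn (hshift hB), hξlaw,
        ← Measure.map_apply hshift hB, hw.map_pi_add fun k => s k.succ, withDensity_apply _ hB,
        ← lintegral_const_mul _ (by
          refine Measurable.ennreal_ofReal (Finset.measurable_prod _ fun k _ => ?_)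
          exact (hw.measurable _).comp (measurable_pi_apply k))]
      refine lintegral_congr fun x => ?_
      rw [if_pos hs, ENNReal.ofReal_mul (hnn s)]
    · have hset : Path ⁻¹' {s} ∩ D = ∅ := by
        ext ω
        simp only [Set.mem_inter_iff, Set.mem_preimage, Set.mem_singleton_iff, hD, hPath,
          Set.mem_empty_iff_false, iff_false, not_and]
        rintro rfl - h1
        exact hs (by simpa using h1)
      simp [hset, hs]
  rw [hsplit]
  simp_rw [prodMatrix_likelihoodMatrix_mulVec, hterm]
  rw [← lintegral_finsetSum]
  · refine lintegral_congr fun x => ?_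
    rw [ENNReal.ofReal_sum_of_nonneg]
    intro s _
    split_ifs
    · exact mul_nonneg (hnn s) (Finset.prod_nonneg fun k _ => (hw.pos _ _).le)
    · exact le_rfl
  · intro s _
    refine Measurable.ennreal_ofReal ?_
    split_ifs
    · exact (Finset.measurable_prod _ fun k _ =>
        (hw.measurable _).comp (measurable_pi_apply k)).const_mul _
    · exact measurable_const

/-- The minimal mean square error of the filtering problem as an iterate of the transfer
operator. -/
theorem IsFilteringModel.filteringMMSE_eq {Ω : Type*} [MeasurableSpace Ω] {Pr : Measure Ω}
    [IsProbabilityMeasure Pr] {ν : Fin d → ℝ} {Λ : Matrix (Fin d) (Fin d) ℝ} {g : ℝ → ℝ}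
    {S : ℕ → Ω → Fin d} {ξ : ℕ → Ω → ℝ} (hM : IsFilteringModel Pr ν Λ g S ξ)
    (hν : ν ∈ stdSimplex ℝ (Fin d)) (hΛ : Λ ∈ rowStochastic ℝ (Fin d))
    {γ : Measure ℝ} [IsProbabilityMeasure γ] (hγ : γ = volume.withDensity fun x => ENNReal.ofReal (g x))
    {h : Fin d → ℝ} {σ : ℝ} (hσ : 0 < σ) {w : Fin d → ℝ → ℝ}
    (hw : IsShiftLikelihood γ (fun j => h j / σ) w) (a : Fin d → ℝ) (n : ℕ) :
    filteringMMSE Pr a h σ S ξ n =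
      (transfer γ (likelihoodMatrix Λ w))^[n] (posteriorRisk a) ν := by
  have hA := hw.isRandomMatrix hΛ
  have hN := hA.prodMatrix n
  set Z : Ω → Fin n → ℝ := fun ω k => h (S (k + 1) ω) / σ + ξ k ω with hZ
  have hZm : Measurable Z := measurable_pi_lambda _ fun k =>
    ((measurable_of_finite fun j => h j / σ).comp (hM.chain.measurable _)).add
      (hM.noise.measurable _)
  -- Rescaling by `σ ≠ 0` generates the same σ-algebra, so the noise law is kept fixed and only the
  -- shifts `h j / σ` depend on `σ`.
  have halg : observationAlgebra (observation h σ S ξ) n = MeasurableSpace.pi.comap Z := by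
    rw [observationAlgebra, MeasurableSpace.pi, MeasurableSpace.comap_iSup]
    refine iSup_congr fun k => ?_
    rw [MeasurableSpace.comap_comp]
    have h1 : observation h σ S ξ k =
        (fun x => σ * x) ∘ ((fun b : Fin n → ℝ => b k) ∘ Z) := by
      ext ω
      simp only [observation, hZ, Function.comp_apply]
      field_simp
    rw [h1, ← MeasurableSpace.comap_comp]
    congr 1
    exact (MeasurableEquiv.mulLeft₀ σ hσ.ne').measurableEmbedding.comap_eq
  rw [filteringMMSE, halg, hA.iterate_eq_transfer n (isSuperlinear_posteriorRisk a).isTame hν.1]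
  exact minMeanSquareError_eq_integral Pr (hM.chain.measurable n) hZm
    (hN.measurable_mulVec_right ν) (fun y => hN.mulVec_nonneg y hν.1)
    (fun j => hN.integrable_mulVec ν j)
    (fun j => hM.map_restrict_eq hν hΛ hγ hw n j) a

end JointLaw

/-! ### Accumulation of the one-step gains -/

section Accumulation

variable {d : ℕ}

/-- `q`-mass times the square of the `q`-mean of `b`. -/
noncomputable def explainedSquare (b q : Fin d → ℝ) : ℝ := (b ⬝ᵥ q) ^ 2 / ∑ i, q i

theorem abs_dotProduct_le_norm_mul_sum {q : Fin d → ℝ} (hq : 0 ≤ q) (b : Fin d → ℝ) :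
    |b ⬝ᵥ q| ≤ ‖b‖ * ∑ i, q i := by
  rw [Finset.mul_sum]
  refine (Finset.abs_sum_le_sum_abs _ _).trans (Finset.sum_le_sum fun i _ => ?_)
  rw [abs_mul, abs_of_nonneg (hq i)]
  exact mul_le_mul_of_nonneg_right (norm_le_pi_norm b i) (hq i)

theorem isTame_explainedSquare (b : Fin d → ℝ) : IsTame (explainedSquare b) := by
  refine ⟨by unfold explainedSquare dotProduct; fun_prop, ‖b‖ ^ 2, fun q hq => ?_⟩
  have hs : 0 ≤ ∑ i, q i := Finset.sum_nonneg fun i _ => hq i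
  rw [explainedSquare, abs_of_nonneg (by positivity)]
  refine div_le_of_le_mul₀ hs (by positivity) ?_
  calc (b ⬝ᵥ q) ^ 2 = |b ⬝ᵥ q| ^ 2 := (sq_abs _).symm
    _ ≤ (‖b‖ * ∑ i, q i) ^ 2 :=
        pow_le_pow_left₀ (abs_nonneg _) (abs_dotProduct_le_norm_mul_sum hq b) 2
    _ = _ := by ring

theorem isTame_abs_dotProduct (b : Fin d → ℝ) : IsTame fun q => |b ⬝ᵥ q| := by
  refine ⟨(IsTame.dotProduct b).measurable.abs, ‖b‖, fun q hq => ?_⟩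
  rw [abs_abs]
  exact abs_dotProduct_le_norm_mul_sum hq b

theorem explainedSquare_smul (b q : Fin d → ℝ) (c : ℝ) :
    explainedSquare b (c • q) = c * explainedSquare b q := by
  simp only [explainedSquare, dotProduct_smul, Pi.smul_apply, smul_eq_mul, ← Finset.mul_sum]
  by_cases hc : c = 0
  · simp [hc]
  · by_cases h : ∑ i, q i = 0
    · simp [h]
    · field_simp

theorem explainedSquare_sub_const {q : Fin d → ℝ} (hq : 0 ≤ q) (b : Fin d → ℝ) (c : ℝ) :
    explainedSquare (fun i => b i - c) q =
      explainedSquare b q + (fun i => c ^ 2 - 2 * c * b i) ⬝ᵥ q := by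
  have h1 : (fun i => b i - c) ⬝ᵥ q = b ⬝ᵥ q - c * ∑ i, q i := by
    simp [dotProduct, sub_mul, Finset.mul_sum]
  have h2 : (fun i => c ^ 2 - 2 * c * b i) ⬝ᵥ q = c ^ 2 * ∑ i, q i - 2 * c * (b ⬝ᵥ q) := by
    simp [dotProduct, sub_mul, Finset.mul_sum, mul_assoc]
  rw [explainedSquare, explainedSquare, h1, h2]
  by_cases h : ∑ i, q i = 0
  · simp [eq_zero_of_sum_eq_zero hq h]
  · field_simp
    ring

theorem explainedSquare_of_mem_stdSimplex {p : Fin d → ℝ} (hp : p ∈ stdSimplex ℝ (Fin d))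
    (b : Fin d → ℝ) : explainedSquare b p = (b ⬝ᵥ p) ^ 2 := by
  rw [explainedSquare, hp.2, div_one]

/-- The gain of one observation in the explained square of `b`, for prior weights `p`. -/
noncomputable def observationGain (γ : Measure ℝ) (w : Fin d → ℝ → ℝ) (b p : Fin d → ℝ) : ℝ :=
  transfer γ (likelihoodMatrix 1 w) (explainedSquare b) p - explainedSquare b p

/-- Separates prediction, which is deterministic, from the update by one observation. -/
theorem transfer_likelihoodMatrix (γ : Measure ℝ) (w : Fin d → ℝ → ℝ)
    (Λ : Matrix (Fin d) (Fin d) ℝ) (Ψ : (Fin d → ℝ) → ℝ) (q : Fin d → ℝ) :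
    transfer γ (likelihoodMatrix Λ w) Ψ q = transfer γ (likelihoodMatrix 1 w) Ψ (Λᵀ *ᵥ q) := by
  simp [transfer, likelihoodMatrix]

theorem observationGain_smul (γ : Measure ℝ) (w : Fin d → ℝ → ℝ) (b p : Fin d → ℝ) (c : ℝ) :
    observationGain γ w b (c • p) = c * observationGain γ w b p := by
  simp only [observationGain, transfer, mulVec_smul, explainedSquare_smul, integral_const_mul,
    mul_sub]

variable {γ : Measure ℝ} [IsProbabilityMeasure γ] {k : Fin d → ℝ} {w : Fin d → ℝ → ℝ}

/-- Centring `b` changes its explained square by a functional linear in the weights, and the update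
alone has the identity as its mean matrix, so that functional yields no gain. -/
theorem IsShiftLikelihood.observationGain_sub_const (hw : IsShiftLikelihood γ k w)
    {p : Fin d → ℝ} (hp : 0 ≤ p) (b : Fin d → ℝ) (c : ℝ) :
    observationGain γ w (fun i => b i - c) p = observationGain γ w b p := by
  have hA := hw.isRandomMatrix (one_mem (rowStochastic ℝ (Fin d)))
  have h1 := hA.iterate_congr (isTame_explainedSquare fun i => b i - c)
    ((isTame_explainedSquare b).add (IsTame.dotProduct fun i => c ^ 2 - 2 * c * b i))
    (fun q hq => explainedSquare_sub_const hq b c) 1 hp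
  simp only [Function.iterate_one] at h1
  rw [observationGain, observationGain, h1, explainedSquare_sub_const hp,
    hA.transfer_add (isTame_explainedSquare b) (IsTame.dotProduct _) hp, hA.transfer_dotProduct]
  simp

/-- Factor the difference of squares: the difference of covariances contributes the constant `3` and
their sum the constant `4`. -/
theorem abs_weightedCov_sub_le {p μ : Fin d → ℝ} (hp : p ∈ stdSimplex ℝ (Fin d))
    (hμ : μ ∈ stdSimplex ℝ (Fin d)) (b h : Fin d → ℝ) :
    |weightedCov p b h ^ 2 - weightedCov μ b h ^ 2| ≤
      12 * ‖b‖ ^ 2 * ‖h‖ ^ 2 * ∑ i, |p i - μ i| := by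
  set D := ∑ i, |p i - μ i| with hD
  have hD0 : 0 ≤ D := Finset.sum_nonneg fun i _ => abs_nonneg _
  have hdot : ∀ u : Fin d → ℝ, |p ⬝ᵥ u - μ ⬝ᵥ u| ≤ ‖u‖ * D := fun u => by
    rw [← sub_dotProduct, Finset.mul_sum]
    refine (Finset.abs_sum_le_sum_abs _ _).trans (Finset.sum_le_sum fun i _ => ?_)
    rw [abs_mul, mul_comm, Pi.sub_apply]
    exact mul_le_mul_of_nonneg_right (norm_le_pi_norm u i) (abs_nonneg _)
  have h1 : |∑ i, p i * b i * h i - ∑ i, μ i * b i * h i| ≤ ‖b‖ * ‖h‖ * D := by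
    have := hdot (b * h)
    simp only [dotProduct, Pi.mul_apply, ← mul_assoc] at this
    exact this.trans (mul_le_mul_of_nonneg_right (norm_mul_le b h) hD0)
  have h2 : |(p ⬝ᵥ b) * (p ⬝ᵥ h) - (μ ⬝ᵥ b) * (μ ⬝ᵥ h)| ≤ 2 * (‖b‖ * ‖h‖ * D) := by
    have : (p ⬝ᵥ b) * (p ⬝ᵥ h) - (μ ⬝ᵥ b) * (μ ⬝ᵥ h) =
        (p ⬝ᵥ b - μ ⬝ᵥ b) * (p ⬝ᵥ h) + (μ ⬝ᵥ b) * (p ⬝ᵥ h - μ ⬝ᵥ h) := by ring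
    rw [this]
    refine (abs_add_le _ _).trans ?_
    rw [abs_mul, abs_mul]
    have e1 := mul_le_mul (hdot b) (abs_dotProduct_le_of_mem_stdSimplex hp h) (abs_nonneg _)
      (by positivity)
    have e2 := mul_le_mul (abs_dotProduct_le_of_mem_stdSimplex hμ b) (hdot h) (abs_nonneg _)
      (by positivity)
    linarith
  have h3 : |weightedCov p b h - weightedCov μ b h| ≤ 3 * (‖b‖ * ‖h‖ * D) := by
    have : weightedCov p b h - weightedCov μ b h =
        (∑ i, p i * b i * h i - ∑ i, μ i * b i * h i) -
          ((p ⬝ᵥ b) * (p ⬝ᵥ h) - (μ ⬝ᵥ b) * (μ ⬝ᵥ h)) := by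
      simp only [weightedCov]; ring
    rw [this]
    exact (abs_sub _ _).trans (by linarith)
  have h4 : |weightedCov p b h + weightedCov μ b h| ≤ 4 * (‖b‖ * ‖h‖) :=
    (abs_add_le _ _).trans (by linarith [abs_weightedCov_le hp b h, abs_weightedCov_le hμ b h])
  rw [sq_sub_sq, abs_mul]
  calc _ ≤ (4 * (‖b‖ * ‖h‖)) * (3 * (‖b‖ * ‖h‖ * D)) :=
        mul_le_mul h4 h3 (abs_nonneg _) (by positivity)
    _ = _ := by ring

variable {Λ : Matrix (Fin d) (Fin d) ℝ} {μ h : Fin d → ℝ} {I s r : ℝ}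

/-- One-step expansion of the explained square for unnormalized weights. -/
theorem IsShiftLikelihood.abs_transfer_sub_le (hw : IsShiftLikelihood γ k w)
    (hΛ : Λ ∈ rowStochastic ℝ (Fin d)) (hμ : μ ∈ stdSimplex ℝ (Fin d)) (hI : 0 ≤ I)
    (hgain : ∀ p ∈ stdSimplex ℝ (Fin d), ∀ b : Fin d → ℝ,
      |s * observationGain γ w b p - I * weightedCov p b h ^ 2| ≤ r * ‖b‖ ^ 2)
    (b : Fin d → ℝ) (c : ℝ) {q : Fin d → ℝ} (hq : 0 ≤ q) :
    |s * (transfer γ (likelihoodMatrix Λ w) (explainedSquare b) q -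
        explainedSquare (Λ *ᵥ b) q) - I * weightedCov μ b h ^ 2 * ∑ i, q i| ≤
      ‖fun i => b i - c‖ ^ 2 * (r * ∑ i, q i + 12 * I * ‖h‖ ^ 2 *
        ∑ i, |(fun j => Λ j i - μ i) ⬝ᵥ q|) := by
  have hcol := transpose_mem_colStochastic_iff_mem_rowStochastic.2 hΛ
  have hmass : ∑ i, (Λᵀ *ᵥ q) i = ∑ i, q i := sum_mulVec_of_mem_colStochastic hcol
  have hexp : explainedSquare (Λ *ᵥ b) q = explainedSquare b (Λᵀ *ᵥ q) := by
    rw [explainedSquare, explainedSquare, hmass, dotProduct_mulVec, vecMul_transpose]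
  rw [hexp, transfer_likelihoodMatrix, ← observationGain]
  rcases (Finset.sum_nonneg fun i _ => hq i : 0 ≤ ∑ i, q i).eq_or_lt with h0 | h0
  · simp [eq_zero_of_sum_eq_zero hq h0.symm, observationGain, transfer, explainedSquare]
  set M := ∑ i, q i with hM
  -- The normalized predicted law, to which the gain estimate for probability vectors applies.
  set p : Fin d → ℝ := M⁻¹ • Λᵀ *ᵥ q with hp
  have hps : p ∈ stdSimplex ℝ (Fin d) := by
    refine ⟨fun i => mul_nonneg (inv_nonneg.2 h0.le) (nonneg_mulVec_of_mem_colStochastic hcol hq i),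
      ?_⟩
    simp only [hp, Pi.smul_apply, smul_eq_mul, ← Finset.mul_sum, hmass]
    exact inv_mul_cancel₀ h0.ne'
  have hqp : Λᵀ *ᵥ q = M • p := by rw [hp, smul_inv_smul₀ h0.ne']
  -- The unnormalized deviation of the predicted law from `μ` is the absolute value of a linear
  -- functional, a form that can be bounded under the iterates.
  have hdiff : ∀ i, M * |p i - μ i| = |(fun j => Λ j i - μ i) ⬝ᵥ q| := fun i => by
    have h1 : (fun j => Λ j i - μ i) ⬝ᵥ q = (Λᵀ *ᵥ q) i - M * μ i := by
      simp only [dotProduct, sub_mul, Finset.sum_sub_distrib, mulVec, transpose_apply, hM,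
        Finset.sum_mul]
      congr 1
      exact Finset.sum_congr rfl fun j _ => mul_comm _ _
    rw [h1, hqp, Pi.smul_apply, smul_eq_mul, ← mul_sub, abs_mul, abs_of_pos h0]
  set b' : Fin d → ℝ := fun i => b i - c with hb'
  have e1 := hgain p hps b'
  rw [hw.observationGain_sub_const hps.1] at e1
  have e2 := abs_weightedCov_sub_le hps hμ b' h
  have e3 : weightedCov μ b h = weightedCov μ b' h := (weightedCov_sub_const hμ.2 b h c).symm
  rw [hqp, observationGain_smul, e3]
  have e4 : s * (M * observationGain γ w b p) - I * weightedCov μ b' h ^ 2 * M =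
      M * ((s * observationGain γ w b p - I * weightedCov p b' h ^ 2) +
        I * (weightedCov p b' h ^ 2 - weightedCov μ b' h ^ 2)) := by ring
  rw [e4, abs_mul, abs_of_pos h0]
  have e5 : |(s * observationGain γ w b p - I * weightedCov p b' h ^ 2) +
      I * (weightedCov p b' h ^ 2 - weightedCov μ b' h ^ 2)| ≤
      r * ‖b'‖ ^ 2 + I * (12 * ‖b'‖ ^ 2 * ‖h‖ ^ 2 * ∑ i, |p i - μ i|) := by
    refine (abs_add_le _ _).trans (add_le_add e1 ?_)
    rw [abs_mul, abs_of_nonneg hI]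
    exact mul_le_mul_of_nonneg_left e2 hI
  refine (mul_le_mul_of_nonneg_left e5 h0.le).trans_eq ?_
  simp_rw [← hdiff, ← Finset.mul_sum]
  ring

/-- A priori bound for the explained square after `n` steps. -/
theorem IsShiftLikelihood.iterate_explainedSquare_le [Nonempty (Fin d)]
    (hw : IsShiftLikelihood γ k w) (hΛ : Λ ∈ rowStochastic ℝ (Fin d))
    (hμ : IsErgodicWithLimit Λ μ) (hI : 0 ≤ I) (hs : 0 < s) (hr : r ≤ 1)
    (hgain : ∀ p ∈ stdSimplex ℝ (Fin d), ∀ b : Fin d → ℝ,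
      |s * observationGain γ w b p - I * weightedCov p b h ^ 2| ≤ r * ‖b‖ ^ 2)
    (c : ℝ) (n : ℕ) (b : Fin d → ℝ) :
    (transfer γ (likelihoodMatrix Λ w))^[n] (explainedSquare b) μ ≤
      (μ ⬝ᵥ b) ^ 2 + (1 + 4 * I * ‖h‖ ^ 2) / s *
        ∑ m ∈ Finset.range n, ‖fun i => ((Λ ^ m) *ᵥ b) i - c‖ ^ 2 := by
  have hA := hw.isRandomMatrix hΛ
  have hμs := hμ.mem_stdSimplex hΛ
  have hcol := transpose_mem_colStochastic_iff_mem_rowStochastic.2 hΛ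
  induction n generalizing b with
  | zero => simp [explainedSquare_of_mem_stdSimplex hμs, dotProduct_comm]
  | succ n ih =>
    -- From `r ≤ 1` and `|Cov_p(b', h)| ≤ 2 ‖b'‖ ‖h‖` for the centred `b'`.
    set K := (1 + 4 * I * ‖h‖ ^ 2) / s * ‖fun i => b i - c‖ ^ 2 with hK
    have hone : ∀ q, 0 ≤ q → transfer γ (likelihoodMatrix Λ w) (explainedSquare b) q ≤
        explainedSquare (Λ *ᵥ b) q + (fun _ => K) ⬝ᵥ q := by
      intro q hq
      have hmass : ∑ i, (Λᵀ *ᵥ q) i = ∑ i, q i := sum_mulVec_of_mem_colStochastic hcol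
      have hexp : explainedSquare (Λ *ᵥ b) q = explainedSquare b (Λᵀ *ᵥ q) := by
        rw [explainedSquare, explainedSquare, hmass, dotProduct_mulVec, vecMul_transpose]
      have hKq : (fun _ => K) ⬝ᵥ q = K * ∑ i, q i := by simp [dotProduct, Finset.mul_sum]
      rw [hexp, transfer_likelihoodMatrix, hKq, ← sub_le_iff_le_add', ← observationGain]
      rcases (Finset.sum_nonneg fun i _ => hq i : 0 ≤ ∑ i, q i).eq_or_lt with h0 | h0
      · simp [eq_zero_of_sum_eq_zero hq h0.symm, observationGain, transfer, explainedSquare]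
      set M := ∑ i, q i with hM
      set p : Fin d → ℝ := M⁻¹ • Λᵀ *ᵥ q with hp
      have hps : p ∈ stdSimplex ℝ (Fin d) := by
        refine ⟨fun i => mul_nonneg (inv_nonneg.2 h0.le)
          (nonneg_mulVec_of_mem_colStochastic hcol hq i), ?_⟩
        simp only [hp, Pi.smul_apply, smul_eq_mul, ← Finset.mul_sum, hmass]
        exact inv_mul_cancel₀ h0.ne'
      have hqp : Λᵀ *ᵥ q = M • p := by rw [hp, smul_inv_smul₀ h0.ne']
      rw [hqp, observationGain_smul, mul_comm K]
      refine mul_le_mul_of_nonneg_left ?_ h0.le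
      set b' : Fin d → ℝ := fun i => b i - c with hb'
      have e1 := (abs_le.1 (hgain p hps b')).2
      rw [hw.observationGain_sub_const hps.1] at e1
      have e2 : weightedCov p b' h ^ 2 ≤ (2 * (‖b'‖ * ‖h‖)) ^ 2 := by
        rw [← sq_abs]
        exact pow_le_pow_left₀ (abs_nonneg _) (abs_weightedCov_le hps b' h) 2
      have e3 := mul_le_mul_of_nonneg_left e2 hI
      have e4 : r * ‖b'‖ ^ 2 ≤ 1 * ‖b'‖ ^ 2 := mul_le_mul_of_nonneg_right hr (sq_nonneg _)
      rw [hK, div_mul_eq_mul_div, le_div_iff₀ hs]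
      nlinarith
    have h1 := hA.iterate_mono (hA.isTame_transfer (isTame_explainedSquare b))
      ((isTame_explainedSquare (Λ *ᵥ b)).add (IsTame.dotProduct fun _ => K)) hone n μ hμs.1
    rw [hA.iterate_add (isTame_explainedSquare _) (IsTame.dotProduct _) n hμs.1,
      hA.iterate_dotProduct, hμ.transpose_pow_mulVec] at h1
    have h2 : (fun _ => K) ⬝ᵥ μ = K := by
      simp only [dotProduct]
      rw [← Finset.mul_sum, hμs.2, mul_one]
    have h3 := ih (Λ *ᵥ b)
    have h4 : μ ⬝ᵥ Λ *ᵥ b = μ ⬝ᵥ b := by simpa using hμ.dotProduct_pow_mulVec 1 b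
    rw [Function.iterate_succ_apply, Finset.sum_range_succ']
    simp only [mulVec_mulVec, ← pow_succ, h4] at h3
    simp only [pow_zero, one_mulVec]
    rw [h2] at h1
    rw [mul_add]
    linarith

/-- The total reduction of the risk in the stationary regime, uniformly in time. -/
theorem IsShiftLikelihood.abs_iterate_explainedSquare_sub_le [Nonempty (Fin d)]
    (hw : IsShiftLikelihood γ k w) (hΛ : Λ ∈ rowStochastic ℝ (Fin d))
    (hμ : IsErgodicWithLimit Λ μ) (hI : 0 ≤ I) {t : ℝ} (ht : 0 < t) (hr0 : 0 ≤ r) (hr : r ≤ 1)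
    (hgain : ∀ p ∈ stdSimplex ℝ (Fin d), ∀ b : Fin d → ℝ,
      |t ^ 2 * observationGain γ w b p - I * weightedCov p b h ^ 2| ≤ r * ‖b‖ ^ 2)
    {G : ℝ} (hG : ∀ (b : Fin d → ℝ) (n : ℕ),
      ∑ m ∈ Finset.range n, ‖(fun i => ((Λ ^ m) *ᵥ b) i - μ ⬝ᵥ b)‖ ^ 2 ≤ G * ‖b‖ ^ 2)
    (a : Fin d → ℝ) (n : ℕ) :
    |t ^ 2 * ((transfer γ (likelihoodMatrix Λ w))^[n] (explainedSquare a) μ - (μ ⬝ᵥ a) ^ 2) -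
        ∑ m ∈ Finset.range n, I * weightedCov μ ((Λ ^ m) *ᵥ a) h ^ 2| ≤
      G * ‖a‖ ^ 2 * (r + 12 * I * ‖h‖ ^ 2 * (∑ i, ((1 + 4 * I * ‖h‖ ^ 2) *
        (G * ‖fun j => Λ j i - μ i‖ ^ 2) + 1) / 2) / t) := by
  have hA := hw.isRandomMatrix hΛ
  have hμs := hμ.mem_stdSimplex hΛ
  have hconst : ∀ K : ℝ, (fun _ => K) ⬝ᵥ μ = K := fun K => by
    simp only [dotProduct]
    rw [← Finset.mul_sum, hμs.2, mul_one]
  -- The columns of `Λ`, centred so that their mean under `μ` is zero; they measure the deviation of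
  -- the predicted law from `μ`.
  set β : Fin d → Fin d → ℝ := fun i j => Λ j i - μ i with hβ
  set D := ∑ i, ((1 + 4 * I * ‖h‖ ^ 2) * (G * ‖β i‖ ^ 2) + 1) / 2 with hD
  have hβμ : ∀ i, μ ⬝ᵥ β i = 0 := fun i => by
    have h1 := congrFun hμ.transpose_mulVec i
    simp only [mulVec, dotProduct, transpose_apply] at h1
    simp only [hβ, dotProduct, mul_sub, Finset.sum_sub_distrib, ← Finset.sum_mul, hμs.2, one_mul]
    rw [sub_eq_zero, ← h1]
    exact Finset.sum_congr rfl fun j _ => mul_comm _ _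
  have habs : ∀ n i, (transfer γ (likelihoodMatrix Λ w))^[n] (fun q => |β i ⬝ᵥ q|) μ ≤
      (((1 + 4 * I * ‖h‖ ^ 2) * (G * ‖β i‖ ^ 2) + 1) / 2) / t := by
    intro n i
    -- Arithmetic–geometric mean inequality balanced at scale `t`: the explained square of `β i` is
    -- `O(t⁻²)` by the a priori bound, so both terms become `O(1/t)`.
    have h1 : ∀ q, 0 ≤ q → |β i ⬝ᵥ q| ≤
        t / 2 * explainedSquare (β i) q + (fun _ => 1 / (2 * t)) ⬝ᵥ q := by
      intro q hq
      have h2 : (fun _ => 1 / (2 * t)) ⬝ᵥ q = 1 / (2 * t) * ∑ i, q i := by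
        simp [dotProduct, Finset.mul_sum]
      rw [h2, explainedSquare, ← sq_abs]
      rcases (Finset.sum_nonneg fun i _ => hq i : 0 ≤ ∑ i, q i).eq_or_lt with h0 | h0
      · simp [eq_zero_of_sum_eq_zero hq h0.symm]
      · have h3 : t / 2 * (|β i ⬝ᵥ q| ^ 2 / ∑ i, q i) + 1 / (2 * t) * ∑ i, q i - |β i ⬝ᵥ q| =
            (t * |β i ⬝ᵥ q| - ∑ i, q i) ^ 2 / (2 * t * ∑ i, q i) := by
          field_simp
          ring
        have h4 : 0 ≤ (t * |β i ⬝ᵥ q| - ∑ i, q i) ^ 2 / (2 * t * ∑ i, q i) := by positivity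
        linarith
    have h5 := hA.iterate_mono (isTame_abs_dotProduct (β i))
      (((isTame_explainedSquare (β i)).const_mul (t / 2)).add (IsTame.dotProduct _)) h1 n μ hμs.1
    rw [hA.iterate_add ((isTame_explainedSquare (β i)).const_mul (t / 2)) (IsTame.dotProduct _) n
      hμs.1, IsRandomMatrix.iterate_const_mul, hA.iterate_dotProduct, hμ.transpose_pow_mulVec,
      hconst] at h5
    have h6 := hw.iterate_explainedSquare_le hΛ hμ hI (pow_pos ht 2) hr hgain (μ ⬝ᵥ β i) n (β i)
    have h7 := mul_le_mul_of_nonneg_left (hG (β i) n)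
      (show 0 ≤ (1 + 4 * I * ‖h‖ ^ 2) / t ^ 2 by positivity)
    rw [hβμ] at h6 h7
    have h8 : (transfer γ (likelihoodMatrix Λ w))^[n] (explainedSquare (β i)) μ ≤
        (1 + 4 * I * ‖h‖ ^ 2) / t ^ 2 * (G * ‖β i‖ ^ 2) := by linarith
    have h9 := mul_le_mul_of_nonneg_left h8 (show 0 ≤ t / 2 by positivity)
    refine h5.trans ((add_le_add_left h9 _).trans_eq ?_)
    field_simp
  have hstep : ∀ (n : ℕ) (b : Fin d → ℝ) (c : ℝ),
      |t ^ 2 * ((transfer γ (likelihoodMatrix Λ w))^[n + 1] (explainedSquare b) μ -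
        (transfer γ (likelihoodMatrix Λ w))^[n] (explainedSquare (Λ *ᵥ b)) μ) -
        I * weightedCov μ b h ^ 2| ≤
      ‖fun i => b i - c‖ ^ 2 * (r + 12 * I * ‖h‖ ^ 2 * D / t) := by
    intro n b c
    set C := I * weightedCov μ b h ^ 2 with hC
    set N := ‖fun i => b i - c‖ ^ 2 with hN
    have htT := hA.isTame_transfer (isTame_explainedSquare b)
    have htU := isTame_explainedSquare (Λ *ᵥ b)
    have htabs : IsTame fun q => ∑ i, |β i ⬝ᵥ q| :=
      IsTame.finset_sum _ fun i _ => isTame_abs_dotProduct (β i)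
    have hlin : ∀ (K : ℝ) (q : Fin d → ℝ), (fun _ => K) ⬝ᵥ q = K * ∑ i, q i := fun K q => by
      simp [dotProduct, Finset.mul_sum]
    have hB := fun q (hq : 0 ≤ q) => abs_le.1 (hw.abs_transfer_sub_le hΛ hμs hI hgain b c hq)
    have hsum : (transfer γ (likelihoodMatrix Λ w))^[n] (fun q => ∑ i, |β i ⬝ᵥ q|) μ ≤ D / t := by
      rw [hA.iterate_finset_sum _ (fun i _ => isTame_abs_dotProduct (β i)) n hμs.1, hD,
        Finset.sum_div]
      exact Finset.sum_le_sum fun i _ => habs n i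
    have hcoef : 0 ≤ N * (12 * I * ‖h‖ ^ 2) := by positivity
    have hsum' := mul_le_mul_of_nonneg_left hsum hcoef
    rw [Function.iterate_succ_apply]
    -- The cases `ε = 1` and `ε = -1` are the upper and lower bounds of the one-step expansion,
    -- pushed through `n` iterations by monotonicity.
    have hL : ∀ ε : ℝ, (transfer γ (likelihoodMatrix Λ w))^[n] (fun q =>
        t ^ 2 * explainedSquare (Λ *ᵥ b) q + ((fun _ => C + ε * (N * r)) ⬝ᵥ q +
          (ε * (N * (12 * I * ‖h‖ ^ 2))) * ∑ i, |β i ⬝ᵥ q|)) μ =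
        t ^ 2 * (transfer γ (likelihoodMatrix Λ w))^[n] (explainedSquare (Λ *ᵥ b)) μ +
          ((C + ε * (N * r)) + (ε * (N * (12 * I * ‖h‖ ^ 2))) *
            (transfer γ (likelihoodMatrix Λ w))^[n] (fun q => ∑ i, |β i ⬝ᵥ q|) μ) := fun ε => by
      rw [hA.iterate_add (htU.const_mul _) ((IsTame.dotProduct _).add (htabs.const_mul _)) n hμs.1,
        hA.iterate_add (IsTame.dotProduct _) (htabs.const_mul _) n hμs.1,
        IsRandomMatrix.iterate_const_mul, IsRandomMatrix.iterate_const_mul, hA.iterate_dotProduct,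
        hμ.transpose_pow_mulVec, hconst]
    have htame : ∀ ε : ℝ, IsTame fun q =>
        t ^ 2 * explainedSquare (Λ *ᵥ b) q + ((fun _ => C + ε * (N * r)) ⬝ᵥ q +
          (ε * (N * (12 * I * ‖h‖ ^ 2))) * ∑ i, |β i ⬝ᵥ q|) := fun ε =>
      (htU.const_mul _).add ((IsTame.dotProduct _).add (htabs.const_mul _))
    have hup := hA.iterate_mono (htT.const_mul (t ^ 2)) (htame 1) (fun q hq => by
      have := (hB q hq).2
      rw [hlin]
      simp only [hC, hN, hβ]
      linarith) n μ hμs.1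
    have hlow := hA.iterate_mono (htame (-1)) (htT.const_mul (t ^ 2)) (fun q hq => by
      have := (hB q hq).1
      rw [hlin]
      simp only [hC, hN, hβ]
      linarith) n μ hμs.1
    rw [hL, IsRandomMatrix.iterate_const_mul] at hup hlow
    have hexp : N * (r + 12 * I * ‖h‖ ^ 2 * D / t) =
        N * r + N * (12 * I * ‖h‖ ^ 2) * (D / t) := by ring
    rw [hexp, abs_le]
    constructor <;> linarith
  -- Each induction step peels off one gain and replaces `b` by `Λ b`. The same centring `c` serves
  -- throughout; it is set to the stationary mean of `a` at the end.
  have hacc : ∀ (n : ℕ) (b : Fin d → ℝ) (c : ℝ),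
      |t ^ 2 * ((transfer γ (likelihoodMatrix Λ w))^[n] (explainedSquare b) μ - (μ ⬝ᵥ b) ^ 2) -
        ∑ m ∈ Finset.range n, I * weightedCov μ ((Λ ^ m) *ᵥ b) h ^ 2| ≤
      (∑ m ∈ Finset.range n, ‖fun i => ((Λ ^ m) *ᵥ b) i - c‖ ^ 2) *
        (r + 12 * I * ‖h‖ ^ 2 * D / t) := by
    intro n
    induction n with
    | zero => intro b c; simp [explainedSquare_of_mem_stdSimplex hμs, dotProduct_comm]
    | succ n ih =>
      intro b c
      have h1 := hstep n b c
      have h2 := ih (Λ *ᵥ b) c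
      have h4 : μ ⬝ᵥ Λ *ᵥ b = μ ⬝ᵥ b := by simpa using hμ.dotProduct_pow_mulVec 1 b
      simp only [mulVec_mulVec, ← pow_succ, h4] at h2
      rw [Finset.sum_range_succ', Finset.sum_range_succ', add_mul]
      simp only [pow_zero, one_mulVec]
      refine le_trans ?_ (add_le_add h2 h1)
      refine le_trans (le_of_eq ?_) (abs_add_le _ _)
      congr 1
      ring
  refine (hacc n a (μ ⬝ᵥ a)).trans ?_
  refine mul_le_mul_of_nonneg_right (hG a n) ?_
  -- The empty sum in `hG` already supplies nonnegativity.
  have hG0 : ∀ i, 0 ≤ G * ‖β i‖ ^ 2 := fun i => by simpa using hG (β i) 0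
  have hD0 : 0 ≤ D := Finset.sum_nonneg fun i _ => by have := hG0 i; positivity
  positivity

theorem posteriorRisk_eq_sub (a q : Fin d → ℝ) :
    posteriorRisk a q = (fun i => a i ^ 2) ⬝ᵥ q + (-1) * explainedSquare a q := by
  rw [posteriorRisk, explainedSquare]
  ring

theorem IsRandomMatrix.iterate_posteriorRisk {X : Type*} [MeasurableSpace X] {ρ : Measure X}
    [SFinite ρ] {A : X → Matrix (Fin d) (Fin d) ℝ} {L : Matrix (Fin d) (Fin d) ℝ}
    (hA : IsRandomMatrix ρ A L) (a : Fin d → ℝ) (n : ℕ) {q : Fin d → ℝ} (hq : 0 ≤ q) :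
    (transfer ρ A)^[n] (posteriorRisk a) q = (fun i => a i ^ 2) ⬝ᵥ (L ^ n) *ᵥ q -
      (transfer ρ A)^[n] (explainedSquare a) q := by
  have h1 : posteriorRisk a = fun q => (fun i => a i ^ 2) ⬝ᵥ q + (-1) * explainedSquare a q :=
    funext (posteriorRisk_eq_sub a)
  rw [h1, hA.iterate_add (IsTame.dotProduct _) ((isTame_explainedSquare a).const_mul _) n hq,
    iterate_const_mul, hA.iterate_dotProduct]
  ring

end Accumulation

/-! ### Regularity of the noise density -/

section Density

variable {g : ℝ → ℝ} {δ : ℝ}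

theorem localMin_le (hg : ∀ x, 0 ≤ g x) {u : ℝ} (hu : |u| ≤ δ) (x : ℝ) :
    localMin g δ x ≤ g (x + u) :=
  ciInf_le ⟨0, by rintro _ ⟨v, rfl⟩; exact hg _⟩ (⟨u, abs_le.1 hu⟩ : Set.Icc (-δ) δ)

theorem localMin_pos (hg : ∀ x, 0 < g x) (hc : Continuous g) (hδ : 0 < δ) (x : ℝ) :
    0 < localMin g δ x := by
  have hne : (Set.Icc (-δ) δ).Nonempty := ⟨0, by constructor <;> linarith⟩
  have : Nonempty (Set.Icc (-δ) δ) := hne.to_subtype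
  obtain ⟨u, hu, hmin⟩ := isCompact_Icc.exists_isMinOn hne
    (hc.comp (continuous_const.add continuous_id) : Continuous fun u => g (x + u)).continuousOn
  exact (hg (x + u)).trans_le (le_ciInf fun v => hmin v.2)

theorem abs_le_localMaxAbs {f : ℝ → ℝ} {C : ℝ} (hf : ∀ x, |f x| ≤ C) {v : ℝ} (hv : |v| ≤ δ)
    (x : ℝ) : |f (x + v)| ≤ localMaxAbs f δ x :=
  le_ciSup (f := fun v : Set.Icc (-δ) δ => |f (x + v)|)
    ⟨C, by rintro _ ⟨v, rfl⟩; exact hf _⟩ ⟨v, abs_le.1 hv⟩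

/-- Mean value inequality twice on the ball of radius `|u|`, first for `deriv g` and then for `g`;
only the local size of the second derivative enters. -/
theorem abs_sub_le_of_localMaxAbs (hd : Differentiable ℝ g) (hd2 : Differentiable ℝ (deriv g))
    {C : ℝ} (hC : ∀ x, |deriv (deriv g) x| ≤ C) {u : ℝ} (hu : |u| ≤ δ) (x : ℝ) :
    |g (x + u) - g x| ≤ (|deriv g x| + localMaxAbs (deriv (deriv g)) δ x * |u|) * |u| := by
  set M := localMaxAbs (deriv (deriv g)) δ x
  have hM0 : 0 ≤ M := (abs_nonneg _).trans (abs_le_localMaxAbs hC (v := 0)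
    (by simpa using (abs_nonneg u).trans hu) x)
  set s := Metric.closedBall x |u|
  have hs : Convex ℝ s := convex_closedBall _ _
  have hxs : x ∈ s := Metric.mem_closedBall_self (abs_nonneg u)
  have h2 : ∀ y ∈ s, ‖deriv (deriv g) y‖ ≤ M := fun y hy => by
    have := abs_le_localMaxAbs hC (v := y - x) (δ := δ)
      ((by simpa [s, Real.dist_eq] using hy : |y - x| ≤ |u|).trans hu) x
    simpa using this
  have h1 : ∀ y ∈ s, ‖deriv g y‖ ≤ |deriv g x| + M * |u| := fun y hy => by
    have h3 := hs.norm_image_sub_le_of_norm_deriv_le (fun z _ => hd2 z) h2 hxs hy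
    have h4 : ‖y - x‖ ≤ |u| := by simpa [s, Real.dist_eq] using hy
    calc ‖deriv g y‖ = ‖deriv g x + (deriv g y - deriv g x)‖ := by rw [add_sub_cancel]
      _ ≤ ‖deriv g x‖ + ‖deriv g y - deriv g x‖ := norm_add_le _ _
      _ ≤ _ := add_le_add le_rfl (h3.trans (mul_le_mul_of_nonneg_left h4 hM0))
  have h5 := hs.norm_image_sub_le_of_norm_deriv_le (fun z _ => hd z) h1 hxs
    (show x + u ∈ s by simp [s])
  simpa using h5

/-- The law with density `g`. -/
noncomputable def densityLaw (g : ℝ → ℝ) : Measure ℝ :=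
  volume.withDensity fun x => ENNReal.ofReal (g x)

theorem isProbabilityMeasure_densityLaw (hg : ∀ x, 0 ≤ g x) (hi : Integrable g)
    (h1 : ∫ x, g x = 1) : IsProbabilityMeasure (densityLaw g) := by
  refine ⟨?_⟩
  rw [densityLaw, withDensity_apply _ MeasurableSet.univ, setLIntegral_univ,
    ← ofReal_integral_eq_lintegral_ofReal hi (Eventually.of_forall hg), h1, ENNReal.ofReal_one]

theorem integrable_densityLaw_iff (hg : ∀ x, 0 ≤ g x) (hc : Continuous g) {f : ℝ → ℝ} :
    Integrable f (densityLaw g) ↔ Integrable fun x => f x * g x := by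
  rw [densityLaw, integrable_withDensity_iff hc.measurable.ennreal_ofReal
    (Eventually.of_forall fun _ => by simp)]
  simp only [ENNReal.toReal_ofReal (hg _)]

theorem integral_densityLaw (hg : ∀ x, 0 ≤ g x) (hc : Continuous g) (f : ℝ → ℝ) :
    ∫ x, f x ∂densityLaw g = ∫ x, g x * f x := by
  rw [densityLaw, integral_withDensity_eq_integral_toReal_smul hc.measurable.ennreal_ofReal
    (Eventually.of_forall fun _ => by simp)]
  simp only [ENNReal.toReal_ofReal (hg _), smul_eq_mul]

/-- Likelihood ratios of the observations in noise of intensity `σ`, in units of `σ`. -/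
noncomputable def noiseLikelihood {d : ℕ} (g : ℝ → ℝ) (h : Fin d → ℝ) (σ : ℝ) (j : Fin d)
    (x : ℝ) : ℝ :=
  g (x - h j / σ) / g x

theorem isShiftLikelihood_noiseLikelihood {d : ℕ} (hg : ∀ x, 0 < g x) (hc : Continuous g)
    (h : Fin d → ℝ) (σ : ℝ) :
    IsShiftLikelihood (densityLaw g) (fun j => h j / σ) (noiseLikelihood g h σ) where
  measurable j := (hc.measurable.comp (measurable_id.sub_const _)).div hc.measurable
  pos j x := div_pos (hg _) (hg _)
  map_eq j := by
    have hm : Measurable fun x => ENNReal.ofReal (noiseLikelihood g h σ j x) :=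
      ((hc.measurable.comp (measurable_id.sub_const _)).div hc.measurable).ennreal_ofReal
    have hmg := hc.measurable.ennreal_ofReal
    rw [densityLaw, ← withDensity_mul _ hmg hm]
    ext B hB
    have hadd : Measurable fun x : ℝ => h j / σ + x := by fun_prop
    rw [Measure.map_apply hadd hB, withDensity_apply _ (hadd hB), withDensity_apply _ hB]
    have hmul : ∀ x, ((fun x => ENNReal.ofReal (g x)) *
        fun x => ENNReal.ofReal (noiseLikelihood g h σ j x)) x =
        ENNReal.ofReal (g (x - h j / σ)) := fun x => by
      rw [Pi.mul_apply, ← ENNReal.ofReal_mul (hg x).le, noiseLikelihood,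
        mul_div_cancel₀ _ (hg x).ne']
    simp_rw [hmul]
    have hm2 : Measurable fun x => ENNReal.ofReal (g (x - h j / σ)) :=
      (hc.measurable.comp (measurable_id.sub_const (h j / σ))).ennreal_ofReal
    rw [← (measurePreserving_add_left volume (h j / σ)).setLIntegral_comp_preimage hB hm2]
    simp

end Density

/-! ### The gain of one observation in large noise -/

section Gain

variable {d : ℕ} {g : ℝ → ℝ} {δ : ℝ}

/-- For `b` centred under `p` the prior explained square vanishes, and `1` may be subtracted from
each likelihood at no cost. The numerator is thus visibly quadratic in the small quantities `w i x -
1`. -/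
theorem IsShiftLikelihood.observationGain_eq {γ : Measure ℝ} [IsProbabilityMeasure γ]
    {k : Fin d → ℝ} {w : Fin d → ℝ → ℝ} (hw : IsShiftLikelihood γ k w) {p : Fin d → ℝ}
    (hp : p ∈ stdSimplex ℝ (Fin d)) (b : Fin d → ℝ) :
    observationGain γ w b p =
      ∫ x, (∑ i, p i * (b i - p ⬝ᵥ b) * (w i x - 1)) ^ 2 / (∑ i, p i * w i x) ∂γ := by
  have hcent : ∑ i, p i * (b i - p ⬝ᵥ b) = 0 := by
    simp only [mul_sub, Finset.sum_sub_distrib, ← Finset.sum_mul, hp.2]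
    simp [dotProduct]
  have h0 : (fun i => b i - p ⬝ᵥ b) ⬝ᵥ p = 0 := by
    rw [dotProduct_comm]
    exact hcent
  rw [← hw.observationGain_sub_const hp.1 b (p ⬝ᵥ b), observationGain,
    explainedSquare_of_mem_stdSimplex hp, h0, transfer]
  rw [zero_pow two_ne_zero, sub_zero]
  refine integral_congr_ae (Eventually.of_forall fun x => ?_)
  have hq : ∀ i, (likelihoodMatrix 1 w x *ᵥ p) i = p i * w i x := fun i => by
    rw [likelihoodMatrix_mulVec, transpose_one, one_mulVec, mul_comm]
  have hn : (fun i => b i - p ⬝ᵥ b) ⬝ᵥ (likelihoodMatrix 1 w x *ᵥ p) =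
      ∑ i, p i * (b i - p ⬝ᵥ b) * (w i x - 1) := by
    simp only [mul_sub _ _ (1 : ℝ), mul_one, Finset.sum_sub_distrib, hcent, sub_zero]
    exact Finset.sum_congr rfl fun i _ => by rw [hq]; ring
  simp only [explainedSquare, hn, hq]

/-- A difference quotient of `t ↦ g (x - h j * t)` at zero, with `t = 1 / σ`. -/
theorem tendsto_mul_noiseLikelihood_sub_one (hg : ∀ x, 0 < g x) (hd : Differentiable ℝ g)
    (h : Fin d → ℝ) (j : Fin d) (x : ℝ) :
    Tendsto (fun σ : ℝ => σ * (noiseLikelihood g h σ j x - 1)) atTop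
      (𝓝 (-h j * (deriv g x / g x))) := by
  have h1 : HasDerivAt (fun t : ℝ => g (x - h j * t)) (deriv g x * -h j) 0 := by
    have e1 : HasDerivAt (fun t : ℝ => x - h j * t) (-h j) 0 := by
      simpa using ((hasDerivAt_id (0 : ℝ)).const_mul (h j)).const_sub x
    have e2 : HasDerivAt g (deriv g x) (x - h j * 0) := by simpa using (hd x).hasDerivAt
    exact e2.comp 0 e1
  have h2 := (hasDerivAt_iff_tendsto_slope_zero.1 h1).comp
    ((tendsto_inv_atTop_nhdsGT_zero (𝕜 := ℝ)).mono_right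
      (nhdsWithin_mono _ fun y (hy : 0 < y) => hy.ne'))
  have h3 := h2.div_const (g x)
  have e : deriv g x * -h j / g x = -h j * (deriv g x / g x) := by ring
  rw [e] at h3
  refine h3.congr fun σ => ?_
  have := (hg x).ne'
  simp only [Function.comp_apply, inv_inv, zero_add, mul_zero, sub_zero, smul_eq_mul,
    noiseLikelihood, div_eq_mul_inv (h j)]
  field_simp

theorem abs_mul_noiseLikelihood_sub_one_le (hg : ∀ x, 0 < g x) (hd : Differentiable ℝ g)
    (hd2 : Differentiable ℝ (deriv g)) {C : ℝ} (hC : ∀ x, |deriv (deriv g) x| ≤ C)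
    (h : Fin d → ℝ) {σ : ℝ} (hσ1 : 1 ≤ σ) (hσ : ‖h‖ ≤ δ * σ) (j : Fin d) (x : ℝ) :
    |σ * (noiseLikelihood g h σ j x - 1)| ≤
      (‖h‖ * |deriv g x| + ‖h‖ ^ 2 * localMaxAbs (deriv (deriv g)) δ x) / g x := by
  have hσ0 : 0 < σ := zero_lt_one.trans_le hσ1
  have hu : |-(h j / σ)| ≤ ‖h‖ / σ := by
    rw [abs_neg, abs_div, abs_of_pos hσ0]
    exact div_le_div_of_nonneg_right (norm_le_pi_norm h j) hσ0.le
  have huδ : |-(h j / σ)| ≤ δ := hu.trans ((div_le_iff₀ hσ0).2 hσ)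
  have h1 := abs_sub_le_of_localMaxAbs hd hd2 hC huδ x
  set M := localMaxAbs (deriv (deriv g)) δ x
  have hM0 : 0 ≤ M := (abs_nonneg _).trans (abs_le_localMaxAbs hC huδ x)
  have e : σ * (noiseLikelihood g h σ j x - 1) = σ * (g (x + -(h j / σ)) - g x) / g x := by
    have := (hg x).ne'
    rw [noiseLikelihood, ← sub_eq_add_neg]
    field_simp
  rw [e, abs_div, abs_of_pos (hg x), abs_mul, abs_of_pos hσ0]
  refine div_le_div_of_nonneg_right ?_ (hg x).le
  have h2 : (|deriv g x| + M * |-(h j / σ)|) * |-(h j / σ)| ≤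
      (|deriv g x| + M * ‖h‖) * (‖h‖ / σ) := by
    have h3 : ‖h‖ / σ ≤ ‖h‖ := div_le_self (norm_nonneg _) hσ1
    have h4 := mul_le_mul_of_nonneg_left (hu.trans h3) hM0
    exact mul_le_mul (by linarith) hu (abs_nonneg _) (by positivity)
  calc σ * |g (x + -(h j / σ)) - g x| ≤ σ * ((|deriv g x| + M * ‖h‖) * (‖h‖ / σ)) :=
        mul_le_mul_of_nonneg_left (h1.trans h2) hσ0.le
    _ = _ := by field_simp

theorem localMin_div_le_noiseLikelihood (hg : ∀ x, 0 < g x) (h : Fin d → ℝ) {σ : ℝ}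
    (hσ0 : 0 < σ) (hσ : ‖h‖ ≤ δ * σ) (j : Fin d) (x : ℝ) :
    localMin g δ x / g x ≤ noiseLikelihood g h σ j x := by
  refine div_le_div_of_nonneg_right ?_ (hg x).le
  rw [sub_eq_add_neg]
  refine localMin_le (fun x => (hg x).le) ?_ x
  rw [abs_neg, abs_div, abs_of_pos hσ0, div_le_iff₀ hσ0]
  exact (norm_le_pi_norm h j).trans hσ

/-- Integrand of the scaled gain of one observation. -/
noncomputable def gainIntegrand (g : ℝ → ℝ) (h : Fin d → ℝ) (σ : ℝ) (b p : Fin d → ℝ) (x : ℝ) :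
    ℝ :=
  (∑ i, p i * (b i - p ⬝ᵥ b) * (σ * (noiseLikelihood g h σ i x - 1))) ^ 2 /
    (∑ i, p i * noiseLikelihood g h σ i x)

theorem gainIntegrand_eq (g : ℝ → ℝ) (h : Fin d → ℝ) (σ : ℝ) (b p : Fin d → ℝ) (x : ℝ) :
    gainIntegrand g h σ b p x = σ ^ 2 * ((∑ i, p i * (b i - p ⬝ᵥ b) *
      (noiseLikelihood g h σ i x - 1)) ^ 2 / (∑ i, p i * noiseLikelihood g h σ i x)) := by
  have : ∑ i, p i * (b i - p ⬝ᵥ b) * (σ * (noiseLikelihood g h σ i x - 1)) =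
      σ * ∑ i, p i * (b i - p ⬝ᵥ b) * (noiseLikelihood g h σ i x - 1) := by
    rw [Finset.mul_sum]
    exact Finset.sum_congr rfl fun i _ => by ring
  rw [gainIntegrand, this, mul_pow, mul_div_assoc]

/-- The denominator is at least `localMin g δ x / g x`. In the numerator the centred `b` is at most
`2` and each scaled increment is bounded through the local Taylor estimate; one factor `g x` is then
lowered to the local minimum. The bound is free of `σ`, `p` and `b`. -/
theorem abs_gainIntegrand_le (hg : ∀ x, 0 < g x) (hδ : 0 < δ) (hd : Differentiable ℝ g)
    (hd2 : Differentiable ℝ (deriv g)) {C : ℝ} (hC : ∀ x, |deriv (deriv g) x| ≤ C)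
    (h : Fin d → ℝ) {σ : ℝ} (hσ1 : 1 ≤ σ) (hσ : ‖h‖ ≤ δ * σ) {b p : Fin d → ℝ}
    (hp : p ∈ stdSimplex ℝ (Fin d)) (hb : ‖b‖ ≤ 1) (x : ℝ) :
    |gainIntegrand g h σ b p x| ≤ 8 * ‖h‖ ^ 2 * (deriv g x / localMin g δ x) ^ 2 +
      8 * ‖h‖ ^ 4 * (localMaxAbs (deriv (deriv g)) δ x / localMin g δ x) ^ 2 := by
  have hm := localMin_pos hg hd.continuous hδ x
  have hmg : localMin g δ x ≤ g x := by
    simpa using localMin_le (fun x => (hg x).le) (u := 0) (by simpa using hδ.le) x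
  set m := localMin g δ x
  set M := localMaxAbs (deriv (deriv g)) δ x with hM
  have hgx := hg x
  set Q := (‖h‖ * |deriv g x| + ‖h‖ ^ 2 * M) / g x with hQ
  have hM0 : 0 ≤ M := (abs_nonneg _).trans (abs_le_localMaxAbs hC (v := 0) (by simpa using hδ.le) x)
  have hQ0 : 0 ≤ Q := by positivity
  have hden : m / g x ≤ ∑ i, p i * noiseLikelihood g h σ i x := by
    calc m / g x = ∑ i, p i * (m / g x) := by rw [← Finset.sum_mul, hp.2, one_mul]
      _ ≤ _ := Finset.sum_le_sum fun i _ => mul_le_mul_of_nonneg_left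
          (localMin_div_le_noiseLikelihood hg h (zero_lt_one.trans_le hσ1) hσ i x) (hp.1 i)
  have hmpos : 0 < m / g x := div_pos hm hgx
  have hnum : |∑ i, p i * (b i - p ⬝ᵥ b) * (σ * (noiseLikelihood g h σ i x - 1))| ≤ 2 * Q := by
    calc _ ≤ ∑ i, p i * (2 * Q) := by
          refine (Finset.abs_sum_le_sum_abs _ _).trans (Finset.sum_le_sum fun i _ => ?_)
          rw [abs_mul, abs_mul, abs_of_nonneg (hp.1 i), mul_assoc]
          refine mul_le_mul_of_nonneg_left ?_ (hp.1 i)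
          refine mul_le_mul ?_ (abs_mul_noiseLikelihood_sub_one_le hg hd hd2 hC h hσ1 hσ i x)
            (abs_nonneg _) zero_le_two
          have h1 := (norm_le_pi_norm b i).trans hb
          have h2 := (abs_dotProduct_le_of_mem_stdSimplex hp b).trans hb
          exact (abs_sub _ _).trans (by rw [Real.norm_eq_abs] at h1; linarith)
      _ = 2 * Q := by rw [← Finset.sum_mul, hp.2, one_mul]
  have hsq : (∑ i, p i * (b i - p ⬝ᵥ b) * (σ * (noiseLikelihood g h σ i x - 1))) ^ 2 ≤
      (2 * Q) ^ 2 := by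
    rw [← sq_abs]
    exact pow_le_pow_left₀ (abs_nonneg _) hnum 2
  rw [gainIntegrand, abs_of_nonneg (div_nonneg (sq_nonneg _) (hmpos.le.trans hden))]
  calc _ ≤ (2 * Q) ^ 2 / (m / g x) := div_le_div₀ (sq_nonneg _) hsq hmpos hden
    _ = 4 * (‖h‖ * |deriv g x| + ‖h‖ ^ 2 * M) ^ 2 / (g x * m) := by
        rw [hQ]; field_simp; ring
    _ ≤ 4 * (‖h‖ * |deriv g x| + ‖h‖ ^ 2 * M) ^ 2 / (m * m) :=
        div_le_div_of_nonneg_left (by positivity) (by positivity)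
          (mul_le_mul_of_nonneg_right hmg hm.le)
    _ ≤ (8 * ‖h‖ ^ 2 * |deriv g x| ^ 2 + 8 * ‖h‖ ^ 4 * M ^ 2) / (m * m) := by
        refine div_le_div_of_nonneg_right ?_ (by positivity)
        nlinarith [sq_nonneg (‖h‖ * |deriv g x| - ‖h‖ ^ 2 * M)]
    _ = _ := by rw [sq_abs]; field_simp

theorem tendsto_gainIntegrand_sub (hg : ∀ x, 0 < g x) (hd : Differentiable ℝ g)
    (h : Fin d → ℝ) (x : ℝ) :
    Tendsto (fun z : ℝ × (Fin d → ℝ) × (Fin d → ℝ) => gainIntegrand g h z.1 z.2.2 z.2.1 x -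
        weightedCov z.2.1 z.2.2 h ^ 2 * (deriv g x / g x) ^ 2)
      (atTop ×ˢ 𝓟 (stdSimplex ℝ (Fin d) ×ˢ Metric.closedBall 0 1)) (𝓝 0) := by
  set K : Set ((Fin d → ℝ) × (Fin d → ℝ)) := stdSimplex ℝ (Fin d) ×ˢ Metric.closedBall 0 1
  have hK : IsCompact K := (isCompact_stdSimplex ℝ (Fin d)).prod (isCompact_closedBall 0 1)
  -- Uniformity over `p` and `b`: along any ultrafilter these converge by compactness, and the two
  -- terms then have the same limit.
  refine tendsto_iff_ultrafilter _ _ _ |>.2 fun u hu => ?_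
  have hσ : Tendsto (fun z : ℝ × (Fin d → ℝ) × (Fin d → ℝ) => z.1) u atTop :=
    tendsto_fst.mono_left hu
  have hmem : Tendsto (fun z : ℝ × (Fin d → ℝ) × (Fin d → ℝ) => z.2) u (𝓟 K) :=
    tendsto_snd.mono_left hu
  obtain ⟨⟨p, b⟩, hpb, hlim⟩ := hK.ultrafilter_le_nhds
    (u.map fun z : ℝ × (Fin d → ℝ) × (Fin d → ℝ) => z.2) hmem
  have hp : Tendsto (fun z : ℝ × (Fin d → ℝ) × (Fin d → ℝ) => z.2.1) u (𝓝 p) :=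
    (continuous_fst.tendsto (p, b)).comp hlim
  have hb : Tendsto (fun z : ℝ × (Fin d → ℝ) × (Fin d → ℝ) => z.2.2) u (𝓝 b) :=
    (continuous_snd.tendsto (p, b)).comp hlim
  have hpi := fun i => (tendsto_pi_nhds.1 hp) i
  have hbi := fun i => (tendsto_pi_nhds.1 hb) i
  have hdot : ∀ v : Fin d → ℝ, Tendsto (fun z : ℝ × (Fin d → ℝ) × (Fin d → ℝ) => z.2.1 ⬝ᵥ v) u
      (𝓝 (p ⬝ᵥ v)) := fun v => tendsto_finsetSum _ fun i _ => (hpi i).mul_const _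
  have hdotb : Tendsto (fun z : ℝ × (Fin d → ℝ) × (Fin d → ℝ) => z.2.1 ⬝ᵥ z.2.2) u
      (𝓝 (p ⬝ᵥ b)) := tendsto_finsetSum _ fun i _ => (hpi i).mul (hbi i)
  have hcov : Tendsto (fun z : ℝ × (Fin d → ℝ) × (Fin d → ℝ) => weightedCov z.2.1 z.2.2 h) u
      (𝓝 (weightedCov p b h)) :=
    (tendsto_finsetSum _ fun i _ => ((hpi i).mul (hbi i)).mul_const (h i)).sub
      (hdotb.mul (hdot h))
  have hδ : ∀ i, Tendsto (fun z : ℝ × (Fin d → ℝ) × (Fin d → ℝ) =>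
      z.1 * (noiseLikelihood g h z.1 i x - 1)) u (𝓝 (-h i * (deriv g x / g x))) := fun i =>
    (tendsto_mul_noiseLikelihood_sub_one hg hd h i x).comp hσ
  have hw : ∀ i, Tendsto (fun z : ℝ × (Fin d → ℝ) × (Fin d → ℝ) =>
      noiseLikelihood g h z.1 i x) u (𝓝 1) := fun i => by
    have h1 : Tendsto (fun σ : ℝ => x - h i / σ) atTop (𝓝 (x - 0)) :=
      tendsto_const_nhds.sub (tendsto_const_nhds.div_atTop tendsto_id)
    rw [sub_zero] at h1
    have h2 := ((hd.continuous.tendsto x).comp h1).div_const (g x)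
    rw [div_self (hg x).ne'] at h2
    exact h2.comp hσ
  have hden : Tendsto (fun z : ℝ × (Fin d → ℝ) × (Fin d → ℝ) =>
      ∑ i, z.2.1 i * noiseLikelihood g h z.1 i x) u (𝓝 1) := by
    have h1 := tendsto_finsetSum Finset.univ fun i _ => (hpi i).mul (hw i)
    simpa [hpb.1.2] using h1
  have hnum : Tendsto (fun z : ℝ × (Fin d → ℝ) × (Fin d → ℝ) => ∑ i, z.2.1 i *
      (z.2.2 i - z.2.1 ⬝ᵥ z.2.2) * (z.1 * (noiseLikelihood g h z.1 i x - 1))) u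
      (𝓝 (-(weightedCov p b h * (deriv g x / g x)))) := by
    have h1 := tendsto_finsetSum Finset.univ fun i _ =>
      ((hpi i).mul ((hbi i).sub hdotb)).mul (hδ i)
    convert h1 using 2
    rw [weightedCov_eq_sum, Finset.sum_mul, ← Finset.sum_neg_distrib]
    exact Finset.sum_congr rfl fun i _ => by ring
  have h3 := ((hnum.pow 2).div hden one_ne_zero).sub
    ((hcov.pow 2).mul_const ((deriv g x / g x) ^ 2))
  have e : (-(weightedCov p b h * (deriv g x / g x))) ^ 2 / 1 -
      weightedCov p b h ^ 2 * (deriv g x / g x) ^ 2 = 0 := by ring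
  rw [e] at h3
  exact h3

/-- Dominated by the first integrability condition, because the local minimum is at most `g x`. -/
theorem integrable_fisher (hg : ∀ x, 0 < g x) (hc : Continuous g) (hδ : 0 < δ)
    (hi : Integrable fun x => (deriv g x / localMin g δ x) ^ 2 * g x) :
    Integrable fun x => (deriv g x) ^ 2 / g x := by
  refine hi.mono' ((measurable_deriv g).pow_const 2 |>.div hc.measurable).aestronglyMeasurable
    (Eventually.of_forall fun x => ?_)
  have hm := localMin_pos hg hc hδ x
  have hmg : localMin g δ x ≤ g x := by
    simpa using localMin_le (fun x => (hg x).le) (u := 0) (by simpa using hδ.le) x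
  have hgx := hg x
  rw [Real.norm_eq_abs, abs_of_nonneg (by positivity), div_pow, div_mul_eq_mul_div,
    div_le_div_iff₀ hgx (by positivity), mul_assoc]
  refine mul_le_mul_of_nonneg_left ?_ (sq_nonneg _)
  rw [← sq]
  exact pow_le_pow_left₀ hm.le hmg 2

end Gain

/-! ### Uniform large-noise limit of the one-step gain -/

section GainLimit

variable {d : ℕ} {g : ℝ → ℝ} {δ : ℝ}

theorem measurable_gainIntegrand (hg : ∀ x, 0 < g x) (hc : Continuous g) (h : Fin d → ℝ) (σ : ℝ)
    (b p : Fin d → ℝ) : Measurable (gainIntegrand g h σ b p) := by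
  have hw := (isShiftLikelihood_noiseLikelihood hg hc h σ).measurable
  exact ((Finset.measurable_sum _ fun i _ =>
    (((hw i).sub_const 1).const_mul σ).const_mul _).pow_const 2).div
      (Finset.measurable_sum _ fun i _ => (hw i).const_mul _)

/-- Dominating function for the scaled gain. -/
noncomputable def gainBound (g : ℝ → ℝ) (δ c : ℝ) (x : ℝ) : ℝ :=
  8 * c ^ 2 * (deriv g x / localMin g δ x) ^ 2 +
    8 * c ^ 4 * (localMaxAbs (deriv (deriv g)) δ x / localMin g δ x) ^ 2

theorem integrable_gainBound (hg : ∀ x, 0 < g x) (hc : Continuous g)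
    (hi1 : Integrable fun x => (deriv g x / localMin g δ x) ^ 2 * g x)
    (hi2 : Integrable fun x => (localMaxAbs (deriv (deriv g)) δ x / localMin g δ x) ^ 2 * g x)
    (c : ℝ) : Integrable (gainBound g δ c) (densityLaw g) := by
  have hg0 : ∀ x, 0 ≤ g x := fun x => (hg x).le
  exact (((integrable_densityLaw_iff hg0 hc).2 hi1).const_mul _).add
    (((integrable_densityLaw_iff hg0 hc).2 hi2).const_mul _)

theorem integrable_score_sq (hg : ∀ x, 0 < g x) (hc : Continuous g) (hδ : 0 < δ)
    (hi : Integrable fun x => (deriv g x / localMin g δ x) ^ 2 * g x) :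
    Integrable (fun x => (deriv g x / g x) ^ 2) (densityLaw g) := by
  rw [integrable_densityLaw_iff (fun x => (hg x).le) hc]
  refine (integrable_fisher hg hc hδ hi).congr (Eventually.of_forall fun x => ?_)
  have := (hg x).ne'
  field_simp

theorem integral_score_sq (hg : ∀ x, 0 < g x) (hc : Continuous g) :
    ∫ x, (deriv g x / g x) ^ 2 ∂densityLaw g = fisherInformation g := by
  rw [integral_densityLaw (fun x => (hg x).le) hc, fisherInformation]
  refine integral_congr_ae (Eventually.of_forall fun x => ?_)
  have := (hg x).ne'
  field_simp

theorem eventually_large (K : Set ((Fin d → ℝ) × (Fin d → ℝ))) (hδ : 0 < δ) (c : ℝ) :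
    ∀ᶠ z : ℝ × (Fin d → ℝ) × (Fin d → ℝ) in atTop ×ˢ 𝓟 K,
      (1 ≤ z.1 ∧ c ≤ δ * z.1) ∧ z.2 ∈ K := by
  have hlarge : ∀ᶠ σ : ℝ in atTop, 1 ≤ σ ∧ c ≤ δ * σ :=
    (eventually_ge_atTop 1).and ((tendsto_id.const_mul_atTop hδ).eventually_ge_atTop c)
  refine eventually_prod_principal_iff.2 (hlarge.mono fun σ hσ y hy => ⟨hσ, hy⟩)

/-- Dominated convergence along `atTop ×ˢ 𝓟 K` yields the limit uniformly over the compact set `K`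
of laws and vectors in one stroke. -/
theorem tendsto_integral_gainIntegrand_sub (hg : ∀ x, 0 < g x) (hδ : 0 < δ)
    (hd : Differentiable ℝ g) (hd2 : Differentiable ℝ (deriv g)) {C : ℝ}
    (hC : ∀ x, |deriv (deriv g) x| ≤ C)
    (hi1 : Integrable fun x => (deriv g x / localMin g δ x) ^ 2 * g x)
    (hi2 : Integrable fun x => (localMaxAbs (deriv (deriv g)) δ x / localMin g δ x) ^ 2 * g x)
    (h : Fin d → ℝ) :
    Tendsto (fun z : ℝ × (Fin d → ℝ) × (Fin d → ℝ) =>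
        ∫ x, (gainIntegrand g h z.1 z.2.2 z.2.1 x -
          weightedCov z.2.1 z.2.2 h ^ 2 * (deriv g x / g x) ^ 2) ∂densityLaw g)
      (atTop ×ˢ 𝓟 (stdSimplex ℝ (Fin d) ×ˢ Metric.closedBall 0 1)) (𝓝 0) := by
  have hc := hd.continuous
  have hmeasf : Measurable fun x => (deriv g x / g x) ^ 2 :=
    ((measurable_deriv g).div hc.measurable).pow_const 2
  have hb := (integrable_gainBound hg hc hi1 hi2 ‖h‖).add
    ((integrable_score_sq hg hc hδ hi1).const_mul ((2 * ‖h‖) ^ 2))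
  rw [← integral_zero ℝ ℝ (μ := densityLaw g)]
  refine tendsto_integral_filter_of_dominated_convergence _ ?_ ?_ hb ?_
  · exact Eventually.of_forall fun z => ((measurable_gainIntegrand hg hc h _ _ _).sub
      (hmeasf.const_mul _)).aestronglyMeasurable
  · filter_upwards [eventually_large (stdSimplex ℝ (Fin d) ×ˢ Metric.closedBall 0 1) hδ ‖h‖]
      with z hz
    obtain ⟨⟨h1, h2⟩, hp, hb⟩ := hz
    have hb1 : ‖z.2.2‖ ≤ 1 := by simpa using hb
    refine Eventually.of_forall fun x => ?_
    have e1 := abs_gainIntegrand_le hg hδ hd hd2 hC h h1 h2 hp hb1 x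
    have e2 : weightedCov z.2.1 z.2.2 h ^ 2 ≤ (2 * ‖h‖) ^ 2 := by
      rw [← sq_abs]
      refine pow_le_pow_left₀ (abs_nonneg _) ((abs_weightedCov_le hp _ _).trans ?_) 2
      have := mul_le_mul_of_nonneg_right hb1 (norm_nonneg h)
      linarith
    refine (norm_sub_le _ _).trans (add_le_add e1 ?_)
    rw [Real.norm_eq_abs, abs_of_nonneg (by positivity)]
    exact mul_le_mul_of_nonneg_right e2 (sq_nonneg _)
  · exact Eventually.of_forall fun x => tendsto_gainIntegrand_sub hg hd h x

theorem observationGain_smul_left (γ : Measure ℝ) (w : Fin d → ℝ → ℝ) (b p : Fin d → ℝ) (c : ℝ) :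
    observationGain γ w (c • b) p = c ^ 2 * observationGain γ w b p := by
  have hq : ∀ q : Fin d → ℝ, explainedSquare (c • b) q = c ^ 2 * explainedSquare b q :=
    fun q => by
      simp only [explainedSquare, smul_dotProduct, smul_eq_mul, mul_pow, mul_div_assoc]
  simp only [observationGain, transfer, hq, integral_const_mul, mul_sub]

theorem weightedCov_smul_left (p b h : Fin d → ℝ) (c : ℝ) :
    weightedCov p (c • b) h = c * weightedCov p b h := by
  simp only [← covMatrix_mulVec_dotProduct, dotProduct_smul, smul_eq_mul]

/-- Uniform asymptotics of the gain of one observation in large noise. -/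
theorem eventually_abs_observationGain_sub_le (hg : ∀ x, 0 < g x) (hgi : Integrable g)
    (hg1 : ∫ x, g x = 1) (hδ : 0 < δ) (hd : Differentiable ℝ g)
    (hd2 : Differentiable ℝ (deriv g)) {C : ℝ} (hC : ∀ x, |deriv (deriv g) x| ≤ C)
    (hi1 : Integrable fun x => (deriv g x / localMin g δ x) ^ 2 * g x)
    (hi2 : Integrable fun x => (localMaxAbs (deriv (deriv g)) δ x / localMin g δ x) ^ 2 * g x)
    (h : Fin d → ℝ) {r : ℝ} (hr : 0 < r) :
    ∀ᶠ σ : ℝ in atTop, ∀ p ∈ stdSimplex ℝ (Fin d), ∀ b : Fin d → ℝ,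
      |σ ^ 2 * observationGain (densityLaw g) (noiseLikelihood g h σ) b p -
        fisherInformation g * weightedCov p b h ^ 2| ≤ r * ‖b‖ ^ 2 := by
  have hc := hd.continuous
  have := isProbabilityMeasure_densityLaw (fun x => (hg x).le) hgi hg1
  have hlim := tendsto_integral_gainIntegrand_sub hg hδ hd hd2 hC hi1 hi2 h
  have hev := (Metric.tendsto_nhds.1 hlim r hr).and
    (eventually_large (stdSimplex ℝ (Fin d) ×ˢ Metric.closedBall 0 1) hδ ‖h‖)
  rw [eventually_prod_principal_iff] at hev
  have hball : ∀ᶠ σ : ℝ in atTop, ∀ p ∈ stdSimplex ℝ (Fin d), ∀ b : Fin d → ℝ, ‖b‖ ≤ 1 →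
      |σ ^ 2 * observationGain (densityLaw g) (noiseLikelihood g h σ) b p -
        fisherInformation g * weightedCov p b h ^ 2| ≤ r := by
    filter_upwards [hev] with σ hσ p hp b hb
    obtain ⟨h1, ⟨h2, h3⟩, -⟩ := hσ (p, b) ⟨hp, by simpa using hb⟩
    have hint : Integrable (gainIntegrand g h σ b p) (densityLaw g) :=
      (integrable_gainBound hg hc hi1 hi2 ‖h‖).mono'
        (measurable_gainIntegrand hg hc h σ b p).aestronglyMeasurable
        (Eventually.of_forall fun x => abs_gainIntegrand_le hg hδ hd hd2 hC h h2 h3 hp hb x)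
    rw [dist_zero_right, Real.norm_eq_abs, integral_sub hint
      ((integrable_score_sq hg hc hδ hi1).const_mul _), integral_const_mul,
      integral_score_sq hg hc] at h1
    rw [(isShiftLikelihood_noiseLikelihood hg hc h σ).observationGain_eq hp, ← integral_const_mul,
      mul_comm (fisherInformation g)]
    simp only [gainIntegrand_eq] at h1
    exact h1.le
  filter_upwards [hball] with σ hσ p hp b
  rcases (norm_nonneg b).eq_or_lt with hb | hb
  · have hb0 : b = 0 := norm_eq_zero.1 hb.symm
    subst hb0
    simp [observationGain, transfer, explainedSquare, weightedCov]
  · have h1 := hσ p hp (‖b‖⁻¹ • b)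
      (by rw [norm_smul, norm_inv, norm_norm, inv_mul_cancel₀ hb.ne'])
    rw [observationGain_smul_left, weightedCov_smul_left] at h1
    have e3 : σ ^ 2 * (‖b‖⁻¹ ^ 2 *
          observationGain (densityLaw g) (noiseLikelihood g h σ) b p) -
        fisherInformation g * (‖b‖⁻¹ * weightedCov p b h) ^ 2 =
        (σ ^ 2 * observationGain (densityLaw g) (noiseLikelihood g h σ) b p -
          fisherInformation g * weightedCov p b h ^ 2) / ‖b‖ ^ 2 := by
      field_simp
    rw [e3, abs_div, abs_of_pos (pow_pos hb 2), div_le_iff₀ (pow_pos hb 2)] at h1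
    exact h1

end GainLimit

/-! ### Passage to the limit in time and conclusion -/

theorem fisherInformation_nonneg {g : ℝ → ℝ} (hg : ∀ x, 0 ≤ g x) : 0 ≤ fisherInformation g :=
  integral_nonneg fun x => div_nonneg (sq_nonneg _) (hg x)

/-- The limit of the iterated risks in the stationary regime, compared with the solution of the
Lyapunov equation. -/
theorem IsShiftLikelihood.abs_limit_sub_le {d : ℕ} [Nonempty (Fin d)] {γ : Measure ℝ}
    [IsProbabilityMeasure γ] {k : Fin d → ℝ} {w : Fin d → ℝ → ℝ}
    (hw : IsShiftLikelihood γ k w) {Λ : Matrix (Fin d) (Fin d) ℝ}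
    (hΛ : Λ ∈ rowStochastic ℝ (Fin d)) {μ h : Fin d → ℝ}
    (hμ : IsErgodicWithLimit Λ μ) {I r : ℝ} (hI : 0 ≤ I) {t : ℝ} (ht : 0 < t) (hr0 : 0 ≤ r)
    (hr : r ≤ 1)
    (hgain : ∀ p ∈ stdSimplex ℝ (Fin d), ∀ b : Fin d → ℝ,
      |t ^ 2 * observationGain γ w b p - I * weightedCov p b h ^ 2| ≤ r * ‖b‖ ^ 2)
    {G : ℝ} (hG : ∀ (b : Fin d → ℝ) (n : ℕ),
      ∑ m ∈ Finset.range n, ‖(fun i => ((Λ ^ m) *ᵥ b) i - μ ⬝ᵥ b)‖ ^ 2 ≤ G * ‖b‖ ^ 2)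
    (a : Fin d → ℝ) {E : ℝ}
    (hE : Tendsto (fun n => (transfer γ (likelihoodMatrix Λ w))^[n] (posteriorRisk a) μ) atTop
      (𝓝 E)) :
    |t ^ 2 * (((∑ i, μ i * a i ^ 2) - (∑ i, μ i * a i) ^ 2) - E) -
        a ⬝ᵥ lyapunovSolution Λ μ h I *ᵥ a| ≤
      G * ‖a‖ ^ 2 * (r + 12 * I * ‖h‖ ^ 2 * (∑ i, ((1 + 4 * I * ‖h‖ ^ 2) *
        (G * ‖fun j => Λ j i - μ i‖ ^ 2) + 1) / 2) / t) := by
  have hA := hw.isRandomMatrix hΛ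
  have hμs := hμ.mem_stdSimplex hΛ
  have hP := (hasSum_lyapunovSolution hΛ hμ h I a a).tendsto_sum_nat
  have hlim := (((hE.const_sub ((∑ i, μ i * a i ^ 2) - (∑ i, μ i * a i) ^ 2)).const_mul
    (t ^ 2)).sub hP).abs
  refine le_of_tendsto hlim (Eventually.of_forall fun n => ?_)
  refine le_trans (le_of_eq ?_)
    (hw.abs_iterate_explainedSquare_sub_le hΛ hμ hI ht hr0 hr hgain hG a n)
  rw [hA.iterate_posteriorRisk a n hμs.1, hμ.transpose_pow_mulVec]
  have e1 : (fun i => a i ^ 2) ⬝ᵥ μ = ∑ i, μ i * a i ^ 2 :=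
    Finset.sum_congr rfl fun i _ => mul_comm _ _
  have e2 : μ ⬝ᵥ a = ∑ i, μ i * a i := rfl
  have e3 : ∀ m : ℕ, I * (weightedCov μ ((Λ ^ m) *ᵥ a) h * weightedCov μ ((Λ ^ m) *ᵥ a) h) =
      I * weightedCov μ ((Λ ^ m) *ᵥ a) h ^ 2 := fun m => by ring
  simp only [e1, e2, e3]
  congr 1
  ring

theorem theorem2p2 {d : ℕ} (a h : Fin d → ℝ)
    (Λ : Matrix (Fin d) (Fin d) ℝ) (hΛ : Λ ∈ Matrix.rowStochastic ℝ (Fin d))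
    (μ : Fin d → ℝ) (hμ : IsErgodicWithLimit Λ μ)
    (g : ℝ → ℝ)
    -- `g` is a probability density
    (hg_nonneg : ∀ x, 0 ≤ g x) (hg_int : Integrable g) (hg_one : ∫ x, g x = 1)
    -- `g` does not vanish, is bounded and has two bounded derivatives
    (hg_ne : ∀ x, g x ≠ 0) (hg_bdd : ∃ C, ∀ x, g x ≤ C)
    (hg_diff : Differentiable ℝ g) (hg_diff2 : Differentiable ℝ (deriv g))
    (hg_bdd1 : ∃ C, ∀ x, |deriv g x| ≤ C) (hg_bdd2 : ∃ C, ∀ x, |deriv (deriv g) x| ≤ C)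
    -- the integrability conditions
    (hg_a2 : ∃ δ > 0,
      Integrable (fun x => (deriv g x / localMin g δ x) ^ 2 * g x) ∧
      Integrable (fun x => (localMaxAbs (deriv (deriv g)) δ x / localMin g δ x) ^ 2 * g x)) :
    -- the Fisher information is finite
    Integrable (fun x => (deriv g x) ^ 2 / g x) ∧
    -- existence and uniqueness for the algebraic Lyapunov equation
    ∃ P : Matrix (Fin d) (Fin d) ℝ,
      IsLyapunovSolution Λ μ h (fisherInformation g) P ∧
      (∀ Q, IsLyapunovSolution Λ μ h (fisherInformation g) Q → Q = P) ∧
      -- the stationary minimal mean square error exists, does not depend on the initial law,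
      -- and has the stated asymptotics
      ∃ E : ℝ → ℝ,
        (∀ (Ω : Type*) [MeasurableSpace Ω] (Pr : Measure Ω) [IsProbabilityMeasure Pr]
          (ν : Fin d → ℝ) (S : ℕ → Ω → Fin d) (ξ : ℕ → Ω → ℝ),
          ν ∈ stdSimplex ℝ (Fin d) → IsFilteringModel Pr ν Λ g S ξ →
          ∀ σ > 0, Tendsto (fun n => filteringMMSE Pr a h σ S ξ n) atTop (𝓝 (E σ))) ∧
        Tendsto
          (fun σ : ℝ => σ ^ 2 * (((∑ i, μ i * a i ^ 2) - (∑ i, μ i * a i) ^ 2) - E σ))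
          atTop (𝓝 (a ⬝ᵥ P *ᵥ a)) := by
  obtain ⟨δ, hδ, hi1, hi2⟩ := hg_a2
  obtain ⟨C, hC⟩ := hg_bdd2
  have hg : ∀ x, 0 < g x := fun x => (hg_nonneg x).lt_of_ne' (hg_ne x)
  have hc := hg_diff.continuous
  have hI := fisherInformation_nonneg hg_nonneg
  refine ⟨integrable_fisher hg hc hδ hi1, ?_⟩
  -- With no states there is no initial probability vector, so the filtering claim is vacuous.
  rcases isEmpty_or_nonempty (Fin d) with hd | hd
  · refine ⟨0, ⟨PosSemidef.zero, by simp, Subsingleton.elim _ _⟩,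
      fun Q _ => Subsingleton.elim _ _, 0, ?_, ?_⟩
    · intro Ω _ Pr _ ν S ξ hν
      exact absurd hν.2 (by simp)
    · simp
  have := isProbabilityMeasure_densityLaw hg_nonneg hg_int hg_one
  have hw := fun σ : ℝ => isShiftLikelihood_noiseLikelihood hg hc h σ
  have hex : ∀ σ : ℝ, ∃ E : ℝ, ∀ ν ∈ stdSimplex ℝ (Fin d), Tendsto
      (fun n => (transfer (densityLaw g) (likelihoodMatrix Λ (noiseLikelihood g h σ)))^[n]
        (posteriorRisk a) ν) atTop (𝓝 E) := fun σ => by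
    obtain ⟨m, hm⟩ := hμ.exists_pow_pos
    exact ((hw σ).isRandomMatrix hΛ).exists_tendsto_iterate
      (fun x i j => (hw σ).prodMatrix_pos hΛ m x (hm j i)) hμ.2 (isSuperlinear_posteriorRisk a)
  choose E hE using hex
  refine ⟨lyapunovSolution Λ μ h (fisherInformation g),
    isLyapunovSolution_lyapunovSolution hΛ hμ h hI,
    fun Q hQ => (isLyapunovSolution_lyapunovSolution hΛ hμ h hI).unique hμ hQ, E, ?_, ?_⟩
  · intro Ω _ Pr _ ν S ξ hν hM σ hσ
    simp_rw [hM.filteringMMSE_eq (γ := densityLaw g) hν hΛ rfl hσ (hw σ)]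
    exact hE σ ν hν
  · obtain ⟨G, hG0, hG⟩ := exists_sum_norm_pow_mulVec_sub_le hΛ hμ
    refine Metric.tendsto_nhds.2 fun ε hε => ?_
    set A := G * ‖a‖ ^ 2 with hA
    have hA0 : 0 ≤ A := by positivity
    set c := 12 * fisherInformation g * ‖h‖ ^ 2 * (∑ i, ((1 + 4 * fisherInformation g * ‖h‖ ^ 2) *
        (G * ‖fun j => Λ j i - μ i‖ ^ 2) + 1) / 2) with hcdef
    -- The total error is `A * (r + c / σ)`. This `r` makes the first part at most `ε / 2`, with `A
    -- + 1` avoiding division by zero; large `σ` handles the second.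
    set r := min 1 (ε / (2 * (A + 1))) with hr
    have hr0 : 0 < r := lt_min one_pos (by positivity)
    have hArε : A * r ≤ ε / 2 := by
      have h1 : r ≤ ε / (2 * (A + 1)) := min_le_right _ _
      rw [le_div_iff₀ (by positivity)] at h1
      nlinarith
    have hsmall : Tendsto (fun σ : ℝ => A * (c / σ)) atTop (𝓝 0) := by
      simpa using ((tendsto_const_nhds (x := c)).div_atTop tendsto_id).const_mul A
    filter_upwards [eventually_abs_observationGain_sub_le hg hg_int hg_one hδ hg_diff hg_diff2 hC
      hi1 hi2 h hr0, eventually_gt_atTop 0, hsmall.eventually (gt_mem_nhds (half_pos hε))]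
      -- The error bound is available only in the stationary regime, which suffices since `E σ` is
      -- also the limit from `ν = μ`.
      with σ h1 h2 h3
    have h4 := (hw σ).abs_limit_sub_le hΛ hμ hI h2 hr0.le (min_le_left _ _) h1 hG a
      (hE σ μ (hμ.mem_stdSimplex hΛ))
    rw [Real.dist_eq]
    refine h4.trans_lt ?_
    rw [mul_add]
    linarith
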